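/- **Setting.** Let $d,M\in\mathbb N$, $T>0$, let $A\subset\mathbb R^d$ be compact with convex hull $\mathrm{co}(A)$ (so $\mathrm{co}(A)=A$ if $A$ is convex). Let $b(t,x,a)\in\mathbb R^d$ and $\sigma(t,x)\in\mathbb R^{d\times d}$ be continuous for $t\in[0,T]$, $x\in\mathbb R^d$, $a\in \mathrm{co}(A)$ and satisfy, for some $K>0$, $|b(t,x_1,a_1)-b(t,x_2,a_2)|\le K(|x_1-x_2|+|a_1-a_2|)$, $|\sigma(t,x_1)-\sigma(t,x_2)|\le K|x_1-x_2|$ and $|b(t,x,a)|+|\sigma(t,x)|\le K(1+|x|+|a|)$. Let $b$ be differentiable in $a$ at every $a\in A$, let $\Psi=(\Psi_1,\dots,\Psi_M)$ have Lipschitz entries $\Psi_j:\mathbb R^d\to\mathbb R$, let $\bar\Lambda\in\mathbb R^{M\times M}$, and let $\mu_0^1,\dots,\mu_0^M$ be initial laws on $\mathbb R^d$. For $r,\delta>0$ let $\phi_r=\gamma_\delta*\mathbb I_r$, where $\mathbb I_r$ is the indicator function of the ball $B_r$ of radius $r$ about $0$ divided by its volume, $\gamma_\delta(x)=\delta^{-d}\gamma(x/\delta)$,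 and $\gamma$ is a smooth, even probability density with compact support. Put $G_{\phi_r}[m](t,x)=\big(\int\phi_r(x-y)m_j(t,y)\,dy\big)_{j=1}^M$. $\mathcal A_d$ is the set of measurable $a:[0,T]\times\mathbb R^d\to A$. A *state* for $a=(a^1,\dots,a^M)\in\mathcal A_d^M$ is a vector $m=(m_1,\dots,m_M)$ of measurable functions on $[0,T]\times\mathbb R^d$ such that each $m_j(t,\cdot)$ is a probability density with finite second moment, $t\mapsto m_j(t,\cdot)$ is continuous on $[0,T]$ for weak convergence together with convergence of second moments, $m_j(0,\cdot)$ is the density of $\mu_0^j$, and $m_j$ is a weak solution of $\partial_t m_j=\tfrac12\mathrm{tr}(\nabla^2(\sigma\sigma^Tm_j))-\nabla\cdot(b(t,x,a^j(t,x))m_j)$: for all $f\in C_b^2(\mathbb R^d)$ and $t\in[0,T]$, $$\int f\,m_j(t,x)\,dx-\int f\,m_j(0,x)\,dx=\int_0^t\!\!\int\Big(b(s,x,a^j(s,x))\cdot\nabla f+\tfrac12\mathrm{tr}(\sigma\sigma^T\nabla^2f)\Big)m_j(s,x)\,dx\,ds .$$ The problem (OC) is to minimize, over all $a\in\mathcal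 A_d^M$ and all states $m$ for $a$, $$J(a,m)=\int_{\mathbb R^d}\Big[\int_0^T f(t,x,a,m)\,dt+\Psi(x)\cdot m(T,x)\Big]dx,\qquad f(t,x,a,m)=\tfrac12\sum_{j}|a^j(t,x)|^2m_j(t,x)+G_{\phi_r}[m]^T\bar\Lambda\, m(t,x).$$ **Theorem.** Let $\hat a\in\mathcal A_d^M$ and let $\hat m$ be a state for $\hat a$. Let $$H(t,x,a,m,p)=f(t,x,a,m)+\sum_{j=1}^M b(t,x,a^j(t,x))\,m_j(t,x)\cdot\nabla p_j(t,x),$$ and let $p=(p_1,\dots,p_M)$ solve the adjoint equation $$\frac{\partial p_j}{\partial t}=-\Big(\tfrac12|\hat a^j|^2+\big(G_{\phi_r}[\hat m]^T(\bar\Lambda+\bar\Lambda^T)\big)_j+b(t,x,\hat a^j)\cdot\nabla p_j+\tfrac12\mathrm{tr}(\sigma\sigma^T\nabla^2p_j)\Big),\qquad p_j(T,\cdot)=\Psi_j ,$$ in the following sense: $p_j$ is continuous on $[0,T]\times\mathbb R^d$; on $[0,T)\times\mathbb R^d$ it is twice differentiable in $x$ with $\nabla p_j$, $\nabla^2p_j$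 continuous, $|\nabla p_j|\le C(1+|x|)$, and $\nabla^2p_j$ bounded on $[0,\tau]\times\mathbb R^d$ for every $\tau<T$; and for a.e. $x$ the equation, integrated in time over $[s,t]$, holds for all $s,t\in[0,T)$ (as it does for classical solutions with these bounds). Consider, for each $t\in[0,T)$, the map $$(a,m)\longmapsto\int_{\mathbb R^d}H(t,x,a,m,p)\,dx$$ on pairs of an $M$-vector of measurable $\mathrm{co}(A)$-valued functions $a^j$ on $\mathbb R^d$ and an $M$-vector of probability densities $m_j$ on $\mathbb R^d$ with finite second moments. Assume that one of the following holds: 1. for every $t\in[0,T)$ this map is convex in the pair $(a,m)$; or 2. for every $t\in[0,T)$ it is convex in $a$ for fixed $m$ and convex in $m$ for fixed $a$, and $\hat m_j>0$ a.e. on $[0,T]\times\mathbb R^d$ for every $j$. If for all $j\in\{1,\dots,M\}$ and all $w^j\in\mathcal A_d$ the function $D_{a^j}H(t,x,\hat a(t,x),\hat m(t,x),p)\cdot w^j(t,x)$ is integrable on $[0,T]\times\mathbb R^d$ and $$\int_{\mathbb R^d}\int_0^T D_{a^j}H(t,x,\hat a(t,x),\hat m(t,x),p)\cdot w^j(t,x)\,dt\,dx=0,$$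 then $\hat a$ (with state $\hat m$) solves (OC): $J(\hat a,\hat m)\le J(a,m)$ for all $a\in\mathcal A_d^M$ and all states $m$ for $a$. -/

import Mathlib

open MeasureTheory Set
open scoped ContDiff Matrix

noncomputable section

/-- `ℝ^d` with the Euclidean norm. -/
abbrev Pt (d : ℕ) : Type := EuclideanSpace ℝ (Fin d)

/-- The Hessian matrix of a function on `ℝ^d`. -/
def hessian {d : ℕ} (f : Pt d → ℝ) (x : Pt d) : Matrix (Fin d) (Fin d) ℝ :=
  Matrix.of fun i k =>
    iteratedFDeriv ℝ 2 f x ![EuclideanSpace.single i (1 : ℝ), EuclideanSpace.single k (1 : ℝ)]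

/-- The Frobenius norm of a matrix. -/
def frobNorm {d : ℕ} (B : Matrix (Fin d) (Fin d) ℝ) : ℝ :=
  Real.sqrt (∑ i, ∑ k, B i k ^ 2)

/-- `f ∈ C_b^2(ℝ^d)`: twice continuously differentiable, bounded with its first and second
derivatives. -/
def IsCb2 {d : ℕ} (f : Pt d → ℝ) : Prop :=
  ContDiff ℝ 2 f ∧
    ∃ C : ℝ, ∀ x, |f x| ≤ C ∧ ‖fderiv ℝ f x‖ ≤ C ∧ ‖iteratedFDeriv ℝ 2 f x‖ ≤ C

/-- `u` is the density of a probability measure on `ℝ^d` with finite second moment. -/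
structure IsDensity2 {d : ℕ} (u : Pt d → ℝ) : Prop where
  measurable : Measurable u
  nonneg : ∀ x, 0 ≤ u x
  integrable : Integrable u
  integral_eq_one : ∫ x, u x = 1
  secondMoment : Integrable fun x => ‖x‖ ^ 2 * u x

/-- The raw data of the control problem with `M` crowds moving in `ℝ^d`
(the assumptions on the data are in `CrowdModel.Standing`). -/
structure CrowdModel (d M : ℕ) where
  /-- time horizon -/
  T : ℝ
  /-- set of control values -/
  A : Set (Pt d)
  /-- drift `b(t,x,a)` -/
  b : ℝ → Pt d → Pt d → Pt d
  /-- diffusion coefficient `σ(t,x)` -/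
  σ : ℝ → Pt d → Matrix (Fin d) (Fin d) ℝ
  /-- final costs `Ψ_j` -/
  Ψ : Fin M → Pt d → ℝ
  /-- crowd aversion weights (the matrix written `Λ` with a bar) -/
  Λ : Matrix (Fin M) (Fin M) ℝ
  /-- initial distributions -/
  μ₀ : Fin M → Measure (Pt d)
  /-- mollifier profile -/
  γ : Pt d → ℝ
  /-- mollification parameter -/
  δ : ℝ
  /-- radius of the personal space -/
  r : ℝ

namespace CrowdModel

variable {d M : ℕ} (S : CrowdModel d M)

/-- Standing assumptions. The drift is considered for control values in the convex hull of `A`,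
which is `A` itself if `A` is convex. -/
structure Standing : Prop where
  T_pos : 0 < S.T
  compact_A : IsCompact S.A
  r_pos : 0 < S.r
  δ_pos : 0 < S.δ
  γ_smooth : ContDiff ℝ ∞ S.γ
  γ_compactSupport : HasCompactSupport S.γ
  γ_nonneg : ∀ x, 0 ≤ S.γ x
  γ_symm : ∀ x, S.γ (-x) = S.γ x
  γ_integral : ∫ x, S.γ x = 1
  b_continuous : ContinuousOn (fun q : ℝ × Pt d × Pt d => S.b q.1 q.2.1 q.2.2)
    (Icc 0 S.T ×ˢ (univ ×ˢ convexHull ℝ S.A))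
  σ_continuous : ContinuousOn (fun q : ℝ × Pt d => S.σ q.1 q.2) (Icc 0 S.T ×ˢ univ)
  lipschitz_growth : ∃ K : ℝ, 0 < K ∧ ∀ t ∈ Icc 0 S.T, ∀ x₁ x₂ : Pt d,
    ∀ a₁ ∈ convexHull ℝ S.A, ∀ a₂ ∈ convexHull ℝ S.A,
      ‖S.b t x₁ a₁ - S.b t x₂ a₂‖ ≤ K * (‖x₁ - x₂‖ + ‖a₁ - a₂‖) ∧
      frobNorm (S.σ t x₁ - S.σ t x₂) ≤ K * ‖x₁ - x₂‖ ∧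
      ‖S.b t x₁ a₁‖ + frobNorm (S.σ t x₁) ≤ K * (1 + ‖x₁‖ + ‖a₁‖)
  Ψ_lipschitz : ∃ K : ℝ, 0 < K ∧ ∀ j, ∀ x₁ x₂ : Pt d, |S.Ψ j x₁ - S.Ψ j x₂| ≤ K * ‖x₁ - x₂‖
  /-- `D_a b` exists at the control values. -/
  b_differentiable : ∀ t ∈ Icc 0 S.T, ∀ x, ∀ α ∈ S.A, DifferentiableAt ℝ (S.b t x) α

/-- The normalized indicator function of the ball of radius `r` about the origin. -/
def ballIndicator (x : Pt d) : ℝ :=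
  (Metric.ball (0 : Pt d) S.r).indicator
    (fun _ => (volume (Metric.ball (0 : Pt d) S.r)).toReal⁻¹) x

/-- The rescaled mollifier `γ_δ`. -/
def mollifier (x : Pt d) : ℝ := (S.δ ^ d)⁻¹ * S.γ (S.δ⁻¹ • x)

/-- The interaction kernel `φ_r`, the convolution of `γ_δ` and the normalized indicator. -/
def kernel (x : Pt d) : ℝ := ∫ y, S.mollifier (x - y) * S.ballIndicator y

/-- The `j`-th entry of `G_{φ_r}[m](x)`; here `m` is a vector of densities at a fixed time. -/
def G (m : Fin M → Pt d → ℝ) (x : Pt d) (j : Fin M) : ℝ := ∫ y, S.kernel (x - y) * m j y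

/-- The generator term `½ tr(σσᵀ(t,x) ∇²f(x))`. -/
def diffusionTerm (t : ℝ) (f : Pt d → ℝ) (x : Pt d) : ℝ :=
  (1 / 2) * (S.σ t x * (S.σ t x)ᵀ * hessian f x).trace

/-- The set `𝒜_d` of admissible deterministic controls: measurable and `A`-valued. Since `A` is
bounded, `∫∫ |a|² m dx dt < ∞` holds for every flow `m` of probability densities. -/
def IsControl (a : ℝ → Pt d → Pt d) : Prop :=
  Measurable (Function.uncurry a) ∧ ∀ t x, a t x ∈ S.A

/-- `m = (m_1,…,m_M)` is a state for the control vector `a`: for each `j`, `m_j` is a weak solution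
of `∂m_j/∂t = ½ tr(∇²(σσᵀ m_j)) - ∇·(b(t,x,a^j) m_j)` with `m_j(0,·)` the density of `μ₀ j`, given
by a curve of densities that is continuous on `[0,T]` for the topology of weak convergence of
probability measures and convergence of second moments. -/
structure IsState (a : Fin M → ℝ → Pt d → Pt d) (m : Fin M → ℝ → Pt d → ℝ) : Prop where
  measurable : ∀ j, Measurable (Function.uncurry (m j))
  density : ∀ j, ∀ t ∈ Icc 0 S.T, IsDensity2 (m j t)
  weak_continuous : ∀ j, ∀ g : BoundedContinuousFunction (Pt d) ℝ,
    ContinuousOn (fun t => ∫ x, g x * m j t x) (Icc 0 S.T)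
  moment_continuous : ∀ j, ContinuousOn (fun t => ∫ x, ‖x‖ ^ 2 * m j t x) (Icc 0 S.T)
  equation : ∀ j, ∀ f : Pt d → ℝ, IsCb2 f → ∀ t ∈ Icc 0 S.T,
    (∫ x, f x * m j t x) - (∫ x, f x * m j 0 x) =
      ∫ s in (0 : ℝ)..t, ∫ x,
        (inner ℝ (S.b s x (a j s x)) (gradient f x) + S.diffusionTerm s f x) * m j s x
  initial : ∀ j, S.μ₀ j = volume.withDensity fun x => ENNReal.ofReal (m j 0 x)

/-- The running cost `f = ½|a|²·m + G_{φ_r}[m]ᵀ Λ m` at a point `x`, where `α` is the vector of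
control values at `x` and `m` the vector of densities at the current time. -/
def runningCost (x : Pt d) (α : Fin M → Pt d) (m : Fin M → Pt d → ℝ) : ℝ :=
  (∑ j, (1 / 2) * ‖α j‖ ^ 2 * m j x) + S.G m x ⬝ᵥ (S.Λ *ᵥ fun j => m j x)

/-- The cost functional of the control problem. -/
def cost (a : Fin M → ℝ → Pt d → Pt d) (m : Fin M → ℝ → Pt d → ℝ) : ℝ :=
  ∫ x, ((∫ t in (0 : ℝ)..S.T, S.runningCost x (fun j => a j t x) (fun j => m j t)) +
    ∑ j, S.Ψ j x * m j S.T x)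

/-- The control vector `a`, with state `m`, solves the optimal control problem: it minimizes the
cost among all admissible control vectors and all states that belong to them. -/
def SolvesOC (a : Fin M → ℝ → Pt d → Pt d) (m : Fin M → ℝ → Pt d → ℝ) : Prop :=
  (∀ j, S.IsControl (a j)) ∧ S.IsState a m ∧
    ∀ a' m', (∀ j, S.IsControl (a' j)) → S.IsState a' m' → S.cost a m ≤ S.cost a' m'

/-- The Hamiltonian `H(t,x,a,m,p) = f + ∑_j b(t,x,a^j) m_j · ∇p_j`, as a function of the control
values `α` at `(t,x)` and the vector `m` of densities at time `t`. -/
def hamiltonian (t : ℝ) (x : Pt d) (α : Fin M → Pt d) (m : Fin M → Pt d → ℝ)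
    (p : Fin M → ℝ → Pt d → ℝ) : ℝ :=
  S.runningCost x α m + ∑ j, inner ℝ (m j x • S.b t x (α j)) (gradient (p j t) x)

/-- The partial derivative `D_{a^j} H(t,x,α,m,p) · w`. -/
def dHamiltonian (j : Fin M) (t : ℝ) (x : Pt d) (α : Fin M → Pt d) (m : Fin M → Pt d → ℝ)
    (p : Fin M → ℝ → Pt d → ℝ) (w : Pt d) : ℝ :=
  fderiv ℝ (fun v => S.hamiltonian t x (Function.update α j v) m p) (α j) w

/-- The bracket on the right-hand side of the adjoint equation for `p_j`, at `(t,x)`. -/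
def adjointBracket (a : Fin M → ℝ → Pt d → Pt d) (m p : Fin M → ℝ → Pt d → ℝ)
    (j : Fin M) (t : ℝ) (x : Pt d) : ℝ :=
  (1 / 2) * ‖a j t x‖ ^ 2 + (S.G (fun k => m k t) x ᵥ* (S.Λ + S.Λᵀ)) j +
    inner ℝ (S.b t x (a j t x)) (gradient (p j t) x) + S.diffusionTerm t (p j t) x

/-- `p` solves the backward adjoint equation `∂p_j/∂t = -(adjointBracket)`, `p_j(T,·) = Ψ_j`:
`p_j` is continuous on `[0,T] × ℝ^d`, twice differentiable in `x` on `[0,T) × ℝ^d` with continuous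
derivatives there, `∇p_j` grows at most linearly, `∇²p_j` is bounded away from the final time, and
the equation holds in integrated form in time (for a classical solution this is the fundamental
theorem of calculus; as the control is only measurable, `∂p_j/∂t` need not be continuous). -/
structure IsAdjoint (a : Fin M → ℝ → Pt d → Pt d) (m p : Fin M → ℝ → Pt d → ℝ) : Prop where
  continuous : ∀ j, ContinuousOn (Function.uncurry (p j)) (Icc 0 S.T ×ˢ univ)
  contDiff : ∀ j, ∀ t ∈ Ico 0 S.T, ContDiff ℝ 2 (p j t)
  gradient_continuous : ∀ j,
    ContinuousOn (fun q : ℝ × Pt d => gradient (p j q.1) q.2) (Ico 0 S.T ×ˢ univ)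
  hessian_continuous : ∀ j,
    ContinuousOn (fun q : ℝ × Pt d => iteratedFDeriv ℝ 2 (p j q.1) q.2) (Ico 0 S.T ×ˢ univ)
  gradient_growth : ∃ C : ℝ, ∀ j, ∀ t ∈ Ico 0 S.T, ∀ x, ‖gradient (p j t) x‖ ≤ C * (1 + ‖x‖)
  hessian_bound : ∀ τ ∈ Ico 0 S.T, ∃ C : ℝ, ∀ j, ∀ t ∈ Icc 0 τ, ∀ x,
    ‖iteratedFDeriv ℝ 2 (p j t) x‖ ≤ C
  equation : ∀ j, ∀ᵐ x, ∀ s ∈ Ico 0 S.T, ∀ t ∈ Ico 0 S.T,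
    p j t x - p j s x = -∫ u in s..t, S.adjointBracket a m p j u x
  terminal : ∀ j x, p j S.T x = S.Ψ j x

/-- Vectors of control profiles at a fixed time, with values in the convex hull of `A`. -/
def controlProfiles : Set (Fin M → Pt d → Pt d) :=
  {a | ∀ j, Measurable (a j) ∧ ∀ x, a j x ∈ convexHull ℝ S.A}

/-- Vectors of probability densities on `ℝ^d` with finite second moments. -/
def densityProfiles : Set (Fin M → Pt d → ℝ) := {m | ∀ j, IsDensity2 (m j)}

/-- `∫ H(t,x,a,m,p) dx` as a function of the profiles `a` and `m` at time `t`. -/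
def totalHamiltonian (p : Fin M → ℝ → Pt d → ℝ) (t : ℝ)
    (a : Fin M → Pt d → Pt d) (m : Fin M → Pt d → ℝ) : ℝ :=
  ∫ x, S.hamiltonian t x (fun j => a j x) m p

/-- `(a,m) ↦ ∫ H(t,x,a,m,p) dx` is convex in the pair `(a,m)`, for every `t` (at `t = T`, where
`∇p` need not exist, nothing is asked). -/
def HamiltonianConvex (p : Fin M → ℝ → Pt d → ℝ) : Prop :=
  ∀ t ∈ Ico 0 S.T,
    ConvexOn ℝ (S.controlProfiles ×ˢ densityProfiles) fun q => S.totalHamiltonian p t q.1 q.2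

/-- `(a,m) ↦ ∫ H(t,x,a,m,p) dx` is convex in `a` for fixed `m` and in `m` for fixed `a`, for
every `t`. -/
def HamiltonianSepConvex (p : Fin M → ℝ → Pt d → ℝ) : Prop :=
  ∀ t ∈ Ico 0 S.T,
    (∀ m ∈ densityProfiles, ConvexOn ℝ S.controlProfiles fun a => S.totalHamiltonian p t a m) ∧
    (∀ a ∈ S.controlProfiles, ConvexOn ℝ densityProfiles fun m => S.totalHamiltonian p t a m)

/-- The first variation of `H` in the controls vanishes: for all `j` and all `w ∈ 𝒜_d` the
integral `∫∫ D_{a^j}H(t,x,a,m,p) · w dt dx` exists and is zero. -/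
def FirstVariationVanishes (a : Fin M → ℝ → Pt d → Pt d) (m p : Fin M → ℝ → Pt d → ℝ) : Prop :=
  ∀ j, ∀ w, S.IsControl w →
    IntegrableOn (fun z : ℝ × Pt d => S.dHamiltonian j z.1 z.2 (fun k => a k z.1 z.2)
      (fun k => m k z.1) p (w z.1 z.2)) (Icc 0 S.T ×ˢ univ) ∧
    ∫ x, ∫ t in (0 : ℝ)..S.T, S.dHamiltonian j t x (fun k => a k t x)
      (fun k => m k t) p (w t x) = 0

end CrowdModel

end

/-! Write 𝓗(a,m) for the Hamiltonian integrated over space at a fixed time, and (â,m̂) for the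
reference pair. Testing the equation of a competing state m' with the adjoint state p replaces the
terminal cost by an initial term and a space-time integral: by `state_adjoint_duality`, ∫ Ψ_j
m'_j(T) - ∫ p_j(0) m'_j(0) is the integral of (∂_t p_j + L^{a'} p_j) m'_j, with L^{a'} the generator
for a'. All states share the initial laws, so the initial term is common to all competitors. The
bracket of the adjoint equation without its diffusion term is the derivative of 𝓗 in the density (Λ
+ Λᵀ appears because the kernel is even). Hence, by `cost_eq` and `integral_reducedCost`, J(a',m') -
J(â,m̂) = ∫ [𝓗(a',m') - 𝓗(â,m̂) - D_m𝓗(â,m̂)(m' - m̂)] dt, and it suffices that the integrand is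
nonnegative for almost every t.

A convex function dominates its one-sided derivative along a segment (`segment_derivative_le`).
Under joint convexity, the segment from (â,m̂) to (a',m') bounds the integrand below by
D_a𝓗(â,m̂)(a' - â). This vanishes: controls may be switched on any measurable set, so the vanishing
first variation localizes to a pointwise identity (`FirstVariationVanishes.ae_eq_zero`). Under
separate convexity, first the density moves with â frozen, then the control moves with m' frozen.
The control derivative is then weighted by m'_j instead of m̂_j; positivity of m̂_j removes the
weight from the pointwise identity, so it vanishes as well.

The analytic work is the duality, because p is only a primitive in time of a measurable function,
may grow quadratically, and has second derivatives controlled only before T. So p is multiplied by a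
spatial cutoff, and the weak equation is tested with translates of a smooth kernel. For each centre
y two absolutely continuous functions of time are multiplied; integrating in y and shrinking the
kernel gives the identity on [0,τ] with τ < T (`duality_cutoff`). Then τ tends to T, and finally the
cutoff is removed by dominated convergence: derivatives of the cutoff decay like inverse powers of
its radius, so all terms stay below a multiple of (1 + |x|)² m', which is integrable. -/

open MeasureTheory Set
open scoped ContDiff Matrix

noncomputable section

/-! ### Duality for bounded test functions with merely measurable time derivative -/

section MollifiedDuality

open Function Filter Topology

/-- The product rule, in integrated form, for two integrals with variable upper limit. -/
theorem mul_sub_mul_eq_integral_of_eq_integral {F G f g : ℝ → ℝ} {τ : ℝ} (hτ : 0 ≤ τ)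
    (hf : IntervalIntegrable f volume 0 τ) (hg : IntervalIntegrable g volume 0 τ)
    (hF : ∀ t ∈ Icc 0 τ, F t - F 0 = ∫ u in (0 : ℝ)..t, f u)
    (hG : ∀ t ∈ Icc 0 τ, G t - G 0 = ∫ u in (0 : ℝ)..t, g u) :
    F τ * G τ - F 0 * G 0 = ∫ u in (0 : ℝ)..τ, (f u * G u + F u * g u) := by
  -- `F` and `G` are known only on `[0, τ]`. Integration by parts is applied to the primitives
  -- agreeing with them there; these are absolutely continuous, with derivatives `f` and `g` almost
  -- everywhere.
  have hac : ∀ (c : ℝ) {k : ℝ → ℝ}, IntervalIntegrable k volume 0 τ →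
      AbsolutelyContinuousOnInterval (fun t => c + ∫ u in (0 : ℝ)..t, k u) 0 τ := by
    intro c k hk
    have h1 := hk.absolutelyContinuousOnInterval_intervalIntegral (c := 0) (by simp)
    have h2 : AbsolutelyContinuousOnInterval (fun _ : ℝ => c) 0 τ :=
      (LipschitzWith.const c).lipschitzOnWith.absolutelyContinuousOnInterval (K := 0)
    exact h2.add h1
  have hτ' : τ ∈ Icc 0 τ := ⟨hτ, le_rfl⟩
  have key := (hac (F 0) hf).integral_deriv_mul_eq_sub (hac (G 0) hg)
  simp only [intervalIntegral.integral_same, add_zero] at key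
  rw [← hF τ hτ', ← hG τ hτ', add_sub_cancel, add_sub_cancel] at key
  rw [← key]
  apply intervalIntegral.integral_congr_ae
  filter_upwards [hf.ae_hasDerivAt_integral, hg.ae_hasDerivAt_integral] with u h1 h2 hu
  have hu' : u ∈ uIcc 0 τ := uIoc_subset_uIcc hu
  have hu'' : u ∈ Icc 0 τ := by rwa [uIcc_of_le hτ] at hu'
  rw [((h1 hu' 0 (by simp)).const_add (F 0)).deriv, ((h2 hu' 0 (by simp)).const_add (G 0)).deriv,
    ← hF u hu'', ← hG u hu'']
  ring

variable {d : ℕ}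

/-- Integrate in `y` first: by translation invariance the kernel contributes the constant `∫ ‖ρ‖`,
so integrability of `c` is enough, and `h` is a bounded factor. -/
theorem integrable_mul_kernel {ν : Measure ℝ} [SFinite ν] {c h : ℝ → Pt d → ℝ} {ρ : Pt d → ℝ}
    (hc : Integrable (uncurry c) (ν.prod volume)) (hρm : Measurable ρ) (hρ : Integrable ρ)
    (hh : Measurable (uncurry h)) {C : ℝ} (hC : ∀ u y, |h u y| ≤ C) :
    Integrable (fun z : (ℝ × Pt d) × Pt d => c z.1.1 z.1.2 * (ρ (z.1.2 - z.2) * h z.1.1 z.2))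
      ((ν.prod volume).prod volume) := by
  have hcm : AEStronglyMeasurable (fun z : (ℝ × Pt d) × Pt d => c z.1.1 z.1.2)
      ((ν.prod volume).prod volume) := hc.aestronglyMeasurable.comp_fst (f := uncurry c)
  have hρm' : Measurable fun z : (ℝ × Pt d) × Pt d => ρ (z.1.2 - z.2) := by fun_prop
  have hhm' : Measurable fun z : (ℝ × Pt d) × Pt d => h z.1.1 z.2 :=
    hh.comp (by fun_prop : Measurable fun z : (ℝ × Pt d) × Pt d => (z.1.1, z.2))
  have h1 : Integrable (fun z : (ℝ × Pt d) × Pt d => c z.1.1 z.1.2 * ρ (z.1.2 - z.2))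
      ((ν.prod volume).prod volume) := by
    refine (integrable_prod_iff (hcm.mul hρm'.aestronglyMeasurable)).2 ?_
    refine ⟨Eventually.of_forall fun z => (hρ.comp_sub_left z.2).const_mul (c z.1 z.2), ?_⟩
    have : (fun z : ℝ × Pt d => ∫ y, ‖c z.1 z.2 * ρ (z.2 - y)‖) =
        fun z => ‖uncurry c z‖ * ∫ y, ‖ρ y‖ := by
      funext z
      simp_rw [norm_mul]
      rw [integral_const_mul, integral_sub_left_eq_self (fun y => ‖ρ y‖)]
      rfl
    exact (hc.norm.mul_const _).congr (Eventually.of_forall fun z => (congrFun this z).symm)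
  have h2 := h1.mul_bdd (c := C) hhm'.aestronglyMeasurable (Eventually.of_forall fun z => hC _ _)
  simpa only [mul_assoc] using h2

/-- Fubini for the triple integral over `u`, `x`, `y`: the kernel can be attached to the coefficient
`c` or to the test function `h`. The integrability for almost every `y` permits work at a fixed
centre. -/
theorem integral_mul_kernel_comm {ν : Measure ℝ} [SFinite ν] {c h : ℝ → Pt d → ℝ} {ρ : Pt d → ℝ}
    (hc : Integrable (uncurry c) (ν.prod volume)) (hρm : Measurable ρ) (hρ : Integrable ρ)
    (hh : Measurable (uncurry h)) {C : ℝ} (hC : ∀ u y, |h u y| ≤ C) :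
    (∀ᵐ y, Integrable (fun u => h u y * ∫ x, c u x * ρ (x - y)) ν) ∧
    Integrable (fun y => ∫ u, h u y * (∫ x, c u x * ρ (x - y)) ∂ν) ∧
    Integrable (fun u => ∫ x, c u x * ∫ y, ρ (x - y) * h u y) ν ∧
    ∫ y, ∫ u, h u y * (∫ x, c u x * ρ (x - y)) ∂ν =
      ∫ u, (∫ x, c u x * ∫ y, ρ (x - y) * h u y) ∂ν := by
  have hI := integrable_mul_kernel hc hρm hρ hh hC
  have hsec := hI.prod_left_ae
  have e1 : ∀ u y, h u y * (∫ x, c u x * ρ (x - y)) =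
      ∫ x, c u x * (ρ (x - y) * h u y) := fun u y => by
    rw [← integral_const_mul]; congr 1; funext x; ring
  have e2 : ∀ u x, c u x * (∫ y, ρ (x - y) * h u y) = ∫ y, c u x * (ρ (x - y) * h u y) :=
    fun u x => by rw [← integral_const_mul]
  simp_rw [e1, e2]
  have hy : (fun y => ∫ u, (∫ x, c u x * (ρ (x - y) * h u y)) ∂ν) =ᵐ[volume]
      fun y => ∫ z : ℝ × Pt d, c z.1 z.2 * (ρ (z.2 - y) * h z.1 y) ∂(ν.prod volume) := by
    filter_upwards [hsec] with y hy
    exact (integral_prod _ hy).symm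
  have hfst := hI.integral_prod_left
  refine ⟨?_, ?_, hfst.integral_prod_left, ?_⟩
  · filter_upwards [hsec] with y hy
    exact hy.integral_prod_left
  · exact hI.integral_prod_right.congr hy.symm
  · rw [integral_congr_ae hy, ← integral_prod_symm _ hI, integral_prod _ hI,
      integral_prod _ hfst]

/-- Static version of `integral_mul_kernel_comm`. -/
theorem integral_mul_kernel_comm_static {c h : Pt d → ℝ} {ρ : Pt d → ℝ}
    (hc : Integrable c) (hρm : Measurable ρ) (hρ : Integrable ρ)
    (hh : Measurable h) {C : ℝ} (hC : ∀ y, |h y| ≤ C) :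
    Integrable (fun y => h y * ∫ x, c x * ρ (x - y)) ∧
    ∫ y, h y * (∫ x, c x * ρ (x - y)) = ∫ x, c x * (∫ y, ρ (x - y) * h y) := by
  -- A Dirac mass in time turns the space-time statement into the static one.
  have := integral_mul_kernel_comm (ν := Measure.dirac 0) (c := fun _ => c) (h := fun _ => h)
    (hc.comp_snd _) hρm hρ (hh.comp measurable_snd) (fun _ => hC)
  simp only [integral_dirac] at this
  exact ⟨this.2.1, this.2.2.2⟩

/-- Duality between a weak solution `w` tested with translates of a kernel `ρ` and a bounded
function `q` which has a bounded measurable time derivative `-g`. -/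
theorem mollified_duality {κ : Type*} [Fintype κ] {τ : ℝ} (hτ : 0 ≤ τ) {w q g : ℝ → Pt d → ℝ}
    {c : κ → ℝ → Pt d → ℝ} {ρ : Pt d → ℝ} {ρ' : κ → Pt d → ℝ}
    (hw : Integrable (uncurry w) ((volume.restrict (Ioc 0 τ)).prod volume))
    (hw0 : Integrable (w 0)) (hwτ : Integrable (w τ))
    (hc : ∀ k, Integrable (uncurry (c k)) ((volume.restrict (Ioc 0 τ)).prod volume))
    (hρ : Continuous ρ) (hρs : HasCompactSupport ρ)
    (hρ' : ∀ k, Continuous (ρ' k)) (hρs' : ∀ k, HasCompactSupport (ρ' k))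
    (hq : Measurable (uncurry q)) (hg : Measurable (uncurry g))
    {C : ℝ} (hqC : ∀ u y, |q u y| ≤ C) (hgC : ∀ u y, |g u y| ≤ C)
    (hweq : ∀ y, ∀ t ∈ Icc 0 τ, (∫ x, w t x * ρ (x - y)) - (∫ x, w 0 x * ρ (x - y)) =
      ∫ u in (0 : ℝ)..t, ∫ x, ∑ k, c k u x * ρ' k (x - y))
    (hqeq : ∀ᵐ y, ∀ t ∈ Icc 0 τ, q t y - q 0 y = -∫ u in (0 : ℝ)..t, g u y) :
    (∫ x, w τ x * ∫ y, ρ (x - y) * q τ y) - (∫ x, w 0 x * ∫ y, ρ (x - y) * q 0 y) =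
      (∑ k, ∫ u in Ioc 0 τ, ∫ x, c k u x * ∫ y, ρ' k (x - y) * q u y) -
        ∫ u in Ioc 0 τ, ∫ x, w u x * ∫ y, ρ (x - y) * g u y := by
  have hρi := hρ.integrable_of_hasCompactSupport (μ := volume) hρs
  have hρi' := fun k => (hρ' k).integrable_of_hasCompactSupport (μ := volume) (hρs' k)
  have hqs : ∀ t, Measurable (q t) := fun t => hq.comp measurable_prodMk_left
  obtain ⟨i0, e0⟩ := integral_mul_kernel_comm_static hw0 hρ.measurable hρi (hqs 0) (hqC 0)
  obtain ⟨iτ, eτ⟩ := integral_mul_kernel_comm_static hwτ hρ.measurable hρi (hqs τ) (hqC τ)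
  obtain ⟨a1, a2, a3, a4⟩ := integral_mul_kernel_comm hw hρ.measurable hρi hg hgC
  have hk := fun k => integral_mul_kernel_comm (hc k) (hρ' k).measurable (hρi' k) hq hqC
  have hbd : ∀ k y, ∃ D, ∀ x, ‖ρ' k (x - y)‖ ≤ D := fun k y => by
    obtain ⟨D, hD⟩ := (hρ' k).bounded_above_of_compact_support (hρs' k)
    exact ⟨D, fun x => hD _⟩
  have hcρ : ∀ k y, Integrable (fun z : ℝ × Pt d => c k z.1 z.2 * ρ' k (z.2 - y))
      ((volume.restrict (Ioc 0 τ)).prod volume) := fun k y => by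
    obtain ⟨D, hD⟩ := hbd k y
    refine (hc k).mul_bdd (c := D) ?_ (Eventually.of_forall fun z => hD z.2)
    exact (by fun_prop : Continuous fun z : ℝ × Pt d => ρ' k (z.2 - y)).aestronglyMeasurable
  -- For a fixed centre `y`, both `q · y` and the pairing of `w` with the translated kernel are
  -- primitives of integrable functions of time, so the product rule applies although `g` is merely
  -- measurable.
  have hpt : ∀ᵐ y, q τ y * (∫ x, w τ x * ρ (x - y)) - q 0 y * (∫ x, w 0 x * ρ (x - y)) =
      (∑ k, ∫ u, q u y * (∫ x, c k u x * ρ' k (x - y)) ∂(volume.restrict (Ioc 0 τ))) -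
        ∫ u, g u y * (∫ x, w u x * ρ (x - y)) ∂(volume.restrict (Ioc 0 τ)) := by
    filter_upwards [hqeq, a1, ae_all_iff.2 fun k => (hk k).1] with y h1 h2 h3
    have hg1 : IntervalIntegrable (fun u => -g u y) volume 0 τ := by
      refine IntervalIntegrable.neg ?_
      rw [intervalIntegrable_iff_integrableOn_Ioc_of_le hτ]
      refine Integrable.of_bound (hg.comp measurable_prodMk_right).aestronglyMeasurable C ?_
      exact Eventually.of_forall fun u => hgC u y
    have hsum : (fun u => ∫ x, ∑ k, c k u x * ρ' k (x - y)) =ᵐ[volume.restrict (Ioc 0 τ)]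
        fun u => ∑ k, ∫ x, c k u x * ρ' k (x - y) := by
      filter_upwards [ae_all_iff.2 fun k => (hcρ k y).prod_right_ae] with u hu
      rw [integral_finsetSum _ fun k _ => hu k]
    have hl1 : IntervalIntegrable (fun u => ∫ x, ∑ k, c k u x * ρ' k (x - y)) volume 0 τ := by
      rw [intervalIntegrable_iff_integrableOn_Ioc_of_le hτ]
      refine Integrable.congr ?_ hsum.symm
      exact integrable_finsetSum _ fun k _ => (hcρ k y).integral_prod_left
    have := mul_sub_mul_eq_integral_of_eq_integral hτ hg1 hl1
      (F := fun t => q t y) (G := fun t => ∫ x, w t x * ρ (x - y))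
      (fun t ht => by rw [h1 t ht, intervalIntegral.integral_neg]) (fun t ht => hweq y t ht)
    rw [this, intervalIntegral.integral_of_le hτ, ← integral_finsetSum _ fun k _ => h3 k,
      ← integral_sub (integrable_finsetSum _ fun k _ => h3 k) h2]
    refine integral_congr_ae ?_
    filter_upwards [hsum] with u hu
    rw [hu, Finset.mul_sum]
    ring
  rw [← e0, ← eτ, ← integral_sub iτ i0, integral_congr_ae hpt,
    integral_sub (integrable_finsetSum _ fun k _ => (hk k).2.1) a2,
    integral_finsetSum _ fun k _ => (hk k).2.1, a4]
  simp_rw [(hk _).2.2.2]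

/-! ### Approximate identity and shrinking of the kernel. -/

/-- A sequence of bump functions shrinking to the origin. -/
def shrinkingBump (d n : ℕ) : ContDiffBump (0 : Pt d) where
  rIn := 1 / ((n : ℝ) + 1)
  rOut := 2 / ((n : ℝ) + 1)
  rIn_pos := by positivity
  rIn_lt_rOut := by gcongr; norm_num

/-- The associated approximate identity. -/
def approxId (d n : ℕ) : Pt d → ℝ := (shrinkingBump d n).normed volume

/-- As `h` is merely bounded and measurable, the convergence takes place at its Lebesgue points. -/
theorem ae_tendsto_approxId {h : Pt d → ℝ} (hh : Measurable h) {C : ℝ} (hC : ∀ y, |h y| ≤ C) :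
    ∀ᵐ x, Tendsto (fun n => ∫ y, approxId d n (x - y) * h y) atTop (𝓝 (h x)) := by
  have hloc : LocallyIntegrable h := fun x =>
    ⟨Metric.ball x 1, Metric.ball_mem_nhds x one_pos,
      Measure.integrableOn_of_bounded (M := C) measure_ball_lt_top.ne hh.aestronglyMeasurable
        (Eventually.of_forall hC)⟩
  have hφ : Tendsto (fun n => (shrinkingBump d n).rOut) atTop (𝓝 0) :=
    tendsto_const_div_atTop_nhds_zero_nat (2 : ℝ) |>.comp (tendsto_add_atTop_nat 1) |>.congr
      fun n => by simp [shrinkingBump]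
  -- The outer radius is always twice the inner one; a bounded ratio is what convergence at Lebesgue
  -- points requires.
  have := ContDiffBump.ae_convolution_tendsto_right_of_locallyIntegrable (μ := volume) (K := 2) hφ
    (Eventually.of_forall fun n => by simp [shrinkingBump, div_eq_mul_inv]) hloc
  filter_upwards [this] with x hx
  refine hx.congr fun n => ?_
  rw [convolution_eq_swap]
  rfl

theorem abs_integral_approxId_mul_le {h : Pt d → ℝ} {C : ℝ} (hC : ∀ y, |h y| ≤ C) (n : ℕ)
    (x : Pt d) : |∫ y, approxId d n (x - y) * h y| ≤ C := by
  have hi : Integrable (approxId d n) := (shrinkingBump d n).integrable_normed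
  have h1 : ‖∫ y, approxId d n (x - y) * h y‖ ≤ ∫ y, approxId d n (x - y) * C := by
    refine norm_integral_le_of_norm_le ((hi.comp_sub_left x).mul_const C)
      (Eventually.of_forall fun y => ?_)
    have h0 : 0 ≤ approxId d n (x - y) := (shrinkingBump d n).nonneg_normed _
    rw [norm_mul, Real.norm_of_nonneg h0]
    exact mul_le_mul_of_nonneg_left (hC y) h0
  rw [integral_mul_const, integral_sub_left_eq_self (approxId d n),
    show ∫ y, approxId d n y = 1 from (shrinkingBump d n).integral_normed, one_mul] at h1
  exact h1

theorem contDiff_approxId (n : ℕ) : ContDiff ℝ ∞ (approxId d n) :=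
  (shrinkingBump d n).contDiff_normed

theorem hasCompactSupport_approxId (n : ℕ) : HasCompactSupport (approxId d n) :=
  (shrinkingBump d n).hasCompactSupport_normed

theorem tendsto_integral_mul_approxId {c h : Pt d → ℝ} (hc : Integrable c) (hh : Measurable h)
    {C : ℝ} (hC : ∀ y, |h y| ≤ C) :
    Tendsto (fun n => ∫ x, c x * ∫ y, approxId d n (x - y) * h y) atTop (𝓝 (∫ x, c x * h x)) := by
  refine tendsto_integral_of_dominated_convergence (fun x => ‖c x‖ * C) (fun n => ?_)
    (hc.norm.mul_const C) (fun n => Eventually.of_forall fun x => ?_) ?_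
  · refine hc.aestronglyMeasurable.mul (StronglyMeasurable.aestronglyMeasurable ?_)
    refine StronglyMeasurable.integral_prod_right (f := fun x y => approxId d n (x - y) * h y) ?_
    refine Measurable.stronglyMeasurable ?_
    have := (contDiff_approxId (d := d) n).continuous.measurable
    fun_prop
  · rw [norm_mul]
    exact mul_le_mul_of_nonneg_left (abs_integral_approxId_mul_le hC n x) (norm_nonneg _)
  · filter_upwards [ae_tendsto_approxId hh hC] with x hx
    exact hx.const_mul _

theorem tendsto_integral_integral_mul_approxId {ν : Measure ℝ} [SFinite ν] {c h : ℝ → Pt d → ℝ}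
    (hc : Integrable (uncurry c) (ν.prod volume)) (hh : Measurable (uncurry h))
    {C : ℝ} (hC : ∀ u y, |h u y| ≤ C) :
    Tendsto (fun n => ∫ u, (∫ x, c u x * ∫ y, approxId d n (x - y) * h u y) ∂ν) atTop
      (𝓝 (∫ u, (∫ x, c u x * h u x) ∂ν)) := by
  refine tendsto_integral_of_dominated_convergence (fun u => (∫ x, ‖c u x‖) * C) (fun n => ?_)
    (hc.integral_norm_prod_left.mul_const C) (fun n => ?_) ?_
  · exact (integral_mul_kernel_comm hc (contDiff_approxId n).continuous.measurable
      (shrinkingBump d n).integrable_normed hh hC).2.2.1.aestronglyMeasurable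
  · filter_upwards [hc.prod_right_ae] with u hu
    rw [← integral_mul_const]
    refine norm_integral_le_of_norm_le (Integrable.mul_const (Integrable.norm hu) C)
      (Eventually.of_forall fun x => ?_)
    rw [norm_mul]
    exact mul_le_mul_of_nonneg_left (abs_integral_approxId_mul_le (hC u) n x) (norm_nonneg _)
  · filter_upwards [hc.prod_right_ae] with u hu
    exact tendsto_integral_mul_approxId hu (hh.comp measurable_prodMk_left) (hC u)

/-- Duality between a weak solution `w` and a function `q` with bounded measurable time derivative
`-g`; the operators `D k` stand for the differential operators of the weak equation and `q' k`
for the functions `D k q`. -/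
theorem weak_equation_duality {κ : Type*} [Fintype κ] {τ : ℝ} (hτ : 0 ≤ τ)
    {w q g : ℝ → Pt d → ℝ} {c q' : κ → ℝ → Pt d → ℝ} {D : κ → (Pt d → ℝ) → Pt d → ℝ}
    (hw : Integrable (uncurry w) ((volume.restrict (Ioc 0 τ)).prod volume))
    (hw0 : Integrable (w 0)) (hwτ : Integrable (w τ))
    (hc : ∀ k, Integrable (uncurry (c k)) ((volume.restrict (Ioc 0 τ)).prod volume))
    (hD : ∀ ρ : Pt d → ℝ, ContDiff ℝ ∞ ρ → HasCompactSupport ρ →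
      ∀ k, Continuous (D k ρ) ∧ HasCompactSupport (D k ρ))
    (hq : Measurable (uncurry q)) (hg : Measurable (uncurry g))
    (hq' : ∀ k, Measurable (uncurry (q' k)))
    {C : ℝ} (hqC : ∀ u y, |q u y| ≤ C) (hgC : ∀ u y, |g u y| ≤ C) (hqC' : ∀ k u y, |q' k u y| ≤ C)
    (hDq : ∀ ρ : Pt d → ℝ, ContDiff ℝ ∞ ρ → HasCompactSupport ρ → ∀ k, ∀ u ∈ Ioc 0 τ, ∀ x,
      ∫ y, D k ρ (x - y) * q u y = ∫ y, ρ (x - y) * q' k u y)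
    (hweq : ∀ ρ : Pt d → ℝ, ContDiff ℝ ∞ ρ → HasCompactSupport ρ → ∀ y, ∀ t ∈ Icc 0 τ,
      (∫ x, w t x * ρ (x - y)) - (∫ x, w 0 x * ρ (x - y)) =
        ∫ u in (0 : ℝ)..t, ∫ x, ∑ k, c k u x * D k ρ (x - y))
    (hqeq : ∀ᵐ y, ∀ t ∈ Icc 0 τ, q t y - q 0 y = -∫ u in (0 : ℝ)..t, g u y) :
    (∫ x, w τ x * q τ x) - (∫ x, w 0 x * q 0 x) =
      (∑ k, ∫ u in Ioc 0 τ, ∫ x, c k u x * q' k u x) - ∫ u in Ioc 0 τ, ∫ x, w u x * g u x := by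
  have hqs : ∀ t, Measurable (q t) := fun t => hq.comp measurable_prodMk_left
  have key : ∀ n, (∫ x, w τ x * ∫ y, approxId d n (x - y) * q τ y) -
      (∫ x, w 0 x * ∫ y, approxId d n (x - y) * q 0 y) =
      (∑ k, ∫ u in Ioc 0 τ, ∫ x, c k u x * ∫ y, approxId d n (x - y) * q' k u y) -
        ∫ u in Ioc 0 τ, ∫ x, w u x * ∫ y, approxId d n (x - y) * g u y := by
    intro n
    have hs := contDiff_approxId (d := d) n
    have hcs := hasCompactSupport_approxId (d := d) n
    rw [mollified_duality hτ hw hw0 hwτ hc hs.continuous hcs (fun k => (hD _ hs hcs k).1)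
      (fun k => (hD _ hs hcs k).2) hq hg hqC hgC (hweq _ hs hcs) hqeq]
    congr 1
    -- The derivatives move from the kernel to `q`, so that no derivative of the kernel is left when
    -- it shrinks.
    refine Finset.sum_congr rfl fun k _ => setIntegral_congr_fun measurableSet_Ioc fun u hu => ?_
    simp_rw [hDq _ hs hcs k u hu]
  have hL := (tendsto_integral_mul_approxId hwτ (hqs τ) (hqC τ)).sub
    (tendsto_integral_mul_approxId hw0 (hqs 0) (hqC 0))
  have hR := (tendsto_finsetSum Finset.univ fun k _ =>
    tendsto_integral_integral_mul_approxId (hc k) (hq' k) (hqC' k)).sub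
    (tendsto_integral_integral_mul_approxId hw hg hgC)
  exact tendsto_nhds_unique (hL.congr key) hR

end MollifiedDuality

/-! ### Partial derivatives -/

section PartialDerivatives

open Function Filter Topology

variable {d : ℕ}

/-- The `i`-th partial derivative. -/
def pderiv (i : Fin d) (f : Pt d → ℝ) (x : Pt d) : ℝ :=
  fderiv ℝ f x (EuclideanSpace.single i (1 : ℝ))

/-- The first and second order partial derivatives. -/
def diffOp : Fin d ⊕ Fin d × Fin d → (Pt d → ℝ) → Pt d → ℝ
  | Sum.inl i, f => pderiv i f
  | Sum.inr ik, f => pderiv ik.2 (pderiv ik.1 f)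

theorem contDiff_pderiv {f : Pt d → ℝ} {m n : WithTop ℕ∞} (hf : ContDiff ℝ n f) (hmn : m + 1 ≤ n)
    (i : Fin d) : ContDiff ℝ m (pderiv i f) :=
  (hf.fderiv_right hmn).clm_apply contDiff_const

theorem hasCompactSupport_pderiv {f : Pt d → ℝ} (hf : HasCompactSupport f) (i : Fin d) :
    HasCompactSupport (pderiv i f) :=
  hf.fderiv_apply ℝ _

theorem hessian_apply {f : Pt d → ℝ} (hf : ContDiff ℝ 2 f) (x : Pt d) (i k : Fin d) :
    hessian f x i k = pderiv i (pderiv k f) x := by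
  have h : DifferentiableAt ℝ (fderiv ℝ f) x :=
    ((hf.fderiv_right (m := 1) le_rfl).differentiable one_ne_zero) x
  simp only [hessian, Matrix.of_apply, iteratedFDeriv_two_apply, Matrix.cons_val_zero,
    Matrix.cons_val_one]
  unfold pderiv
  rw [fderiv_clm_apply h (differentiableAt_const _)]
  simp

theorem inner_gradient_eq (f : Pt d → ℝ) (x v : Pt d) :
    inner ℝ v (gradient f x) = fderiv ℝ f x v := by
  rw [real_inner_comm, gradient, InnerProductSpace.toDual_symm_apply]

theorem fderiv_apply_eq_sum (f : Pt d → ℝ) (x v : Pt d) :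
    fderiv ℝ f x v = ∑ i, v i * pderiv i f x := by
  have hv : v = ∑ i, v i • EuclideanSpace.single i (1 : ℝ) := by
    ext k
    simp [Pi.single_apply]
  conv_lhs => rw [hv]
  simp [pderiv]

theorem gradient_apply (f : Pt d → ℝ) (x : Pt d) (i : Fin d) :
    gradient f x i = pderiv i f x := by
  rw [pderiv, ← inner_gradient_eq, EuclideanSpace.inner_single_left]
  simp

theorem pderiv_comp_sub (i : Fin d) (f : Pt d → ℝ) (y : Pt d) :
    pderiv i (fun x => f (x - y)) = fun x => pderiv i f (x - y) := by
  funext x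
  unfold pderiv
  rw [fderiv_comp_sub]

theorem diffOp_comp_sub (k : Fin d ⊕ Fin d × Fin d) (f : Pt d → ℝ) (y x : Pt d) :
    diffOp k (fun x => f (x - y)) x = diffOp k f (x - y) := by
  rcases k with i | ⟨i, k⟩ <;> simp only [diffOp, pderiv_comp_sub]

theorem continuous_diffOp {f : Pt d → ℝ} (hf : ContDiff ℝ 2 f) (k : Fin d ⊕ Fin d × Fin d) :
    Continuous (diffOp k f) := by
  rcases k with i | ⟨i, k⟩
  · exact (contDiff_pderiv (m := 1) hf le_rfl i).continuous
  · exact (contDiff_pderiv (m := 0) (contDiff_pderiv (m := 1) hf le_rfl i) (by simp) k).continuous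

theorem hasCompactSupport_diffOp {f : Pt d → ℝ} (hf : HasCompactSupport f)
    (k : Fin d ⊕ Fin d × Fin d) : HasCompactSupport (diffOp k f) := by
  rcases k with i | ⟨i, k⟩
  · exact hasCompactSupport_pderiv hf i
  · exact hasCompactSupport_pderiv (hasCompactSupport_pderiv hf i) k

theorem pderiv_eq_zero_of_eventuallyEq {f : Pt d → ℝ} {x : Pt d} {c : ℝ}
    (h : f =ᶠ[𝓝 x] fun _ => c) (i : Fin d) : pderiv i f x = 0 := by
  unfold pderiv
  rw [h.fderiv_eq]
  simp

theorem diffOp_eq_zero_of_eventuallyEq {f : Pt d → ℝ} {x : Pt d} {c : ℝ}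
    (h : f =ᶠ[𝓝 x] fun _ => c) (k : Fin d ⊕ Fin d × Fin d) : diffOp k f x = 0 := by
  rcases k with i | ⟨i, k⟩
  · exact pderiv_eq_zero_of_eventuallyEq h i
  · refine pderiv_eq_zero_of_eventuallyEq (c := 0) ?_ k
    filter_upwards [eventually_eventually_nhds.2 h] with y hy
    exact pderiv_eq_zero_of_eventuallyEq hy i

theorem pderiv_add {f g : Pt d → ℝ} {x : Pt d} (hf : DifferentiableAt ℝ f x)
    (hg : DifferentiableAt ℝ g x) (i : Fin d) :
    pderiv i (fun y => f y + g y) x = pderiv i f x + pderiv i g x := by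
  unfold pderiv
  rw [fderiv_fun_add hf hg]
  rfl

theorem pderiv_mul {f g : Pt d → ℝ} {x : Pt d} (hf : DifferentiableAt ℝ f x)
    (hg : DifferentiableAt ℝ g x) (i : Fin d) :
    pderiv i (fun y => f y * g y) x = f x * pderiv i g x + pderiv i f x * g x := by
  unfold pderiv
  rw [fderiv_fun_mul hf hg]
  simp [mul_comm]

theorem pderiv_pderiv_mul {f g : Pt d → ℝ} (hf : ContDiff ℝ 2 f) (hg : ContDiff ℝ 2 g)
    (i k : Fin d) (x : Pt d) :
    pderiv k (pderiv i fun y => f y * g y) x =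
      f x * pderiv k (pderiv i g) x + pderiv k f x * pderiv i g x + pderiv i f x * pderiv k g x +
        pderiv k (pderiv i f) x * g x := by
  have df : Differentiable ℝ f := hf.differentiable two_ne_zero
  have dg : Differentiable ℝ g := hg.differentiable two_ne_zero
  have df' : Differentiable ℝ (pderiv i f) :=
    (contDiff_pderiv (m := 1) hf le_rfl i).differentiable one_ne_zero
  have dg' : Differentiable ℝ (pderiv i g) :=
    (contDiff_pderiv (m := 1) hg le_rfl i).differentiable one_ne_zero
  have : (pderiv i fun y => f y * g y) = fun y => f y * pderiv i g y + pderiv i f y * g y :=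
    funext fun y => pderiv_mul (df y) (dg y) i
  rw [this, pderiv_add ((df x).fun_mul (dg' x)) ((df' x).fun_mul (dg x)), pderiv_mul (df x) (dg' x), pderiv_mul (df' x) (dg x)]
  ring

/-- Integration by parts in `y`: the sign it produces cancels the one from differentiating `y ↦ ρ (x
- y)`. Compact support of `ρ` makes growth of `q` irrelevant. -/
theorem integral_pderiv_comp_sub_mul {ρ q : Pt d → ℝ} (hρ : ContDiff ℝ 1 ρ)
    (hρs : HasCompactSupport ρ) (hq : ContDiff ℝ 1 q) (i : Fin d) (x : Pt d) :
    ∫ y, pderiv i ρ (x - y) * q y = ∫ y, ρ (x - y) * pderiv i q y := by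
  set ρx : Pt d → ℝ := fun y => ρ (x - y) with hρx
  have hfd : ∀ y, fderiv ℝ ρx y (EuclideanSpace.single i 1) = -pderiv i ρ (x - y) := fun y => by
    have : HasFDerivAt ρx _ y := (hρ.differentiable one_ne_zero (x - y)).hasFDerivAt.comp y
      ((hasFDerivAt_const x y).sub (hasFDerivAt_id y))
    rw [this.fderiv]
    simp [pderiv]
  have hcs : HasCompactSupport ρx := hρs.comp_homeomorph (Homeomorph.subLeft x)
  have hρx1 : ContDiff ℝ 1 ρx := hρ.comp (contDiff_const.sub contDiff_id)
  have c1 : Continuous ρx := hρx1.continuous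
  have c2 : Continuous fun y => fderiv ℝ ρx y (EuclideanSpace.single i 1) :=
    (contDiff_pderiv (m := 0) hρx1 (by simp) i).continuous
  have cs2 : HasCompactSupport fun y => fderiv ℝ ρx y (EuclideanSpace.single i 1) :=
    hasCompactSupport_pderiv hcs i
  have c3 : Continuous fun y => fderiv ℝ q y (EuclideanSpace.single i 1) :=
    (contDiff_pderiv (m := 0) hq (by simp) i).continuous
  have := integral_mul_fderiv_eq_neg_fderiv_mul_of_integrable (μ := volume) (f := q) (g := ρx)
    (v := EuclideanSpace.single i 1)
    ((c3.mul c1).integrable_of_hasCompactSupport hcs.mul_left)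
    ((hq.continuous.mul c2).integrable_of_hasCompactSupport cs2.mul_left)
    ((hq.continuous.mul c1).integrable_of_hasCompactSupport hcs.mul_left)
    (fun y _ => hq.differentiable one_ne_zero y) (fun y _ => hρx1.differentiable one_ne_zero y)
  simp_rw [hfd, mul_neg, integral_neg, neg_inj] at this
  simp_rw [mul_comm (pderiv i ρ _)]
  rw [this]
  simp_rw [mul_comm (ρ _)]
  rfl

/-- Two integrations by parts put the second-order derivatives on `q` in reversed order; symmetry of
the Hessian restores it. -/
theorem integral_diffOp_comp_sub_mul {ρ q : Pt d → ℝ} (hρ : ContDiff ℝ ∞ ρ)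
    (hρs : HasCompactSupport ρ) (hq : ContDiff ℝ 2 q) (k : Fin d ⊕ Fin d × Fin d) (x : Pt d) :
    ∫ y, diffOp k ρ (x - y) * q y = ∫ y, ρ (x - y) * diffOp k q y := by
  have h1 : ∀ {n : ℕ}, ContDiff ℝ n ρ := contDiff_infty.1 hρ _
  rcases k with i | ⟨i, k⟩
  · exact integral_pderiv_comp_sub_mul (h1 (n := 1)) hρs (hq.of_le one_le_two) i x
  · have h2 : ContDiff ℝ 1 (pderiv i ρ) := contDiff_pderiv (h1 (n := 2)) le_rfl i
    simp only [diffOp]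
    rw [integral_pderiv_comp_sub_mul h2 (hasCompactSupport_pderiv hρs i) (hq.of_le one_le_two),
      integral_pderiv_comp_sub_mul (h1 (n := 1)) hρs (contDiff_pderiv hq le_rfl k)]
    have : pderiv i (pderiv k q) = pderiv k (pderiv i q) := by
      funext y
      rw [← hessian_apply hq, ← hessian_apply hq]
      simp only [hessian, Matrix.of_apply, iteratedFDeriv_two_apply, Matrix.cons_val_zero,
        Matrix.cons_val_one]
      exact (hq.contDiffAt.isSymmSndFDerivAt (by simp)) _ _
    rw [this]

theorem measurable_indicator_of_continuousOn {α : Type*} [TopologicalSpace α] [MeasurableSpace α]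
    [OpensMeasurableSpace α] {f : α → ℝ} {s : Set α} (hs : MeasurableSet s)
    (hf : ContinuousOn f s) : Measurable (s.indicator f) := by
  classical
  have := hf.measurable_piecewise (g := fun _ => (0 : ℝ)) continuousOn_const hs
  rw [← piecewise_eq_indicator]
  exact this

theorem exists_bound_of_continuousOn_of_support {f : ℝ → Pt d → ℝ} {τ R : ℝ}
    (hf : ContinuousOn (uncurry f) (Icc 0 τ ×ˢ univ))
    (hs : ∀ u ∈ Icc 0 τ, ∀ x, R < ‖x‖ → f u x = 0) :
    ∃ C, 0 ≤ C ∧ ∀ u ∈ Icc 0 τ, ∀ x, |f u x| ≤ C := by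
  obtain ⟨C, hC⟩ := (isCompact_Icc.prod (isCompact_closedBall (0 : Pt d) R)).exists_bound_of_continuousOn
    (hf.mono (prod_mono_right (subset_univ _)))
  refine ⟨max C 0, le_max_right _ _, fun u hu x => ?_⟩
  by_cases hx : R < ‖x‖
  · simp [hs u hu x hx]
  · exact (hC (u, x) ⟨hu, by simpa using hx⟩).trans (le_max_left _ _)

/-- Duality between a weak solution and a family of compactly supported `C²` functions. -/
theorem weak_equation_duality_of_contDiff {τ R : ℝ} (hτ : 0 ≤ τ) {w q g : ℝ → Pt d → ℝ}
    {c : Fin d ⊕ Fin d × Fin d → ℝ → Pt d → ℝ}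
    (hw : Integrable (uncurry w) ((volume.restrict (Ioc 0 τ)).prod volume))
    (hw0 : Integrable (w 0)) (hwτ : Integrable (w τ))
    (hc : ∀ k, Integrable (uncurry (c k)) ((volume.restrict (Ioc 0 τ)).prod volume))
    (hq : ∀ u ∈ Icc 0 τ, ContDiff ℝ 2 (q u)) (hqs : ∀ u ∈ Icc 0 τ, ∀ x, R < ‖x‖ → q u x = 0)
    (hqc : ContinuousOn (uncurry q) (Icc 0 τ ×ˢ univ))
    (hqc' : ∀ k, ContinuousOn (fun z : ℝ × Pt d => diffOp k (q z.1) z.2) (Icc 0 τ ×ˢ univ))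
    (hg : Measurable (uncurry g)) {C : ℝ} (hgC : ∀ u y, |g u y| ≤ C)
    (hweq : ∀ ρ : Pt d → ℝ, ContDiff ℝ ∞ ρ → HasCompactSupport ρ → ∀ t ∈ Icc 0 τ,
      (∫ x, w t x * ρ x) - (∫ x, w 0 x * ρ x) =
        ∫ u in (0 : ℝ)..t, ∫ x, ∑ k, c k u x * diffOp k ρ x)
    (hqeq : ∀ᵐ y, ∀ t ∈ Icc 0 τ, q t y - q 0 y = -∫ u in (0 : ℝ)..t, g u y) :
    (∫ x, w τ x * q τ x) - (∫ x, w 0 x * q 0 x) =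
      (∑ k, ∫ u in Ioc 0 τ, ∫ x, c k u x * diffOp k (q u) x) -
        ∫ u in Ioc 0 τ, ∫ x, w u x * g u x := by
  have hms : MeasurableSet (Icc 0 τ ×ˢ (univ : Set (Pt d))) := measurableSet_Icc.prod .univ
  have hsupp : ∀ k, ∀ u ∈ Icc 0 τ, ∀ x, R < ‖x‖ → diffOp k (q u) x = 0 := fun k u hu x hx => by
    refine diffOp_eq_zero_of_eventuallyEq (c := 0) ?_ k
    filter_upwards [(isOpen_lt continuous_const continuous_norm).mem_nhds hx] with y hy
    exact hqs u hu y hy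
  obtain ⟨C1, hC10, hC1⟩ := exists_bound_of_continuousOn_of_support hqc hqs
  choose C2 hC20 hC2 using fun k => exists_bound_of_continuousOn_of_support (hqc' k) (hsupp k)
  have hC0 : 0 ≤ C := (abs_nonneg _).trans (hgC 0 0)
  have hsum0 : 0 ≤ ∑ k, C2 k := Finset.sum_nonneg fun k _ => hC20 k
  have hle : ∀ k, C2 k ≤ ∑ k, C2 k := fun k =>
    Finset.single_le_sum (fun k _ => hC20 k) (Finset.mem_univ k)
  -- Regularity is available only for times in `[0, τ]`; the extension by zero is measurable and
  -- bounded for all times.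
  set Q : ℝ → Pt d → ℝ := fun u x => (Icc 0 τ ×ˢ univ).indicator (uncurry q) (u, x) with hQ
  set Q' : Fin d ⊕ Fin d × Fin d → ℝ → Pt d → ℝ := fun k u x =>
    (Icc 0 τ ×ˢ univ).indicator (fun z : ℝ × Pt d => diffOp k (q z.1) z.2) (u, x) with hQ'
  have eQ : ∀ u ∈ Icc 0 τ, Q u = q u := fun u hu => by
    funext x
    exact indicator_of_mem (show (u, x) ∈ Icc 0 τ ×ˢ univ from ⟨hu, mem_univ _⟩) _
  have eQ' : ∀ k, ∀ u ∈ Icc 0 τ, Q' k u = diffOp k (q u) := fun k u hu => by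
    funext x
    exact indicator_of_mem (show (u, x) ∈ Icc 0 τ ×ˢ univ from ⟨hu, mem_univ _⟩) _
  have h0 : (0 : ℝ) ∈ Icc 0 τ := ⟨le_rfl, hτ⟩
  have hτ' : τ ∈ Icc 0 τ := ⟨hτ, le_rfl⟩
  have key := weak_equation_duality hτ (q := Q) (q' := Q') (D := diffOp) (g := g)
    (C := C + C1 + ∑ k, C2 k) hw hw0 hwτ hc ?_
    (measurable_indicator_of_continuousOn hms hqc) hg
    (fun k => measurable_indicator_of_continuousOn hms (hqc' k)) ?_ ?_ ?_ ?_ ?_ ?_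
  · rw [eQ τ hτ', eQ 0 h0] at key
    rw [key]
    congr 1
    refine Finset.sum_congr rfl fun k _ => setIntegral_congr_fun measurableSet_Ioc fun u hu => ?_
    simp only [eQ' k u (Ioc_subset_Icc_self hu)]
  · intro ρ hρ hρs k
    exact ⟨continuous_diffOp (contDiff_infty.1 hρ 2) k, hasCompactSupport_diffOp hρs k⟩
  · intro u y
    by_cases hu : u ∈ Icc 0 τ
    · rw [eQ u hu]
      linarith [hC1 u hu y]
    · have : Q u y = 0 := indicator_of_notMem (fun h => hu h.1) _
      rw [this, abs_zero]
      positivity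
  · intro u y
    linarith [hgC u y]
  · intro k u y
    by_cases hu : u ∈ Icc 0 τ
    · rw [eQ' k u hu]
      linarith [hC2 k u hu y, hle k]
    · have : Q' k u y = 0 := indicator_of_notMem (fun h => hu h.1) _
      rw [this, abs_zero]
      positivity
  · intro ρ hρ hρs k u hu x
    rw [eQ u (Ioc_subset_Icc_self hu), eQ' k u (Ioc_subset_Icc_self hu)]
    exact integral_diffOp_comp_sub_mul hρ hρs (hq u (Ioc_subset_Icc_self hu)) k x
  · intro ρ hρ hρs y t ht
    have h1 : ContDiff ℝ ∞ fun x => ρ (x - y) := hρ.comp (contDiff_id.sub contDiff_const)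
    have h2 : HasCompactSupport fun x => ρ (x - y) := by
      have := hρs.comp_homeomorph (Homeomorph.subRight y)
      exact this
    have := hweq _ h1 h2 t ht
    simp only [diffOp_comp_sub] at this
    exact this
  · filter_upwards [hqeq] with y hy t ht
    rw [eQ t ht, eQ 0 h0]
    exact hy t ht

end PartialDerivatives

/-! ### Cutoff functions -/

section Cutoff

open Function Filter Topology

variable {d : ℕ}

theorem pderiv_comp_smul (i : Fin d) (f : Pt d → ℝ) (c : ℝ) :
    pderiv i (fun x => f (c • x)) = fun x => c * pderiv i f (c • x) := by
  funext x
  unfold pderiv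
  rw [fderiv_comp_smul]
  rfl

theorem pderiv_const_mul (i : Fin d) {f : Pt d → ℝ} (hf : Differentiable ℝ f) (c : ℝ) :
    pderiv i (fun x => c * f x) = fun x => c * pderiv i f x := by
  funext x
  unfold pderiv
  rw [fderiv_const_mul (hf x)]
  rfl

/-- A smooth function which is `1` on the unit ball and `0` off the ball of radius `2`. -/
def unitCutoff (d : ℕ) : ContDiffBump (0 : Pt d) where
  rIn := 1
  rOut := 2
  rIn_pos := one_pos
  rIn_lt_rOut := one_lt_two

/-- A smooth function which is `1` on the ball of radius `n + 1` and `0` off the ball of twice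
that radius. -/
def cutoff (d n : ℕ) (x : Pt d) : ℝ := unitCutoff d (((n : ℝ) + 1)⁻¹ • x)

theorem contDiff_cutoff (n : ℕ) {m : ℕ∞} : ContDiff ℝ m (cutoff d n) :=
  (unitCutoff d).contDiff.comp (contDiff_id.const_smul ((n : ℝ) + 1)⁻¹)

theorem cutoff_nonneg (n : ℕ) (x : Pt d) : 0 ≤ cutoff d n x := (unitCutoff d).nonneg

theorem cutoff_le_one (n : ℕ) (x : Pt d) : cutoff d n x ≤ 1 := (unitCutoff d).le_one

theorem abs_cutoff_le_one (n : ℕ) (x : Pt d) : |cutoff d n x| ≤ 1 := by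
  rw [abs_of_nonneg (cutoff_nonneg n x)]
  exact cutoff_le_one n x

theorem cutoff_eq_zero {n : ℕ} {x : Pt d} (hx : 2 * ((n : ℝ) + 1) < ‖x‖) : cutoff d n x = 0 := by
  refine (unitCutoff d).zero_of_le_dist ?_
  rw [dist_zero_right, norm_smul, norm_inv, Real.norm_of_nonneg (by positivity),
    inv_mul_eq_div, le_div_iff₀ (by positivity)]
  exact hx.le

theorem cutoff_eq_one {n : ℕ} {x : Pt d} (hx : ‖x‖ < (n : ℝ) + 1) : cutoff d n x = 1 := by
  refine (unitCutoff d).one_of_mem_closedBall ?_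
  rw [mem_closedBall_zero_iff, norm_smul, norm_inv, Real.norm_of_nonneg (by positivity),
    inv_mul_eq_div]
  exact (div_le_one (by positivity)).2 hx.le

theorem cutoff_eventuallyEq_one {n : ℕ} {x : Pt d} (hx : ‖x‖ < (n : ℝ) + 1) :
    cutoff d n =ᶠ[𝓝 x] fun _ => 1 := by
  filter_upwards [(isOpen_lt continuous_norm continuous_const).mem_nhds hx] with y hy
  exact cutoff_eq_one hy

theorem tendsto_cutoff (x : Pt d) : Tendsto (fun n => cutoff d n x) atTop (𝓝 1) := by
  obtain ⟨N, hN⟩ := exists_nat_gt ‖x‖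
  refine tendsto_const_nhds.congr' ?_
  filter_upwards [eventually_ge_atTop N] with n hn
  have : (N : ℝ) ≤ n := by exact_mod_cast hn
  exact (cutoff_eq_one (by linarith)).symm

/-- Scaling: with `r = n + 1`, derivatives of order one and two carry factors `r⁻¹` and `r⁻²` and
vanish beyond radius `2r`. They therefore absorb one and two powers of `1 + ‖x‖`, uniformly in `n`.
-/
theorem exists_bound_diffOp_cutoff (d : ℕ) : ∃ C : ℝ, 0 ≤ C ∧ ∀ (n : ℕ) (x : Pt d) (i k : Fin d),
    |pderiv i (cutoff d n) x| * (1 + ‖x‖) ≤ C ∧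
    |pderiv k (pderiv i (cutoff d n)) x| * (1 + ‖x‖) ^ 2 ≤ C := by
  have hsm : ContDiff ℝ 2 (unitCutoff d) := (unitCutoff d).contDiff
  have hcs : HasCompactSupport (unitCutoff d) := (unitCutoff d).hasCompactSupport
  have hb : ∀ κ : Fin d ⊕ Fin d × Fin d, ∃ C, ∀ x, ‖diffOp κ (unitCutoff d) x‖ ≤ C := fun κ =>
    (continuous_diffOp hsm κ).bounded_above_of_compact_support (hasCompactSupport_diffOp hcs κ)
  choose C hC using hb
  have hC0 : ∀ κ, 0 ≤ C κ := fun κ => (norm_nonneg _).trans (hC κ 0)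
  have hle : ∀ κ, C κ ≤ ∑ κ, C κ := fun κ =>
    Finset.single_le_sum (fun κ _ => hC0 κ) (Finset.mem_univ κ)
  have hs0 : 0 ≤ ∑ κ, C κ := Finset.sum_nonneg fun κ _ => hC0 κ
  -- The factor is `3 ^ 2`: where `‖x‖ ≤ 2r` and `1 ≤ r` one has `1 + ‖x‖ ≤ 3r`, which is used
  -- squared at second order.
  refine ⟨9 * ∑ κ, C κ, by positivity, fun n x i k => ?_⟩
  set r : ℝ := (n : ℝ) + 1 with hr
  have hr1 : 1 ≤ r := by simp [hr]
  have hr0 : 0 < r := by positivity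
  by_cases hx : 2 * r < ‖x‖
  · have h0 : cutoff d n =ᶠ[𝓝 x] fun _ => 0 := by
      filter_upwards [(isOpen_lt continuous_const continuous_norm).mem_nhds hx] with y hy
      exact cutoff_eq_zero hy
    have h1 := diffOp_eq_zero_of_eventuallyEq h0 (Sum.inl i)
    have h2 := diffOp_eq_zero_of_eventuallyEq h0 (Sum.inr (i, k))
    simp only [diffOp] at h1 h2
    rw [h1, h2]
    simp only [abs_zero, zero_mul]
    constructor <;> positivity
  · have hw : r⁻¹ * (1 + ‖x‖) ≤ 3 := by
      rw [inv_mul_le_iff₀ hr0]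
      linarith [not_lt.1 hx]
    have hw0 : 0 ≤ r⁻¹ * (1 + ‖x‖) := by positivity
    have e1 : pderiv i (cutoff d n) = fun x => r⁻¹ * pderiv i (unitCutoff d) (r⁻¹ • x) :=
      pderiv_comp_smul i _ _
    have e2 : pderiv k (pderiv i (cutoff d n)) =
        fun x => r⁻¹ * (r⁻¹ * pderiv k (pderiv i (unitCutoff d)) (r⁻¹ • x)) := by
      rw [e1, pderiv_const_mul (f := fun x => pderiv i (unitCutoff d) (r⁻¹ • x)),
        pderiv_comp_smul]
      exact ((contDiff_pderiv (m := 1) hsm le_rfl i).differentiable one_ne_zero).comp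
        (differentiable_id.const_smul r⁻¹)
    have b1 := (hC (Sum.inl i) (r⁻¹ • x)).trans (hle _)
    have b2 := (hC (Sum.inr (i, k)) (r⁻¹ • x)).trans (hle _)
    simp only [diffOp, Real.norm_eq_abs] at b1 b2
    rw [e2, e1]
    simp only [abs_mul, abs_inv, abs_of_pos hr0]
    constructor
    · calc _ = (r⁻¹ * (1 + ‖x‖)) * |pderiv i (unitCutoff d) (r⁻¹ • x)| := by ring
        _ ≤ 3 * ∑ κ, C κ := by gcongr
        _ ≤ _ := by nlinarith
    · calc _ = (r⁻¹ * (1 + ‖x‖)) ^ 2 * |pderiv k (pderiv i (unitCutoff d)) (r⁻¹ • x)| := by ring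
        _ ≤ 3 ^ 2 * ∑ κ, C κ := by gcongr
        _ = _ := by ring

end Cutoff

/-! ### Elementary bounds for the data of the model -/

namespace CrowdModel

open Function Filter Topology

variable {d M : ℕ} {S : CrowdModel d M}

/-- The coefficients of the generator. -/
def coef (S : CrowdModel d M) (a : ℝ → Pt d → Pt d) : Fin d ⊕ Fin d × Fin d → ℝ → Pt d → ℝ
  | Sum.inl i, t, x => S.b t x (a t x) i
  | Sum.inr ik, t, x => (1 / 2) * (S.σ t x * (S.σ t x)ᵀ) ik.1 ik.2

theorem diffusionTerm_eq {f : Pt d → ℝ} (hf : ContDiff ℝ 2 f) (t : ℝ) (x : Pt d)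
    (a : ℝ → Pt d → Pt d) :
    S.diffusionTerm t f x =
      ∑ ik : Fin d × Fin d, S.coef a (Sum.inr ik) t x * diffOp (Sum.inr ik) f x := by
  simp only [diffusionTerm, coef, diffOp, Fintype.sum_prod_type, Matrix.trace, Matrix.diag,
    Matrix.mul_apply (N := hessian f x), hessian_apply hf, Finset.mul_sum, mul_assoc]

theorem generator_eq {f : Pt d → ℝ} (hf : ContDiff ℝ 2 f) (t : ℝ) (x : Pt d)
    (a : ℝ → Pt d → Pt d) :
    inner ℝ (S.b t x (a t x)) (gradient f x) + S.diffusionTerm t f x =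
      ∑ k, S.coef a k t x * diffOp k f x := by
  rw [Fintype.sum_sum_type, ← diffusionTerm_eq hf, inner_gradient_eq, fderiv_apply_eq_sum]
  rfl

theorem abs_apply_le_frobNorm (B : Matrix (Fin d) (Fin d) ℝ) (i k : Fin d) :
    |B i k| ≤ frobNorm B := by
  rw [← Real.sqrt_sq_eq_abs]
  refine Real.sqrt_le_sqrt ?_
  calc B i k ^ 2 ≤ ∑ k, B i k ^ 2 :=
        Finset.single_le_sum (f := fun k => B i k ^ 2) (fun _ _ => sq_nonneg _) (Finset.mem_univ k)
    _ ≤ _ := Finset.single_le_sum (f := fun i => ∑ k, B i k ^ 2)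
        (fun _ _ => Finset.sum_nonneg fun _ _ => sq_nonneg _) (Finset.mem_univ i)

theorem frobNorm_nonneg (B : Matrix (Fin d) (Fin d) ℝ) : 0 ≤ frobNorm B := Real.sqrt_nonneg _

theorem Standing.exists_growth (hS : S.Standing) : ∃ K : ℝ, 0 ≤ K ∧ ∀ t ∈ Icc 0 S.T, ∀ x : Pt d,
    ∀ α ∈ convexHull ℝ S.A, ‖α‖ ≤ K ∧ ‖S.b t x α‖ ≤ K * (1 + ‖x‖) ∧
      (∀ i k, |S.σ t x i k| ≤ K * (1 + ‖x‖)) ∧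
      ∀ α' ∈ convexHull ℝ S.A, ‖S.b t x α' - S.b t x α‖ ≤ K * ‖α' - α‖ := by
  obtain ⟨K, hK, h⟩ := hS.lipschitz_growth
  obtain ⟨R, hR⟩ := (isBounded_convexHull.2 hS.compact_A.isBounded).exists_norm_le
  refine ⟨max R 0 + K * (1 + max R 0), by positivity, fun t ht x α hα => ?_⟩
  have hR' : ‖α‖ ≤ max R 0 := (hR α hα).trans (le_max_left _ _)
  have hR0 : 0 ≤ max R 0 := le_max_right _ _
  set R' := max R 0
  have hgr := (h t ht x x α hα α hα).2.2
  have hn : 0 ≤ ‖x‖ := norm_nonneg x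
  have hbig : K * (1 + ‖x‖ + ‖α‖) ≤ (R' + K * (1 + R')) * (1 + ‖x‖) := by
    have : K * (1 + ‖x‖ + ‖α‖) ≤ K * (1 + ‖x‖ + R') := by gcongr
    have : 0 ≤ K * R' * ‖x‖ := by positivity
    have : 0 ≤ R' * ‖x‖ := by positivity
    nlinarith
  refine ⟨?_, ?_, fun i k => ?_, fun α' hα' => ?_⟩
  · have : 0 ≤ K * (1 + R') := by positivity
    linarith
  · linarith [frobNorm_nonneg (S.σ t x)]
  · linarith [abs_apply_le_frobNorm (S.σ t x) i k, norm_nonneg (S.b t x α)]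
  · have := (h t ht x x α' hα' α hα).1
    rw [sub_self, norm_zero, zero_add] at this
    refine this.trans ?_
    gcongr
    nlinarith

theorem IsControl.mem_hull {a : ℝ → Pt d → Pt d} (ha : S.IsControl a) (t : ℝ) (x : Pt d) :
    a t x ∈ convexHull ℝ S.A := subset_convexHull ℝ _ (ha.2 t x)

/-- The linear bound for the drift is kept apart because in the commutator the drift multiplies `p`,
of quadratic growth, against a single derivative of the cutoff. -/
theorem Standing.exists_coef_growth (hS : S.Standing) : ∃ K : ℝ, 0 ≤ K ∧ ∀ a : ℝ → Pt d → Pt d,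
    S.IsControl a → ∀ t ∈ Icc 0 S.T, ∀ x, (∀ i, |S.coef a (Sum.inl i) t x| ≤ K * (1 + ‖x‖)) ∧
      ∀ k, |S.coef a k t x| ≤ K * (1 + ‖x‖) ^ 2 := by
  obtain ⟨K, hK, h⟩ := hS.exists_growth
  refine ⟨K + d * K ^ 2, by positivity, fun a ha t ht x => ?_⟩
  obtain ⟨-, h1, h2, -⟩ := h t ht x (a t x) (ha.mem_hull t x)
  have hn : 0 ≤ ‖x‖ := norm_nonneg x
  have hb : ∀ i, |S.coef a (Sum.inl i) t x| ≤ (K + d * K ^ 2) * (1 + ‖x‖) := fun i => by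
    have : |S.b t x (a t x) i| ≤ ‖S.b t x (a t x)‖ := PiLp.norm_apply_le (S.b t x (a t x)) i
    have : 0 ≤ d * K ^ 2 * (1 + ‖x‖) := by positivity
    simp only [coef]
    linarith
  refine ⟨hb, fun k => ?_⟩
  rcases k with i | ⟨i, k⟩
  · refine (hb i).trans ?_
    gcongr
    exact le_self_pow₀ (by linarith) two_ne_zero
  · have hs : |(S.σ t x * (S.σ t x)ᵀ) i k| ≤ d * (K * (1 + ‖x‖)) ^ 2 := by
      rw [Matrix.mul_apply]
      refine (Finset.abs_sum_le_sum_abs _ _).trans ?_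
      have : ∀ l ∈ Finset.univ, |S.σ t x i l * (S.σ t x)ᵀ l k| ≤ (K * (1 + ‖x‖)) ^ 2 := by
        intro l _
        rw [abs_mul, Matrix.transpose_apply, sq]
        exact mul_le_mul (h2 i l) (h2 k l) (abs_nonneg _) (by positivity)
      simpa using Finset.sum_le_sum this
    simp only [coef]
    rw [abs_mul, abs_of_pos (by norm_num : (0 : ℝ) < 1 / 2)]
    have h3 : d * (K * (1 + ‖x‖)) ^ 2 = d * K ^ 2 * (1 + ‖x‖) ^ 2 := by ring
    have h4 : 0 ≤ K * (1 + ‖x‖) ^ 2 := by positivity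
    have h5 : 0 ≤ d * K ^ 2 * (1 + ‖x‖) ^ 2 := by positivity
    nlinarith

/-! ### The interaction kernel -/

theorem measurable_ballIndicator : Measurable S.ballIndicator :=
  measurable_const.indicator measurableSet_ball

theorem integrable_ballIndicator : Integrable S.ballIndicator :=
  (integrable_indicator_iff measurableSet_ball).2
    (integrableOn_const measure_ball_lt_top.ne)

theorem Standing.continuous_mollifier (hS : S.Standing) : Continuous S.mollifier := by
  have := hS.γ_smooth.continuous
  unfold mollifier
  fun_prop

theorem Standing.exists_kernel_bound (hS : S.Standing) : ∃ C, 0 ≤ C ∧ ∀ x, |S.kernel x| ≤ C := by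
  obtain ⟨C, hC⟩ : ∃ C, ∀ x, ‖S.γ x‖ ≤ C :=
    hS.γ_smooth.continuous.bounded_above_of_compact_support hS.γ_compactSupport
  refine ⟨|(S.δ ^ d)⁻¹| * |C| * ∫ y, ‖S.ballIndicator y‖, by positivity, fun x => ?_⟩
  rw [← integral_const_mul]
  change ‖∫ y, S.mollifier (x - y) * S.ballIndicator y‖ ≤ _
  refine norm_integral_le_of_norm_le (integrable_ballIndicator.norm.const_mul _)
    (Eventually.of_forall fun y => ?_)
  simp only [mollifier, norm_mul, Real.norm_eq_abs]
  exact mul_le_mul_of_nonneg_right (mul_le_mul_of_nonneg_left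
    ((hC _).trans (le_abs_self C)) (abs_nonneg _)) (abs_nonneg _)

theorem Standing.measurable_kernel (hS : S.Standing) : Measurable S.kernel := by
  have h1 := hS.continuous_mollifier.measurable
  have h2 := measurable_ballIndicator (S := S)
  refine StronglyMeasurable.measurable ?_
  refine StronglyMeasurable.integral_prod_right
    (f := fun x y => S.mollifier (x - y) * S.ballIndicator y) ?_
  refine Measurable.stronglyMeasurable ?_
  fun_prop

/-- The mollifier and the ball are both even. This symmetry is what produces `Λ + Λᵀ` in the adjoint
equation. -/
theorem Standing.kernel_neg (hS : S.Standing) (x : Pt d) : S.kernel (-x) = S.kernel x := by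
  unfold kernel
  rw [← integral_neg_eq_self]
  congr 1
  funext y
  have h1 : S.ballIndicator (-y) = S.ballIndicator y := by
    simp [ballIndicator, indicator]
  have h2 : S.mollifier (-x - -y) = S.mollifier (x - y) := by
    rw [show -x - -y = -(x - y) by abel, mollifier, mollifier, smul_neg, hS.γ_symm]
  rw [h1, h2]

end CrowdModel

/-! ### Integrability and measurability -/

section

open Function Filter Topology

variable {d : ℕ}

theorem integrable_mul_of_abs_le {α : Type*} [MeasurableSpace α] {μ : Measure α} {φ W u : α → ℝ}
    {C : ℝ} (hW : Integrable (fun x => W x * u x) μ) (hφ : AEStronglyMeasurable φ μ)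
    (hu : AEStronglyMeasurable u μ) (h : ∀ᵐ x ∂μ, |φ x| ≤ C * W x) :
    Integrable (fun x => φ x * u x) μ := by
  refine (hW.norm.const_mul |C|).mono' (hφ.mul hu) ?_
  filter_upwards [h] with x hx
  rw [norm_mul, norm_mul, Real.norm_eq_abs, ← mul_assoc, Real.norm_eq_abs (W x), ← abs_mul]
  exact mul_le_mul_of_nonneg_right (hx.trans (le_abs_self _)) (abs_nonneg _)

theorem IsDensity2.integrable_weight {u : Pt d → ℝ} (hu : IsDensity2 u) :
    Integrable fun x => (1 + ‖x‖) ^ 2 * u x := by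
  have h : Integrable fun x => (1 + ‖x‖ ^ 2) * u x := by
    simp only [add_mul, one_mul]
    exact hu.integrable.add hu.secondMoment
  refine integrable_mul_of_abs_le (C := 2) h (by fun_prop) hu.measurable.aestronglyMeasurable
    (Eventually.of_forall fun x => ?_)
  rw [abs_of_nonneg (by positivity)]
  nlinarith [sq_nonneg (1 - ‖x‖)]

theorem IsDensity2.integral_weight_le {u : Pt d → ℝ} (hu : IsDensity2 u) :
    ∫ x, (1 + ‖x‖) ^ 2 * u x ≤ 2 * (1 + ∫ x, ‖x‖ ^ 2 * u x) := by
  have h := integral_add hu.integrable hu.secondMoment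
  rw [hu.integral_eq_one] at h
  rw [← h, ← integral_const_mul]
  refine integral_mono hu.integrable_weight ((hu.integrable.add hu.secondMoment).const_mul 2)
    fun x => ?_
  have := hu.nonneg x
  nlinarith [mul_nonneg (sq_nonneg (1 - ‖x‖)) this]

theorem IsDensity2.integrable_mul {u φ : Pt d → ℝ} (hu : IsDensity2 u) {C : ℝ}
    (hφ : AEStronglyMeasurable φ) (h : ∀ x, |φ x| ≤ C * (1 + ‖x‖) ^ 2) :
    Integrable fun x => φ x * u x :=
  integrable_mul_of_abs_le hu.integrable_weight hφ hu.measurable.aestronglyMeasurable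
    (Eventually.of_forall h)

end

namespace CrowdModel

open Function Filter Topology

variable {d M : ℕ} {S : CrowdModel d M}

/-- Lebesgue measure on the open time interval `(0,T)`. -/
def timeVol (S : CrowdModel d M) : Measure ℝ := volume.restrict (Ioo 0 S.T)

instance : SFinite S.timeVol := by unfold timeVol; infer_instance

instance : IsFiniteMeasure S.timeVol :=
  ⟨by simp [timeVol]⟩

theorem timeVol_prod : S.timeVol.prod (volume : Measure (Pt d)) =
    (volume : Measure (ℝ × Pt d)).restrict (Ioo 0 S.T ×ˢ univ) := by
  conv_lhs => rw [timeVol, ← Measure.restrict_univ (μ := (volume : Measure (Pt d))),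
    Measure.prod_restrict]
  rfl

theorem ae_timeVol {P : ℝ → Prop} (h : ∀ t ∈ Ioo 0 S.T, P t) : ∀ᵐ t ∂S.timeVol, P t :=
  (ae_restrict_mem measurableSet_Ioo).mono h

theorem ae_timeVol_prod {P : ℝ × Pt d → Prop} (h : ∀ t ∈ Ioo 0 S.T, ∀ x, P (t, x)) :
    ∀ᵐ z ∂(S.timeVol.prod volume), P z := by
  rw [timeVol_prod]
  exact (ae_restrict_mem (measurableSet_Ioo.prod .univ)).mono fun z hz => h z.1 hz.1 z.2

theorem intervalIntegral_eq_timeVol (hT : 0 ≤ S.T) (f : ℝ → ℝ) :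
    ∫ t in (0 : ℝ)..S.T, f t = ∫ t, f t ∂S.timeVol := by
  rw [intervalIntegral.integral_of_le hT, integral_Ioc_eq_integral_Ioo, timeVol]

theorem aestronglyMeasurable_of_continuousOn_Ico {β : Type*} [TopologicalSpace β]
    [TopologicalSpace.PseudoMetrizableSpace β] [SecondCountableTopology β]
    {f : ℝ × Pt d → β} (hf : ContinuousOn f (Ico 0 S.T ×ˢ univ)) :
    AEStronglyMeasurable f (S.timeVol.prod volume) := by
  rw [timeVol_prod]
  exact (hf.mono (prod_mono_left Ioo_subset_Ico_self)).aestronglyMeasurable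
    (measurableSet_Ioo.prod .univ)

theorem Standing.measurable_drift_comp (hS : S.Standing) {Z : Type*} [MeasurableSpace Z]
    {τ : Z → ℝ} {y α : Z → Pt d} (hτ : Measurable τ) (hy : Measurable y) (hα : Measurable α)
    (hτ' : ∀ z, τ z ∈ Icc 0 S.T) (hα' : ∀ z, α z ∈ convexHull ℝ S.A) :
    Measurable fun z => S.b (τ z) (y z) (α z) := by
  have h := (continuousOn_iff_continuous_domRestrict.1 hS.b_continuous).measurable
  have hz : Measurable fun z => (⟨(τ z, y z, α z), hτ' z, mem_univ _, hα' z⟩ :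
      (Icc 0 S.T ×ˢ ((univ : Set (Pt d)) ×ˢ convexHull ℝ S.A) : Set (ℝ × Pt d × Pt d))) :=
    Measurable.subtype_mk (hτ.prodMk (hy.prodMk hα))
  exact h.comp hz

theorem Standing.measurable_drift (hS : S.Standing) {t : ℝ} (ht : t ∈ Icc 0 S.T)
    {a : Pt d → Pt d} (ha : Measurable a) (hmem : ∀ x, a x ∈ convexHull ℝ S.A) :
    Measurable fun x => S.b t x (a x) :=
  hS.measurable_drift_comp measurable_const measurable_id ha (fun _ => ht) hmem

theorem Standing.aestronglyMeasurable_drift (hS : S.Standing) {a : ℝ → Pt d → Pt d}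
    (ha : S.IsControl a) :
    AEStronglyMeasurable (fun z : ℝ × Pt d => S.b z.1 z.2 (a z.1 z.2)) (S.timeVol.prod volume) := by
  -- Times are clamped to `[0, T]`, where the drift is continuous; on the open interval nothing
  -- changes.
  have h := hS.measurable_drift_comp (Z := ℝ × Pt d)
    (τ := fun z => (projIcc 0 S.T hS.T_pos.le z.1 : ℝ)) (y := fun z => z.2)
    (α := fun z => a z.1 z.2) ((continuous_subtype_val.comp
      (continuous_projIcc.comp continuous_fst)).measurable) measurable_snd ha.1
    (fun z => Subtype.coe_prop _) fun z => ha.mem_hull _ _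
  refine h.aestronglyMeasurable.congr (ae_timeVol_prod fun t ht x => ?_)
  simp only [projIcc_of_mem hS.T_pos.le (Ioo_subset_Icc_self ht)]

theorem Standing.aestronglyMeasurable_coef (hS : S.Standing) {a : ℝ → Pt d → Pt d}
    (ha : S.IsControl a) (k : Fin d ⊕ Fin d × Fin d) :
    AEStronglyMeasurable (fun z : ℝ × Pt d => S.coef a k z.1 z.2) (S.timeVol.prod volume) := by
  rcases k with i | ⟨i, k⟩
  · exact (by fun_prop : Continuous fun v : Pt d => v i).comp_aestronglyMeasurable
      (hS.aestronglyMeasurable_drift ha)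
  · refine aestronglyMeasurable_of_continuousOn_Ico ?_
    have h : ContinuousOn (fun q : ℝ × Pt d => S.σ q.1 q.2) (Ico 0 S.T ×ˢ univ) :=
      hS.σ_continuous.mono (prod_mono_left Ico_subset_Icc_self)
    have : Continuous fun B : Matrix (Fin d) (Fin d) ℝ => (1 / 2) * (B * Bᵀ) i k := by
      have h2 : Continuous fun B : Matrix (Fin d) (Fin d) ℝ => B * Bᵀ :=
        continuous_id.matrix_mul continuous_id.matrix_transpose
      exact continuous_const.mul (h2.matrix_elem i k)
    exact this.comp_continuousOn h

/-! ### States -/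

section State

variable {a : Fin M → ℝ → Pt d → Pt d} {m : Fin M → ℝ → Pt d → ℝ}

/-- Second moments are continuous on the compact interval `[0, T]`, hence uniformly bounded. This
provides the dominating function for all space-time integrands of quadratic growth. -/
theorem IsState.integrable_weight (hm : S.IsState a m) (j : Fin M) :
    Integrable (fun z : ℝ × Pt d => (1 + ‖z.2‖) ^ 2 * m j z.1 z.2) (S.timeVol.prod volume) := by
  have hmeas : Measurable fun z : ℝ × Pt d => m j z.1 z.2 := hm.measurable j
  have hsm : StronglyMeasurable fun z : ℝ × Pt d => (1 + ‖z.2‖) ^ 2 * m j z.1 z.2 :=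
    Measurable.stronglyMeasurable (by fun_prop)
  rw [integrable_prod_iff hsm.aestronglyMeasurable]
  constructor
  · exact ae_timeVol fun t ht => (hm.density j t (Ioo_subset_Icc_self ht)).integrable_weight
  · obtain ⟨C, hC⟩ := isCompact_Icc.exists_bound_of_continuousOn (hm.moment_continuous j)
    refine Integrable.of_bound (C := 2 * (1 + C))
      (StronglyMeasurable.integral_prod_right (f := fun t x => ‖(1 + ‖x‖) ^ 2 * m j t x‖)
        hsm.norm).aestronglyMeasurable ?_
    refine ae_timeVol fun t ht => ?_
    have hd := hm.density j t (Ioo_subset_Icc_self ht)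
    have e : ∀ x, ‖(1 + ‖x‖) ^ 2 * m j t x‖ = (1 + ‖x‖) ^ 2 * m j t x := fun x =>
      Real.norm_of_nonneg (mul_nonneg (by positivity) (hd.nonneg x))
    simp_rw [e]
    rw [Real.norm_of_nonneg (integral_nonneg fun x => mul_nonneg (by positivity) (hd.nonneg x))]
    have h1 := hd.integral_weight_le
    have h2 := (le_abs_self _).trans (hC t (Ioo_subset_Icc_self ht))
    linarith

theorem IsState.integrable_mul (hm : S.IsState a m) (j : Fin M) {φ : ℝ → Pt d → ℝ} {C : ℝ}
    (hφ : AEStronglyMeasurable (uncurry φ) (S.timeVol.prod volume))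
    (h : ∀ t ∈ Ioo 0 S.T, ∀ x, |φ t x| ≤ C * (1 + ‖x‖) ^ 2) :
    Integrable (fun z : ℝ × Pt d => φ z.1 z.2 * m j z.1 z.2) (S.timeVol.prod volume) :=
  integrable_mul_of_abs_le (hm.integrable_weight j) hφ (hm.measurable j).aestronglyMeasurable
    (ae_timeVol_prod h)

end State

/-! ### The interaction term -/

theorem Standing.integrable_kernel_mul (hS : S.Standing) {u : Pt d → ℝ} (hu : Integrable u)
    (x : Pt d) : Integrable fun y => S.kernel (x - y) * u y := by
  obtain ⟨C, -, hC⟩ := hS.exists_kernel_bound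
  have hk := hS.measurable_kernel
  exact hu.bdd_mul (c := C) (by fun_prop : Measurable fun y => S.kernel (x - y)).aestronglyMeasurable
    (Eventually.of_forall fun y => hC _)

/-- The kernel is bounded and densities have mass one, so one constant serves for all densities. -/
theorem Standing.exists_G_bound (hS : S.Standing) : ∃ C, 0 ≤ C ∧
    ∀ (m : Fin M → Pt d → ℝ) (j : Fin M), IsDensity2 (m j) → ∀ x, |S.G m x j| ≤ C := by
  obtain ⟨C, hC0, hC⟩ := hS.exists_kernel_bound
  refine ⟨C, hC0, fun m j hm x => ?_⟩
  have : ‖∫ y, S.kernel (x - y) * m j y‖ ≤ ∫ y, C * m j y := by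
    refine norm_integral_le_of_norm_le (hm.integrable.const_mul C) (Eventually.of_forall fun y => ?_)
    rw [norm_mul, Real.norm_of_nonneg (hm.nonneg y)]
    exact mul_le_mul_of_nonneg_right (hC _) (hm.nonneg y)
  rwa [integral_const_mul, hm.integral_eq_one, mul_one] at this

theorem Standing.measurable_G (hS : S.Standing) {m : Fin M → ℝ → Pt d → ℝ} (j : Fin M)
    (hm : Measurable (uncurry (m j))) :
    Measurable fun z : ℝ × Pt d => S.G (fun k => m k z.1) z.2 j := by
  have hk := hS.measurable_kernel
  have hm' : Measurable fun z : ℝ × Pt d => m j z.1 z.2 := hm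
  refine StronglyMeasurable.measurable ?_
  refine StronglyMeasurable.integral_prod_right
    (f := fun (z : ℝ × Pt d) y => S.kernel (z.2 - y) * m j z.1 y) ?_
  refine Measurable.stronglyMeasurable ?_
  have h2 : Measurable fun z : (ℝ × Pt d) × Pt d => m j z.1.1 z.2 :=
    hm'.comp (by fun_prop : Measurable fun z : (ℝ × Pt d) × Pt d => (z.1.1, z.2))
  have h1 : Measurable fun z : (ℝ × Pt d) × Pt d => S.kernel (z.1.2 - z.2) := by fun_prop
  exact h1.mul h2

theorem Standing.measurable_G_profile (hS : S.Standing) {m : Fin M → Pt d → ℝ} (j : Fin M)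
    (hm : Measurable (m j)) : Measurable fun x => S.G m x j := by
  have hk := hS.measurable_kernel
  have h : StronglyMeasurable fun z : Pt d × Pt d => S.kernel (z.1 - z.2) * m j z.2 :=
    Measurable.stronglyMeasurable (by fun_prop)
  exact h.integral_prod_right'.measurable

/-- Fubini together with evenness of the kernel. -/
theorem Standing.integral_G_mul_comm (hS : S.Standing) {m n : Fin M → Pt d → ℝ} {j k : Fin M}
    (hm : Integrable (m j)) (hn : Integrable (n k)) :
    ∫ x, S.G m x j * n k x = ∫ x, m j x * S.G n x k := by
  obtain ⟨C, -, hC⟩ := hS.exists_kernel_bound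
  have hI : Integrable (fun z : Pt d × Pt d => S.kernel (z.1 - z.2) * (n k z.1 * m j z.2))
      (volume.prod volume) := by
    have hk := hS.measurable_kernel
    exact (hn.mul_prod hm).bdd_mul (c := C)
      (by fun_prop : Measurable fun z : Pt d × Pt d => S.kernel (z.1 - z.2)).aestronglyMeasurable
      (Eventually.of_forall fun y => hC _)
  have e1 : ∀ x, S.G m x j * n k x = ∫ y, S.kernel (x - y) * (n k x * m j y) := fun x => by
    rw [G, ← integral_mul_const]
    refine integral_congr_ae (Eventually.of_forall fun y => ?_)
    simp only []
    ring
  have e2 : ∀ y, m j y * S.G n y k = ∫ x, S.kernel (x - y) * (n k x * m j y) := fun y => by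
    rw [G, ← integral_const_mul]
    refine integral_congr_ae (Eventually.of_forall fun x => ?_)
    simp only []
    rw [show x - y = -(y - x) by abel, hS.kernel_neg]
    ring
  simp_rw [e1, e2]
  exact integral_integral_swap hI

/-! ### The adjoint state -/

section Adjoint

variable {a : Fin M → ℝ → Pt d → Pt d} {m p : Fin M → ℝ → Pt d → ℝ}

theorem IsAdjoint.continuousOn_diffOp (hp : S.IsAdjoint a m p) (j : Fin M)
    (k : Fin d ⊕ Fin d × Fin d) :
    ContinuousOn (fun z : ℝ × Pt d => diffOp k (p j z.1) z.2) (Ico 0 S.T ×ˢ univ) := by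
  rcases k with i | ⟨i, k⟩
  · have := (by fun_prop : Continuous fun v : Pt d => v i).comp_continuousOn
      (hp.gradient_continuous j)
    refine this.congr fun z _ => ?_
    exact (gradient_apply (p j z.1) z.2 i).symm
  · have h2 : ContinuousOn (fun z : ℝ × Pt d => iteratedFDeriv ℝ 2 (p j z.1) z.2
        ![EuclideanSpace.single k (1 : ℝ), EuclideanSpace.single i (1 : ℝ)])
        (Ico 0 S.T ×ˢ univ) :=
      (ContinuousMultilinearMap.apply ℝ (fun _ : Fin 2 => Pt d) ℝ _).continuous.comp_continuousOn
        (hp.hessian_continuous j)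
    refine h2.congr fun z hz => ?_
    exact (hessian_apply (hp.contDiff j z.1 hz.1) z.2 k i).symm

/-- The mean value inequality on a ball around the origin integrates the gradient bound; `p j t 0`
is bounded by continuity on `[0, T]`. No second derivative enters, so the constant is uniform up to
`T`. -/
theorem IsAdjoint.exists_growth (hT : 0 < S.T) (hp : S.IsAdjoint a m p) :
    ∃ C, 0 ≤ C ∧ ∀ j, ∀ t ∈ Ico 0 S.T, ∀ x, ‖gradient (p j t) x‖ ≤ C * (1 + ‖x‖) ∧
      (∀ i, |pderiv i (p j t) x| ≤ C * (1 + ‖x‖)) ∧ |p j t x| ≤ C * (1 + ‖x‖) ^ 2 := by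
  obtain ⟨C, hC⟩ := hp.gradient_growth
  have hC' : ∀ j, ∀ t ∈ Ico 0 S.T, ∀ x, ‖gradient (p j t) x‖ ≤ |C| * (1 + ‖x‖) :=
    fun j t ht x => (hC j t ht x).trans
      (mul_le_mul_of_nonneg_right (le_abs_self C) (by positivity))
  have h0 : ∀ j, ∃ D, ∀ t ∈ Icc 0 S.T, ‖p j t 0‖ ≤ D := fun j => by
    refine isCompact_Icc.exists_bound_of_continuousOn (f := fun t => p j t 0) ?_
    exact (hp.continuous j).comp (by fun_prop : Continuous fun t : ℝ => (t, (0 : Pt d))).continuousOn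
      fun t ht => ⟨ht, mem_univ _⟩
  choose D hD using h0
  have hD0 : ∀ j, 0 ≤ D j := fun j => (norm_nonneg _).trans (hD j 0 ⟨le_rfl, hT.le⟩)
  have hDle : ∀ j, D j ≤ ∑ j, D j := fun j =>
    Finset.single_le_sum (fun j _ => hD0 j) (Finset.mem_univ j)
  have hDs : 0 ≤ ∑ j, D j := Finset.sum_nonneg fun j _ => hD0 j
  refine ⟨|C| + ∑ j, D j, by positivity, fun j t ht x => ?_⟩
  have hn := norm_nonneg x
  have hg : ‖gradient (p j t) x‖ ≤ (|C| + ∑ j, D j) * (1 + ‖x‖) :=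
    (hC' j t ht x).trans (mul_le_mul_of_nonneg_right (by linarith) (by positivity))
  refine ⟨hg, fun i => ?_, ?_⟩
  · rw [← gradient_apply]
    exact (PiLp.norm_apply_le (gradient (p j t) x) i).trans hg
  · have hdiff : Differentiable ℝ (p j t) := (hp.contDiff j t ht).differentiable two_ne_zero
    have hmv : ‖p j t x - p j t 0‖ ≤ (|C| * (1 + ‖x‖)) * ‖x - 0‖ := by
      refine (convex_closedBall (0 : Pt d) ‖x‖).norm_image_sub_le_of_norm_fderiv_le (𝕜 := ℝ)
        (fun y _ => hdiff y) (fun y hy => ?_) (by simp) (by simp)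
      have : ‖fderiv ℝ (p j t) y‖ = ‖gradient (p j t) y‖ := by
        rw [gradient, LinearIsometryEquiv.norm_map]
      rw [this]
      refine (hC' j t ht y).trans ?_
      have := mem_closedBall_zero_iff.1 hy
      gcongr
    have h1 := hD j t (Ico_subset_Icc_self ht)
    rw [sub_zero] at hmv
    have h2 : |p j t x| ≤ |C| * (1 + ‖x‖) * ‖x‖ + D j := by
      have := norm_sub_norm_le (p j t x) (p j t 0)
      simp only [Real.norm_eq_abs] at *
      linarith
    have h3 : |C| * (1 + ‖x‖) * ‖x‖ ≤ |C| * (1 + ‖x‖) ^ 2 := by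
      have := abs_nonneg C
      nlinarith [mul_nonneg this hn]
    have h4 : D j ≤ (∑ j, D j) * (1 + ‖x‖) ^ 2 := by
      have : (1 : ℝ) ≤ (1 + ‖x‖) ^ 2 := one_le_pow₀ (by linarith)
      nlinarith [hDle j]
    linarith

end Adjoint

end CrowdModel

/-! ### Duality between states and the adjoint equation -/

section

open Function Filter Topology

variable {d : ℕ}

/-- Version of `weak_equation_duality_of_contDiff` in which the time derivative is only given
almost everywhere. -/
theorem weak_equation_duality_of_contDiff_ae {τ R : ℝ} (hτ : 0 ≤ τ) {w q g : ℝ → Pt d → ℝ}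
    {c : Fin d ⊕ Fin d × Fin d → ℝ → Pt d → ℝ}
    (hw : Integrable (uncurry w) ((volume.restrict (Ioc 0 τ)).prod volume))
    (hw0 : Integrable (w 0)) (hwτ : Integrable (w τ))
    (hc : ∀ k, Integrable (uncurry (c k)) ((volume.restrict (Ioc 0 τ)).prod volume))
    (hq : ∀ u ∈ Icc 0 τ, ContDiff ℝ 2 (q u)) (hqs : ∀ u ∈ Icc 0 τ, ∀ x, R < ‖x‖ → q u x = 0)
    (hqc : ContinuousOn (uncurry q) (Icc 0 τ ×ˢ univ))
    (hqc' : ∀ k, ContinuousOn (fun z : ℝ × Pt d => diffOp k (q z.1) z.2) (Icc 0 τ ×ˢ univ))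
    (hg : AEStronglyMeasurable (uncurry g) ((volume.restrict (Ioc 0 τ)).prod volume))
    {C : ℝ} (hgC : ∀ u ∈ Ioc 0 τ, ∀ y, |g u y| ≤ C)
    (hweq : ∀ ρ : Pt d → ℝ, ContDiff ℝ ∞ ρ → HasCompactSupport ρ → ∀ t ∈ Icc 0 τ,
      (∫ x, w t x * ρ x) - (∫ x, w 0 x * ρ x) =
        ∫ u in (0 : ℝ)..t, ∫ x, ∑ k, c k u x * diffOp k ρ x)
    (hqeq : ∀ᵐ y, ∀ t ∈ Icc 0 τ, q t y - q 0 y = -∫ u in (0 : ℝ)..t, g u y) :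
    (∫ x, w τ x * q τ x) - (∫ x, w 0 x * q 0 x) =
      ∫ z, ((∑ k, c k z.1 z.2 * diffOp k (q z.1) z.2) - w z.1 z.2 * g z.1 z.2)
        ∂((volume.restrict (Ioc 0 τ)).prod volume) := by
  set μ : Measure (ℝ × Pt d) := (volume.restrict (Ioc 0 τ)).prod volume with hμ
  have hμ' : μ = volume.restrict (Ioc 0 τ ×ˢ univ) := by
    rw [hμ]
    conv_lhs => rw [← Measure.restrict_univ (μ := (volume : Measure (Pt d))), Measure.prod_restrict]
    rfl
  have hmem : ∀ᵐ z ∂μ, z.1 ∈ Ioc 0 τ := by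
    rw [hμ']
    exact (ae_restrict_mem (measurableSet_Ioc.prod .univ)).mono fun z hz => hz.1
  -- A measurable representative of `g`, clipped to `[-|C|, |C|]` so that it is bounded everywhere;
  -- clipping does not affect it where it agrees with `g`.
  set g' : ℝ → Pt d → ℝ := fun u x => max (-|C|) (min |C| (hg.mk _ (u, x))) with hg'
  have hg'm : Measurable (uncurry g') :=
    measurable_const.max (measurable_const.min hg.stronglyMeasurable_mk.measurable)
  have hg'C : ∀ u y, |g' u y| ≤ |C| := fun u y =>
    abs_le.2 ⟨le_max_left _ _, max_le (by linarith [abs_nonneg C]) (min_le_left _ _)⟩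
  have hgg' : ∀ᵐ z ∂μ, g z.1 z.2 = g' z.1 z.2 := by
    filter_upwards [hg.ae_eq_mk, hmem] with z h1 h2
    have h3 := abs_le.1 ((hgC z.1 h2 z.2).trans (le_abs_self C))
    have h1' : g z.1 z.2 = hg.mk _ (z.1, z.2) := h1
    simp only [hg']
    rw [← h1', min_eq_right h3.2, max_eq_right h3.1]
  -- By Fubini the slices agree for almost every `y`, so the integrated equation for `q` is
  -- unaffected by the change of representative.
  have hswap : ∀ᵐ y, ∀ᵐ u ∂(volume.restrict (Ioc 0 τ)), g u y = g' u y :=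
    Measure.ae_ae_of_ae_prod (Measure.measurePreserving_swap.quasiMeasurePreserving.ae hgg')
  have hqeq' : ∀ᵐ y, ∀ t ∈ Icc 0 τ, q t y - q 0 y = -∫ u in (0 : ℝ)..t, g' u y := by
    filter_upwards [hqeq, hswap] with y h1 h2 t ht
    rw [h1 t ht, intervalIntegral.integral_of_le ht.1, intervalIntegral.integral_of_le ht.1]
    congr 1
    exact integral_congr_ae (ae_mono (Measure.restrict_mono (Ioc_subset_Ioc_right ht.2) le_rfl) h2)
  have hsupp : ∀ k, ∀ u ∈ Icc 0 τ, ∀ x, R < ‖x‖ → diffOp k (q u) x = 0 := fun k u hu x hx => by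
    refine diffOp_eq_zero_of_eventuallyEq (c := 0) ?_ k
    filter_upwards [(isOpen_lt continuous_const continuous_norm).mem_nhds hx] with y hy
    exact hqs u hu y hy
  have hIk : ∀ k, Integrable (fun z : ℝ × Pt d => c k z.1 z.2 * diffOp k (q z.1) z.2) μ := by
    intro k
    obtain ⟨D, -, hD⟩ := exists_bound_of_continuousOn_of_support (hqc' k) (hsupp k)
    refine (hc k).mul_bdd (c := D) ?_ (hmem.mono fun z hz => hD z.1 (Ioc_subset_Icc_self hz) z.2)
    rw [hμ']
    exact ((hqc' k).mono (prod_mono_left Ioc_subset_Icc_self)).aestronglyMeasurable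
      (measurableSet_Ioc.prod .univ)
  have hIg : Integrable (fun z : ℝ × Pt d => w z.1 z.2 * g z.1 z.2) μ :=
    hw.mul_bdd (c := C) hg (hmem.mono fun z hz => hgC z.1 hz z.2)
  have hIg' : Integrable (fun z : ℝ × Pt d => w z.1 z.2 * g' z.1 z.2) μ :=
    hIg.congr (hgg'.mono fun z hz => by simp only [hz])
  rw [weak_equation_duality_of_contDiff hτ hw hw0 hwτ hc hq hqs hqc hqc' hg'm hg'C hweq hqeq',
    integral_sub (integrable_finsetSum _ fun k _ => hIk k) hIg,
    integral_finsetSum _ fun k _ => hIk k]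
  congr 1
  · exact Finset.sum_congr rfl fun k _ => (integral_prod _ (hIk k)).symm
  · rw [integral_congr_ae (hgg'.mono fun z hz => by simp only [hz] :
      (fun z : ℝ × Pt d => w z.1 z.2 * g z.1 z.2) =ᵐ[μ] fun z => w z.1 z.2 * g' z.1 z.2)]
    exact (integral_prod _ hIg').symm

theorem isCb2_of_hasCompactSupport {ρ : Pt d → ℝ} (hρ : ContDiff ℝ ∞ ρ)
    (hρs : HasCompactSupport ρ) : IsCb2 ρ := by
  have h2 : ContDiff ℝ 2 ρ := contDiff_infty.1 hρ 2
  obtain ⟨C0, h0⟩ := hρ.continuous.bounded_above_of_compact_support hρs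
  obtain ⟨C1, h1⟩ := (h2.continuous_fderiv two_ne_zero).bounded_above_of_compact_support
    (hρs.fderiv ℝ)
  obtain ⟨C2, h2'⟩ := (h2.continuous_iteratedFDeriv le_rfl).bounded_above_of_compact_support
    (hρs.iteratedFDeriv 2)
  refine ⟨h2, max C0 (max C1 C2), fun x => ⟨(h0 x).trans (le_max_left _ _),
    (h1 x).trans ((le_max_left _ _).trans (le_max_right _ _)),
    (h2' x).trans ((le_max_right _ _).trans (le_max_right _ _))⟩⟩

end

namespace CrowdModel

open Function Filter Topology

variable {d M : ℕ} {S : CrowdModel d M} {a a' : Fin M → ℝ → Pt d → Pt d}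
  {m m' p : Fin M → ℝ → Pt d → ℝ}

/-- The linearization of the interaction term which enters the adjoint equation. -/
def adjointInteraction (S : CrowdModel d M) (m : Fin M → Pt d → ℝ) (j : Fin M) (x : Pt d) : ℝ :=
  (S.G m x ᵥ* (S.Λ + S.Λᵀ)) j

/-- `∂p_j/∂t` plus the generator belonging to the control `α`, applied to `p_j`. -/
def adjointGap (S : CrowdModel d M) (a : Fin M → ℝ → Pt d → Pt d) (m p : Fin M → ℝ → Pt d → ℝ)
    (α : ℝ → Pt d → Pt d) (j : Fin M) (t : ℝ) (x : Pt d) : ℝ :=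
  inner ℝ (S.b t x (α t x)) (gradient (p j t) x) -
    ((1 / 2) * ‖a j t x‖ ^ 2 + S.adjointInteraction (fun k => m k t) j x +
      inner ℝ (S.b t x (a j t x)) (gradient (p j t) x))

theorem adjointInteraction_eq_sum (m : Fin M → Pt d → ℝ) (j : Fin M) (x : Pt d) :
    S.adjointInteraction m j x = ∑ k, S.G m x k * (S.Λ k j + S.Λ j k) := by
  simp [adjointInteraction, Matrix.vecMul, dotProduct]

theorem Standing.exists_adjointInteraction_bound (hS : S.Standing) : ∃ C, 0 ≤ C ∧
    ∀ m : Fin M → Pt d → ℝ, (∀ j, IsDensity2 (m j)) → ∀ j x,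
      |S.adjointInteraction m j x| ≤ C := by
  obtain ⟨C, hC0, hC⟩ := hS.exists_G_bound
  refine ⟨∑ j, ∑ k, C * |S.Λ k j + S.Λ j k|, by positivity, fun m hm j x => ?_⟩
  rw [adjointInteraction_eq_sum]
  refine (Finset.abs_sum_le_sum_abs _ _).trans ?_
  refine le_trans ?_ (Finset.single_le_sum (f := fun j => ∑ k, C * |S.Λ k j + S.Λ j k|)
    (fun j _ => by positivity) (Finset.mem_univ j))
  refine Finset.sum_le_sum fun k _ => ?_
  rw [abs_mul]
  exact mul_le_mul_of_nonneg_right (hC m k (hm k) x) (abs_nonneg _)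

theorem IsState.measurable_adjointInteraction (hS : S.Standing) (hm : S.IsState a m) (j : Fin M) :
    Measurable fun z : ℝ × Pt d => S.adjointInteraction (fun k => m k z.1) j z.2 := by
  simp_rw [adjointInteraction_eq_sum]
  exact Finset.measurable_sum _ fun k _ => (hS.measurable_G k (hm.measurable k)).mul_const _

theorem IsAdjoint.adjointBracket_eq (hp : S.IsAdjoint a m p) (j : Fin M) {t : ℝ}
    (ht : t ∈ Ico 0 S.T) (x : Pt d) :
    S.adjointBracket a m p j t x = (1 / 2) * ‖a j t x‖ ^ 2 +
      S.adjointInteraction (fun k => m k t) j x + ∑ k, S.coef (a j) k t x * diffOp k (p j t) x := by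
  rw [← generator_eq (hp.contDiff j t ht), adjointBracket, adjointInteraction]
  ring

/-- The diffusion does not depend on the control, so the second-order terms of the generator and of
the bracket cancel. -/
theorem IsAdjoint.adjointGap_eq (hp : S.IsAdjoint a m p) (α : ℝ → Pt d → Pt d) (j : Fin M) {t : ℝ}
    (ht : t ∈ Ico 0 S.T) (x : Pt d) :
    S.adjointGap a m p α j t x =
      (∑ k, S.coef α k t x * diffOp k (p j t) x) - S.adjointBracket a m p j t x := by
  rw [← generator_eq (hp.contDiff j t ht), adjointBracket, adjointGap, adjointInteraction]
  ring

theorem aestronglyMeasurable_inner_drift (hS : S.Standing) (hp : S.IsAdjoint a m p)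
    {α : ℝ → Pt d → Pt d} (hα : S.IsControl α) (j : Fin M) :
    AEStronglyMeasurable (fun z : ℝ × Pt d => inner ℝ (S.b z.1 z.2 (α z.1 z.2))
      (gradient (p j z.1) z.2)) (S.timeVol.prod volume) :=
  (hS.aestronglyMeasurable_drift hα).inner
    (aestronglyMeasurable_of_continuousOn_Ico (hp.gradient_continuous j))

theorem aestronglyMeasurable_adjointGap (hS : S.Standing) (ha : ∀ j, S.IsControl (a j))
    (hm : S.IsState a m) (hp : S.IsAdjoint a m p) {α : ℝ → Pt d → Pt d} (hα : S.IsControl α)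
    (j : Fin M) :
    AEStronglyMeasurable (uncurry (S.adjointGap a m p α j)) (S.timeVol.prod volume) := by
  have h1 : Measurable fun z : ℝ × Pt d => (1 / 2) * ‖a j z.1 z.2‖ ^ 2 := by
    have : Measurable fun z : ℝ × Pt d => a j z.1 z.2 := (ha j).1
    fun_prop
  exact (aestronglyMeasurable_inner_drift hS hp hα j).sub
    ((h1.aestronglyMeasurable.add
      (hm.measurable_adjointInteraction hS j).aestronglyMeasurable).add
      (aestronglyMeasurable_inner_drift hS hp (ha j) j))

/-- Drift and gradient each grow linearly, and the remaining terms are bounded. Without second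
derivatives of `p`, the bound holds uniformly up to the final time. -/
theorem exists_adjointGap_bound (hS : S.Standing) (ha : ∀ j, S.IsControl (a j))
    (hm : S.IsState a m) (hp : S.IsAdjoint a m p) : ∃ C, 0 ≤ C ∧
    ∀ α : ℝ → Pt d → Pt d, S.IsControl α → ∀ j, ∀ t ∈ Ico 0 S.T, ∀ x,
      |S.adjointGap a m p α j t x| ≤ C * (1 + ‖x‖) ^ 2 := by
  obtain ⟨K, hK0, hK⟩ := hS.exists_growth
  obtain ⟨C, hC0, hC⟩ := hp.exists_growth hS.T_pos
  obtain ⟨D, hD0, hD⟩ := hS.exists_adjointInteraction_bound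
  refine ⟨2 * (K * C) + (1 / 2) * K ^ 2 + D, by positivity, fun α hα j t ht x => ?_⟩
  have ht' := Ico_subset_Icc_self ht
  have hW : (1 : ℝ) ≤ (1 + ‖x‖) ^ 2 := one_le_pow₀ (by linarith [norm_nonneg x])
  have hin : ∀ β : ℝ → Pt d → Pt d, S.IsControl β →
      |inner ℝ (S.b t x (β t x)) (gradient (p j t) x)| ≤ K * C * (1 + ‖x‖) ^ 2 := fun β hβ => by
    refine (abs_real_inner_le_norm _ _).trans ?_
    calc _ ≤ (K * (1 + ‖x‖)) * (C * (1 + ‖x‖)) :=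
          mul_le_mul (hK t ht' x _ (hβ.mem_hull t x)).2.1 (hC j t ht x).1 (norm_nonneg _)
            (by positivity)
      _ = _ := by ring
  have h1 := abs_le.1 (hin α hα)
  have h2 := abs_le.1 (hin (a j) (ha j))
  have h3 := abs_le.1 (hD (fun k => m k t) (fun k => hm.density k t ht') j x)
  have h4 : (1 / 2) * ‖a j t x‖ ^ 2 ≤ (1 / 2) * K ^ 2 := by
    have := (hK t ht' x _ ((ha j).mem_hull t x)).1
    gcongr
  have h5 : 0 ≤ (1 / 2) * ‖a j t x‖ ^ 2 := by positivity
  have h6 : ((1 / 2) * K ^ 2 + D) * 1 ≤ ((1 / 2) * K ^ 2 + D) * (1 + ‖x‖) ^ 2 := by gcongr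
  unfold adjointGap
  rw [abs_le]
  constructor <;> nlinarith [h1.1, h1.2, h2.1, h2.2, h3.1, h3.2]

/-! #### The commutator with the cutoff -/

/-- The commutator of a differential operator with the multiplication by a cutoff function. -/
def cutoffCommutator (n : ℕ) (k : Fin d ⊕ Fin d × Fin d) (f : Pt d → ℝ) (x : Pt d) : ℝ :=
  diffOp k (fun y => cutoff d n y * f y) x - cutoff d n x * diffOp k f x

theorem contDiff_two_cutoff (n : ℕ) : ContDiff ℝ 2 (cutoff d n) :=
  contDiff_cutoff (d := d) (m := 2) n

theorem cutoffCommutator_inl (n : ℕ) (i : Fin d) {f : Pt d → ℝ} (hf : ContDiff ℝ 2 f) (x : Pt d) :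
    cutoffCommutator n (Sum.inl i) f x = pderiv i (cutoff d n) x * f x := by
  simp only [cutoffCommutator, diffOp]
  rw [pderiv_mul ((contDiff_two_cutoff n).differentiable two_ne_zero x)
    (hf.differentiable two_ne_zero x)]
  ring

theorem cutoffCommutator_inr (n : ℕ) (ik : Fin d × Fin d) {f : Pt d → ℝ} (hf : ContDiff ℝ 2 f)
    (x : Pt d) :
    cutoffCommutator n (Sum.inr ik) f x = pderiv ik.2 (cutoff d n) x * pderiv ik.1 f x +
      pderiv ik.1 (cutoff d n) x * pderiv ik.2 f x +
        pderiv ik.2 (pderiv ik.1 (cutoff d n)) x * f x := by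
  simp only [cutoffCommutator, diffOp]
  rw [pderiv_pderiv_mul (contDiff_two_cutoff n) hf]
  ring

/-- Every term of the commutator contains a derivative of the cutoff, which is constant near such a
point. -/
theorem cutoffCommutator_eq_zero {n : ℕ} (k : Fin d ⊕ Fin d × Fin d) {f : Pt d → ℝ}
    (hf : ContDiff ℝ 2 f) {x : Pt d} (hx : ‖x‖ < (n : ℝ) + 1) : cutoffCommutator n k f x = 0 := by
  have h := fun k => diffOp_eq_zero_of_eventuallyEq (cutoff_eventuallyEq_one hx) k
  rcases k with i | ⟨i, k⟩
  · have h1 := h (Sum.inl i)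
    simp only [diffOp] at h1
    rw [cutoffCommutator_inl n i hf, h1, zero_mul]
  · have h1 := h (Sum.inl i)
    have h2 := h (Sum.inl k)
    have h3 := h (Sum.inr (i, k))
    simp only [diffOp] at h1 h2 h3
    rw [cutoffCommutator_inr n (i, k) hf, h1, h2, h3]
    simp

theorem IsAdjoint.continuousOn_Ico (hp : S.IsAdjoint a m p) (j : Fin M) :
    ContinuousOn (fun z : ℝ × Pt d => p j z.1 z.2) (Ico 0 S.T ×ˢ univ) :=
  (hp.continuous j).mono (prod_mono_left Ico_subset_Icc_self)

theorem IsAdjoint.continuousOn_cutoffCommutator (hp : S.IsAdjoint a m p) (j : Fin M) (n : ℕ)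
    (k : Fin d ⊕ Fin d × Fin d) :
    ContinuousOn (fun z : ℝ × Pt d => cutoffCommutator n k (p j z.1) z.2)
      (Ico 0 S.T ×ˢ univ) := by
  have hχ : ∀ k, ContinuousOn (fun z : ℝ × Pt d => diffOp k (cutoff d n) z.2)
      (Ico 0 S.T ×ˢ univ) := fun k =>
    ((continuous_diffOp (contDiff_two_cutoff n) k).comp continuous_snd).continuousOn
  rcases k with i | ik
  · exact ((hχ (Sum.inl i)).mul (hp.continuousOn_Ico j)).congr fun z hz =>
      cutoffCommutator_inl n i (hp.contDiff j z.1 hz.1) z.2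
  · exact ((((hχ (Sum.inl ik.2)).mul (hp.continuousOn_diffOp j (Sum.inl ik.1))).add
      ((hχ (Sum.inl ik.1)).mul (hp.continuousOn_diffOp j (Sum.inl ik.2)))).add
      ((hχ (Sum.inr ik)).mul (hp.continuousOn_Ico j))).congr fun z hz =>
      cutoffCommutator_inr n ik (hp.contDiff j z.1 hz.1) z.2

/-- With `W = 1 + ‖x‖`, each derivative of the cutoff compensates one power of `W`. First order: `W`
from the drift and `W ^ 2` from `p`, less one power. Second order: `W ^ 2` from the coefficient
times three bounded products, whence the factor `3`. -/
theorem exists_coef_mul_commutator_bound (hS : S.Standing) (hp : S.IsAdjoint a m p) : ∃ C, 0 ≤ C ∧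
    ∀ α : ℝ → Pt d → Pt d, S.IsControl α → ∀ j (n : ℕ) k, ∀ t ∈ Ico 0 S.T, ∀ x,
      |S.coef α k t x * cutoffCommutator n k (p j t) x| ≤ C * (1 + ‖x‖) ^ 2 := by
  obtain ⟨K, hK0, hK⟩ := hS.exists_coef_growth
  obtain ⟨C, hC0, hC⟩ := hp.exists_growth hS.T_pos
  obtain ⟨D, hD0, hD⟩ := exists_bound_diffOp_cutoff d
  refine ⟨3 * (K * C * D), by positivity, fun α hα j n k t ht x => ?_⟩
  have hc2 := hp.contDiff j t ht
  obtain ⟨hb1, hb2⟩ := hK α hα t (Ico_subset_Icc_self ht) x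
  obtain ⟨-, hg, hv⟩ := hC j t ht x
  set W := 1 + ‖x‖ with hWdef
  have hW : 0 ≤ W := by positivity
  have hmain : 0 ≤ K * C * D * W ^ 2 := by positivity
  rcases k with i | ⟨i, k⟩
  · rw [cutoffCommutator_inl n i hc2, abs_mul, abs_mul]
    calc _ ≤ (K * W) * (|pderiv i (cutoff d n) x| * (C * W ^ 2)) :=
          mul_le_mul (hb1 i) (mul_le_mul_of_nonneg_left hv (abs_nonneg _)) (by positivity)
            (by positivity)
      _ = (K * C * W ^ 2) * (|pderiv i (cutoff d n) x| * W) := by ring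
      _ ≤ (K * C * W ^ 2) * D := mul_le_mul_of_nonneg_left (hD n x i i).1 (by positivity)
      _ ≤ _ := by nlinarith
  · rw [cutoffCommutator_inr n (i, k) hc2, abs_mul]
    have hprod : ∀ i k, |pderiv k (cutoff d n) x * pderiv i (p j t) x| ≤ C * D := fun i k => by
      rw [abs_mul]
      calc _ ≤ |pderiv k (cutoff d n) x| * (C * W) :=
            mul_le_mul_of_nonneg_left (hg i) (abs_nonneg _)
        _ = C * (|pderiv k (cutoff d n) x| * W) := by ring
        _ ≤ _ := mul_le_mul_of_nonneg_left (hD n x k k).1 hC0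
    have hlast : |pderiv k (pderiv i (cutoff d n)) x * p j t x| ≤ C * D := by
      rw [abs_mul]
      calc _ ≤ |pderiv k (pderiv i (cutoff d n)) x| * (C * W ^ 2) :=
            mul_le_mul_of_nonneg_left hv (abs_nonneg _)
        _ = C * (|pderiv k (pderiv i (cutoff d n)) x| * W ^ 2) := by ring
        _ ≤ _ := mul_le_mul_of_nonneg_left (hD n x i k).2 hC0
    calc _ ≤ (K * W ^ 2) * (3 * (C * D)) := by
          refine mul_le_mul (hb2 _) ?_ (abs_nonneg _) (by positivity)
          refine (abs_add_le _ _).trans ?_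
          have := (abs_add_le (pderiv k (cutoff d n) x * pderiv i (p j t) x)
            (pderiv i (cutoff d n) x * pderiv k (p j t) x))
          linarith [hprod i k, hprod k i]
      _ = _ := by ring

end CrowdModel

/-! ### Duality for the truncated adjoint state before the final time. -/

namespace CrowdModel

open Function Filter Topology

variable {d M : ℕ} {S : CrowdModel d M} {a a' : Fin M → ℝ → Pt d → Pt d}
  {m m' p : Fin M → ℝ → Pt d → ℝ}

/-- `∂/∂t` plus the generator belonging to the control `α`, applied to the product of the `n`-th
cutoff function and `p_j`. -/
def cutoffGap (S : CrowdModel d M) (a : Fin M → ℝ → Pt d → Pt d) (m p : Fin M → ℝ → Pt d → ℝ)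
    (α : ℝ → Pt d → Pt d) (j : Fin M) (n : ℕ) (t : ℝ) (x : Pt d) : ℝ :=
  cutoff d n x * S.adjointGap a m p α j t x +
    ∑ k, S.coef α k t x * cutoffCommutator n k (p j t) x

theorem exists_cutoffGap_bound (hS : S.Standing) (ha : ∀ j, S.IsControl (a j))
    (hm : S.IsState a m) (hp : S.IsAdjoint a m p) : ∃ C, 0 ≤ C ∧
    ∀ α : ℝ → Pt d → Pt d, S.IsControl α → ∀ j n, ∀ t ∈ Ico 0 S.T, ∀ x,
      |S.cutoffGap a m p α j n t x| ≤ C * (1 + ‖x‖) ^ 2 := by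
  obtain ⟨C, hC0, hC⟩ := exists_adjointGap_bound hS ha hm hp
  obtain ⟨D, hD0, hD⟩ := exists_coef_mul_commutator_bound hS hp
  refine ⟨C + ∑ _k : Fin d ⊕ Fin d × Fin d, D, by positivity, fun α hα j n t ht x => ?_⟩
  rw [add_mul, Finset.sum_mul]
  refine (abs_add_le _ _).trans (add_le_add ?_ ((Finset.abs_sum_le_sum_abs _ _).trans
    (Finset.sum_le_sum fun k _ => hD α hα j n k t ht x)))
  rw [abs_mul]
  calc _ ≤ 1 * |S.adjointGap a m p α j t x| :=
        mul_le_mul_of_nonneg_right (abs_cutoff_le_one n x) (abs_nonneg _)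
    _ ≤ _ := by rw [one_mul]; exact hC α hα j t ht x

theorem aestronglyMeasurable_cutoffGap (hS : S.Standing) (ha : ∀ j, S.IsControl (a j))
    (hm : S.IsState a m) (hp : S.IsAdjoint a m p) {α : ℝ → Pt d → Pt d} (hα : S.IsControl α)
    (j : Fin M) (n : ℕ) :
    AEStronglyMeasurable (uncurry (S.cutoffGap a m p α j n)) (S.timeVol.prod volume) := by
  have h1 : Continuous fun z : ℝ × Pt d => cutoff d n z.2 :=
    (contDiff_two_cutoff n).continuous.comp continuous_snd
  have h2 : AEStronglyMeasurable (fun z : ℝ × Pt d =>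
      ∑ k, S.coef α k z.1 z.2 * cutoffCommutator n k (p j z.1) z.2) (S.timeVol.prod volume) :=
    Finset.aestronglyMeasurable_fun_sum _ fun k _ => (hS.aestronglyMeasurable_coef hα k).mul
      (aestronglyMeasurable_of_continuousOn_Ico (hp.continuousOn_cutoffCommutator j n k))
  exact (h1.aestronglyMeasurable.mul (aestronglyMeasurable_adjointGap hS ha hm hp hα j)).add h2

theorem integrable_restrict_Ioc {f : ℝ × Pt d → ℝ} (hf : Integrable f (S.timeVol.prod volume))
    {τ : ℝ} (hτ : τ < S.T) : Integrable f ((volume.restrict (Ioc 0 τ)).prod volume) := by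
  refine hf.mono_measure (Measure.prod_mono ?_ le_rfl)
  exact Measure.restrict_mono (show Ioc 0 τ ⊆ Ioo 0 S.T from
    fun u hu => ⟨hu.1, hu.2.trans_lt hτ⟩) le_rfl

theorem aestronglyMeasurable_restrict_Ioc {f : ℝ × Pt d → ℝ}
    (hf : AEStronglyMeasurable f (S.timeVol.prod volume))
    {τ : ℝ} (hτ : τ < S.T) : AEStronglyMeasurable f ((volume.restrict (Ioc 0 τ)).prod volume) := by
  refine hf.mono_measure (Measure.prod_mono ?_ le_rfl)
  exact Measure.restrict_mono (show Ioc 0 τ ⊆ Ioo 0 S.T from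
    fun u hu => ⟨hu.1, hu.2.trans_lt hτ⟩) le_rfl

theorem aestronglyMeasurable_adjointBracket (hS : S.Standing) (ha : ∀ j, S.IsControl (a j))
    (hm : S.IsState a m) (hp : S.IsAdjoint a m p) (j : Fin M) :
    AEStronglyMeasurable (uncurry (S.adjointBracket a m p j)) (S.timeVol.prod volume) := by
  have h1 : Measurable fun z : ℝ × Pt d => (1 / 2) * ‖a j z.1 z.2‖ ^ 2 := by
    have : Measurable fun z : ℝ × Pt d => a j z.1 z.2 := (ha j).1
    fun_prop
  have h2 : AEStronglyMeasurable (fun z : ℝ × Pt d =>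
      ∑ k, S.coef (a j) k z.1 z.2 * diffOp k (p j z.1) z.2) (S.timeVol.prod volume) :=
    Finset.aestronglyMeasurable_fun_sum _ fun k _ => (hS.aestronglyMeasurable_coef (ha j) k).mul
      (aestronglyMeasurable_of_continuousOn_Ico (hp.continuousOn_diffOp j k))
  refine ((h1.aestronglyMeasurable.add
    (hm.measurable_adjointInteraction hS j).aestronglyMeasurable).add h2).congr
    (ae_timeVol_prod fun t ht x => ?_)
  exact (hp.adjointBracket_eq j (Ioo_subset_Ico_self ht) x).symm

/-- On the support of the cutoff and up to `τ < T` the derivatives of `p j` are continuous on a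
compact set; coefficients are bounded there and the interaction is bounded everywhere. -/
theorem exists_cutoff_mul_adjointBracket_bound (hS : S.Standing) (ha : ∀ j, S.IsControl (a j))
    (hm : S.IsState a m) (hp : S.IsAdjoint a m p) (j : Fin M) (n : ℕ) {τ : ℝ}
    (hτ : τ ∈ Ico 0 S.T) :
    ∃ C, ∀ u ∈ Ioc 0 τ, ∀ x, |cutoff d n x * S.adjointBracket a m p j u x| ≤ C := by
  obtain ⟨K, hK0, hK⟩ := hS.exists_growth
  obtain ⟨L, hL0, hL⟩ := hS.exists_coef_growth
  obtain ⟨D, hD0, hD⟩ := hS.exists_adjointInteraction_bound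
  set R : ℝ := 2 * ((n : ℝ) + 1) with hR
  have hsub : Icc 0 τ ⊆ Ico 0 S.T := fun u hu => ⟨hu.1, hu.2.trans_lt hτ.2⟩
  have hB : ∀ k, ∃ B, ∀ z ∈ Icc 0 τ ×ˢ Metric.closedBall (0 : Pt d) R,
      ‖diffOp k (p j z.1) z.2‖ ≤ B := fun k =>
    (isCompact_Icc.prod (isCompact_closedBall _ _)).exists_bound_of_continuousOn
      ((hp.continuousOn_diffOp j k).mono (prod_mono hsub (subset_univ _)))
  choose B hB using hB
  refine ⟨(1 / 2) * K ^ 2 + D + ∑ k, L * (1 + R) ^ 2 * |B k|, fun u hu x => ?_⟩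
  have hu' := Ioc_subset_Icc_self hu
  have huT := hsub hu'
  have huT' := Ico_subset_Icc_self huT
  have hR0 : 0 ≤ R := by positivity
  by_cases hx : R < ‖x‖
  · rw [cutoff_eq_zero hx, zero_mul, abs_zero]
    positivity
  · rw [abs_mul]
    have hx' := not_lt.1 hx
    refine (mul_le_mul_of_nonneg_right (abs_cutoff_le_one n x) (abs_nonneg _)).trans ?_
    rw [one_mul, hp.adjointBracket_eq j huT]
    refine (abs_add_le _ _).trans (add_le_add ((abs_add_le _ _).trans (add_le_add ?_
      (hD _ (fun k => hm.density k u huT') j x)))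
      ((Finset.abs_sum_le_sum_abs _ _).trans (Finset.sum_le_sum fun k _ => ?_)))
    · rw [abs_of_nonneg (by positivity)]
      have := (hK u huT' x _ ((ha j).mem_hull u x)).1
      gcongr
    · rw [abs_mul]
      refine mul_le_mul (((hL _ (ha j) u huT' x).2 k).trans (by gcongr)) ?_ (abs_nonneg _)
        (by positivity)
      exact (hB k (u, x) ⟨hu', by simpa using hx'⟩).trans (le_abs_self _)

theorem IsState.weak_equation (hm' : S.IsState a' m') (j : Fin M) {ρ : Pt d → ℝ}
    (hρ : ContDiff ℝ ∞ ρ) (hρs : HasCompactSupport ρ) {t : ℝ} (ht : t ∈ Icc 0 S.T) :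
    (∫ x, m' j t x * ρ x) - (∫ x, m' j 0 x * ρ x) =
      ∫ u in (0 : ℝ)..t, ∫ x, ∑ k, S.coef (a' j) k u x * m' j u x * diffOp k ρ x := by
  have := hm'.equation j ρ (isCb2_of_hasCompactSupport hρ hρs) t ht
  simp_rw [generator_eq (contDiff_infty.1 hρ 2) _ _ (a' j), Finset.sum_mul] at this
  simp_rw [mul_comm (m' j _ _) (ρ _), mul_right_comm (S.coef (a' j) _ _ _) (m' j _ _)]
  exact this

/-- The general duality is applied to the cutoff times `p j`. The generator of this product is the
cutoff times the generator of `p j` plus commutators; together with the time derivative this gives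
`cutoffGap`. The restriction `τ < T` avoids the final time, where the second derivatives of `p j`
need not exist. -/
theorem duality_cutoff (hS : S.Standing) (ha : ∀ j, S.IsControl (a j))
    (hm : S.IsState a m) (hp : S.IsAdjoint a m p) (ha' : ∀ j, S.IsControl (a' j))
    (hm' : S.IsState a' m') (j : Fin M) (n : ℕ) {τ : ℝ} (hτ : τ ∈ Ico 0 S.T) :
    (∫ x, m' j τ x * (cutoff d n x * p j τ x)) - (∫ x, m' j 0 x * (cutoff d n x * p j 0 x)) =
      ∫ u in (0 : ℝ)..τ, ∫ x, S.cutoffGap a m p (a' j) j n u x * m' j u x := by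
  have hsub : Icc 0 τ ⊆ Ico 0 S.T := fun u hu => ⟨hu.1, hu.2.trans_lt hτ.2⟩
  have h0T : (0 : ℝ) ∈ Icc 0 S.T := ⟨le_rfl, hS.T_pos.le⟩
  obtain ⟨C, hC⟩ := exists_cutoff_mul_adjointBracket_bound hS ha hm hp j n hτ
  obtain ⟨L, hL0, hL⟩ := hS.exists_coef_growth
  obtain ⟨D, hD0, hD⟩ := exists_cutoffGap_bound hS ha hm hp
  have hχc : Continuous (cutoff d n) := (contDiff_two_cutoff n).continuous
  have hχc' : Continuous fun z : ℝ × Pt d => cutoff d n z.2 := hχc.comp continuous_snd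
  have hw : Integrable (uncurry (m' j)) (S.timeVol.prod volume) := by
    have := hm'.integrable_mul j (φ := fun _ _ => 1) (C := 1) (by exact aestronglyMeasurable_const)
      fun t _ x => by
        rw [abs_one, one_mul]
        exact one_le_pow₀ (by linarith [norm_nonneg x])
    simp only [one_mul] at this
    exact this
  have key := weak_equation_duality_of_contDiff_ae (R := 2 * ((n : ℝ) + 1)) hτ.1 (w := m' j)
    (q := fun u x => cutoff d n x * p j u x)
    (g := fun u x => cutoff d n x * S.adjointBracket a m p j u x)
    (c := fun k u x => S.coef (a' j) k u x * m' j u x) (C := C)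
    (integrable_restrict_Ioc hw hτ.2) (hm'.density j 0 h0T).integrable
    (hm'.density j τ (Ico_subset_Icc_self hτ)).integrable
    (fun k => integrable_restrict_Ioc (hm'.integrable_mul j (φ := S.coef (a' j) k)
      (hS.aestronglyMeasurable_coef (ha' j) k)
      fun t ht x => (hL _ (ha' j) t (Ioo_subset_Icc_self ht) x).2 k) hτ.2)
    (fun u hu => (contDiff_two_cutoff n).mul (hp.contDiff j u (hsub hu)))
    (fun u _ x hx => by rw [cutoff_eq_zero hx, zero_mul])
    (hχc'.continuousOn.mul ((hp.continuousOn_Ico j).mono (prod_mono_left hsub)))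
    (fun k => ?_) ?_ hC
    (fun ρ hρ hρs t ht => hm'.weak_equation j hρ hρs (Ico_subset_Icc_self (hsub ht))) ?_
  · rw [key, intervalIntegral.integral_of_le hτ.1]
    have hI := integrable_restrict_Ioc (hm'.integrable_mul j
      (aestronglyMeasurable_cutoffGap hS ha hm hp (ha' j) j n)
      fun t ht x => hD _ (ha' j) j n t (Ioo_subset_Ico_self ht) x) hτ.2
    rw [← integral_prod _ hI]
    have hmem : ∀ᵐ z ∂((volume.restrict (Ioc 0 τ)).prod (volume : Measure (Pt d))),
        z.1 ∈ Ioc 0 τ :=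
      Measure.quasiMeasurePreserving_fst.ae (ae_restrict_mem measurableSet_Ioc)
    refine integral_congr_ae (hmem.mono fun z hz => ?_)
    have hz' := hsub (Ioc_subset_Icc_self hz)
    simp only [cutoffGap, cutoffCommutator, hp.adjointGap_eq _ j hz']
    simp only [mul_sub, Finset.sum_sub_distrib]
    have e1 : ∑ k, S.coef (a' j) k z.1 z.2 * (cutoff d n z.2 * diffOp k (p j z.1) z.2) =
        cutoff d n z.2 * ∑ k, S.coef (a' j) k z.1 z.2 * diffOp k (p j z.1) z.2 := by
      rw [Finset.mul_sum]
      exact Finset.sum_congr rfl fun k _ => by ring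
    have e2 : ∑ k, S.coef (a' j) k z.1 z.2 * m' j z.1 z.2 *
          diffOp k (fun y => cutoff d n y * p j z.1 y) z.2 =
        (∑ k, S.coef (a' j) k z.1 z.2 *
          diffOp k (fun y => cutoff d n y * p j z.1 y) z.2) * m' j z.1 z.2 := by
      rw [Finset.sum_mul]
      exact Finset.sum_congr rfl fun k _ => by ring
    rw [e1, e2]
    ring
  · have h1 := hp.continuousOn_cutoffCommutator j n k
    have h2 := h1.add (hχc'.continuousOn.mul (hp.continuousOn_diffOp j k))
    refine (h2.mono (prod_mono_left hsub)).congr fun z _ => ?_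
    simp [cutoffCommutator]
  · exact aestronglyMeasurable_restrict_Ioc (S := S) (hχc'.aestronglyMeasurable.mul
      (aestronglyMeasurable_adjointBracket hS ha hm hp j)) hτ.2
  · filter_upwards [hp.equation j] with y hy t ht
    rw [← mul_sub, hy 0 ⟨le_rfl, hS.T_pos⟩ t (hsub ht), intervalIntegral.integral_const_mul]
    ring

/-! ### Passage to the final time and removal of the cutoff. -/

theorem Standing.continuous_terminalCost (hS : S.Standing) (j : Fin M) : Continuous (S.Ψ j) := by
  obtain ⟨K, hK, h⟩ := hS.Ψ_lipschitz
  refine (LipschitzWith.of_dist_le_mul (K := ⟨K, hK.le⟩) fun x y => ?_).continuous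
  rw [Real.dist_eq, dist_eq_norm]
  exact h j x y

theorem Standing.exists_terminalCost_bound (hS : S.Standing) (j : Fin M) :
    ∃ C, 0 ≤ C ∧ ∀ x, |S.Ψ j x| ≤ C * (1 + ‖x‖) ^ 2 := by
  obtain ⟨K, hK, h⟩ := hS.Ψ_lipschitz
  refine ⟨K + |S.Ψ j 0|, by positivity, fun x => ?_⟩
  have h1 := h j x 0
  rw [sub_zero] at h1
  have h2 := abs_sub_abs_le_abs_sub (S.Ψ j x) (S.Ψ j 0)
  have h3 := norm_nonneg x
  have h4 := abs_nonneg (S.Ψ j 0)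
  have h5 : |S.Ψ j 0| * ‖x‖ ≥ 0 := by positivity
  have h6 : |S.Ψ j 0| * ‖x‖ ^ 2 ≥ 0 := by positivity
  have h7 : K * ‖x‖ ^ 2 ≥ 0 := by positivity
  nlinarith [mul_nonneg hK.le h3]

/-- Terminal values of the adjoint state, tested with a curve of densities. -/
theorem tendsto_integral_cutoff_mul_adjoint (hS : S.Standing) (hp : S.IsAdjoint a m p)
    (hm' : S.IsState a' m') (j : Fin M) (n : ℕ) :
    Tendsto (fun τ => ∫ x, m' j τ x * (cutoff d n x * p j τ x)) (𝓝[<] S.T)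
      (𝓝 (∫ x, m' j S.T x * (cutoff d n x * S.Ψ j x))) := by
  have hTmem : S.T ∈ Icc 0 S.T := ⟨hS.T_pos.le, le_rfl⟩
  have hχc : Continuous (cutoff d n) := (contDiff_two_cutoff n).continuous
  have hΨc := hS.continuous_terminalCost j
  have hcs : HasCompactSupport (cutoff d n) :=
    HasCompactSupport.of_support_subset_isCompact
      (isCompact_closedBall (0 : Pt d) (2 * ((n : ℝ) + 1))) fun x hx => by
        by_contra h
        exact hx (cutoff_eq_zero (by simpa using h))
  obtain ⟨D, hD⟩ := (hχc.mul hΨc).bounded_above_of_compact_support hcs.mul_right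
  have hev : ∀ᶠ τ in 𝓝[<] S.T, τ ∈ Ico 0 S.T := by
    filter_upwards [Ioo_mem_nhdsLT hS.T_pos] with τ hτ using Ioo_subset_Ico_self hτ
  have hle : 𝓝[<] S.T ≤ 𝓝[Icc 0 S.T] S.T := by
    rw [← nhdsWithin_Ioo_eq_nhdsLT hS.T_pos]
    exact nhdsWithin_mono _ Ioo_subset_Icc_self
  -- With the terminal cost frozen, the truncated function is bounded and continuous, so weak
  -- continuity of the state suffices.
  have hlim : Tendsto (fun τ => ∫ x, m' j τ x * (cutoff d n x * S.Ψ j x)) (𝓝[<] S.T)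
      (𝓝 (∫ x, m' j S.T x * (cutoff d n x * S.Ψ j x))) := by
    have := (hm'.weak_continuous j
      (BoundedContinuousFunction.ofNormedAddCommGroup _ (hχc.mul hΨc) D hD)) S.T hTmem
    simp_rw [mul_comm (m' j _ _)]
    exact this.mono_left hle
  -- The remaining error is uniformly small: `p j` is uniformly continuous on a compact set
  -- containing the support of the cutoff, and the densities have mass one.
  have hdiff : Tendsto (fun τ => ∫ x, m' j τ x * (cutoff d n x * (p j τ x - S.Ψ j x))) (𝓝[<] S.T)
      (𝓝 0) := by
    have huc := ((isCompact_Icc (a := 0) (b := S.T)).prod (isCompact_closedBall (0 : Pt d)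
      (2 * ((n : ℝ) + 1)))).uniformContinuousOn_of_continuous
      ((hp.continuous j).mono (prod_mono_right (subset_univ _)))
    rw [Metric.uniformContinuousOn_iff] at huc
    rw [Metric.tendsto_nhds]
    intro ε hε
    obtain ⟨δ, hδ, h⟩ := huc (ε / 2) (by positivity)
    have hnear : ∀ᶠ τ in 𝓝[<] S.T, dist τ S.T < δ :=
      nhdsWithin_le_nhds (Metric.ball_mem_nhds S.T hδ)
    filter_upwards [hev, hnear] with τ hτ hτδ
    have hd := hm'.density j τ (Ico_subset_Icc_self hτ)
    have hpt : ∀ x, |cutoff d n x * (p j τ x - S.Ψ j x)| ≤ ε / 2 := fun x => by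
      by_cases hx : 2 * ((n : ℝ) + 1) < ‖x‖
      · rw [cutoff_eq_zero hx, zero_mul, abs_zero]
        positivity
      · have hxb : x ∈ Metric.closedBall (0 : Pt d) (2 * ((n : ℝ) + 1)) := by
          simpa using hx
        have := h (τ, x) ⟨Ico_subset_Icc_self hτ, hxb⟩ (S.T, x) ⟨hTmem, hxb⟩
          (by simpa [Prod.dist_eq] using hτδ)
        rw [Real.dist_eq] at this
        simp only [uncurry, hp.terminal] at this
        rw [abs_mul]
        refine (mul_le_mul_of_nonneg_right (abs_cutoff_le_one n x) (abs_nonneg _)).trans ?_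
        rw [one_mul]
        exact this.le
    have hb : ‖∫ x, m' j τ x * (cutoff d n x * (p j τ x - S.Ψ j x))‖ ≤ ∫ x, m' j τ x * (ε / 2) := by
      refine norm_integral_le_of_norm_le (hd.integrable.mul_const _)
        (Eventually.of_forall fun x => ?_)
      rw [norm_mul, Real.norm_of_nonneg (hd.nonneg x)]
      exact mul_le_mul_of_nonneg_left (hpt x) (hd.nonneg x)
    rw [integral_mul_const, hd.integral_eq_one, one_mul] at hb
    rw [dist_zero_right]
    linarith
  have hsum := hlim.add hdiff
  rw [add_zero] at hsum
  refine hsum.congr' ?_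
  filter_upwards [hev] with τ hτ
  have hd := hm'.density j τ (Ico_subset_Icc_self hτ)
  obtain ⟨D', hD'⟩ := (hχc.mul (hp.contDiff j τ hτ).continuous).bounded_above_of_compact_support
    hcs.mul_right
  have hi1 : Integrable fun x => m' j τ x * (cutoff d n x * S.Ψ j x) :=
    hd.integrable.mul_bdd (c := D) (hχc.mul hΨc).aestronglyMeasurable (Eventually.of_forall hD)
  have hi2 : Integrable fun x => m' j τ x * (cutoff d n x * p j τ x) :=
    hd.integrable.mul_bdd (c := D') (hχc.mul (hp.contDiff j τ hτ).continuous).aestronglyMeasurable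
      (Eventually.of_forall hD')
  have hi3 : Integrable fun x => m' j τ x * (cutoff d n x * (p j τ x - S.Ψ j x)) :=
    (hi2.sub hi1).congr (Eventually.of_forall fun x => by simp only [Pi.sub_apply]; ring)
  rw [← integral_add hi1 hi3]
  exact integral_congr_ae (Eventually.of_forall fun x => by simp only []; ring)

/-- The bound on `cutoffGap` is uniform up to `T`, so the right side of `duality_cutoff` is a
continuous primitive and both sides converge as `τ` increases to `T`. -/
theorem duality_cutoff_terminal (hS : S.Standing) (ha : ∀ j, S.IsControl (a j))
    (hm : S.IsState a m) (hp : S.IsAdjoint a m p) (ha' : ∀ j, S.IsControl (a' j))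
    (hm' : S.IsState a' m') (j : Fin M) (n : ℕ) :
    (∫ x, m' j S.T x * (cutoff d n x * S.Ψ j x)) - (∫ x, m' j 0 x * (cutoff d n x * p j 0 x)) =
      ∫ z, S.cutoffGap a m p (a' j) j n z.1 z.2 * m' j z.1 z.2 ∂(S.timeVol.prod volume) := by
  obtain ⟨D, hD0, hD⟩ := exists_cutoffGap_bound hS ha hm hp
  have hI := hm'.integrable_mul j (aestronglyMeasurable_cutoffGap hS ha hm hp (ha' j) j n)
      fun t ht x => hD _ (ha' j) j n t (Ioo_subset_Ico_self ht) x
  rw [integral_prod _ hI, ← intervalIntegral_eq_timeVol hS.T_pos.le]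
  set Φ : ℝ → ℝ := fun u => ∫ x, S.cutoffGap a m p (a' j) j n u x * m' j u x with hΦ
  have hΦi : IntegrableOn Φ (uIcc 0 S.T) := by
    rw [uIcc_of_le hS.T_pos.le, integrableOn_Icc_iff_integrableOn_Ioo]
    exact hI.integral_prod_left
  have hcont := intervalIntegral.continuousOn_primitive_interval hΦi S.T (by simp)
  have hle : 𝓝[<] S.T ≤ 𝓝[uIcc 0 S.T] S.T := by
    rw [← nhdsWithin_Ioo_eq_nhdsLT hS.T_pos, uIcc_of_le hS.T_pos.le]
    exact nhdsWithin_mono _ Ioo_subset_Icc_self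
  refine tendsto_nhds_unique ((tendsto_integral_cutoff_mul_adjoint hS hp hm' j n).sub_const _)
    (Tendsto.congr' ?_ (hcont.mono_left hle))
  filter_upwards [Ioo_mem_nhdsLT hS.T_pos] with τ hτ
  exact (duality_cutoff hS ha hm hp ha' hm' j n (Ioo_subset_Ico_self hτ)).symm

theorem tendsto_integral_mul_cutoff {u f : Pt d → ℝ} (hu : IsDensity2 u)
    (hf : Continuous f) {C : ℝ} (hfC : ∀ x, |f x| ≤ C * (1 + ‖x‖) ^ 2) :
    Tendsto (fun n => ∫ x, u x * (cutoff d n x * f x)) atTop (𝓝 (∫ x, u x * f x)) := by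
  have hi : Integrable fun x => f x * u x := hu.integrable_mul hf.aestronglyMeasurable hfC
  refine tendsto_integral_of_dominated_convergence (fun x => ‖f x * u x‖) (fun n => ?_) hi.norm
    (fun n => Eventually.of_forall fun x => ?_) (Eventually.of_forall fun x => ?_)
  · exact hu.measurable.aestronglyMeasurable.mul
      ((contDiff_two_cutoff n).continuous.mul hf).aestronglyMeasurable
  · rw [show u x * (cutoff d n x * f x) = cutoff d n x * (f x * u x) by ring, norm_mul]
    exact mul_le_of_le_one_left (norm_nonneg _) (abs_cutoff_le_one n x)
  · have := ((tendsto_cutoff x).mul_const (f x)).const_mul (u x)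
    rwa [one_mul] at this

/-- Duality between a state `m'` for an arbitrary control `a'` and the adjoint state `p`. -/
theorem state_adjoint_duality (hS : S.Standing) (ha : ∀ j, S.IsControl (a j))
    (hm : S.IsState a m) (hp : S.IsAdjoint a m p) (ha' : ∀ j, S.IsControl (a' j))
    (hm' : S.IsState a' m') (j : Fin M) :
    (∫ x, m' j S.T x * S.Ψ j x) - (∫ x, m' j 0 x * p j 0 x) =
      ∫ z, S.adjointGap a m p (a' j) j z.1 z.2 * m' j z.1 z.2 ∂(S.timeVol.prod volume) := by
  obtain ⟨C, -, hC⟩ := hp.exists_growth hS.T_pos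
  obtain ⟨E, -, hE⟩ := hS.exists_terminalCost_bound j
  obtain ⟨D, hD0, hD⟩ := exists_cutoffGap_bound hS ha hm hp
  have h0 : (0 : ℝ) ∈ Ico 0 S.T := ⟨le_rfl, hS.T_pos⟩
  have hL := (tendsto_integral_mul_cutoff (hm'.density j S.T ⟨hS.T_pos.le, le_rfl⟩)
    (hS.continuous_terminalCost j) hE).sub (tendsto_integral_mul_cutoff
    (hm'.density j 0 (Ico_subset_Icc_self h0)) (hp.contDiff j 0 h0).continuous
    fun x => (hC j 0 h0 x).2.2)
  refine tendsto_nhds_unique (hL.congr fun n =>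
    duality_cutoff_terminal hS ha hm hp ha' hm' j n) ?_
  have hW := (hm'.integrable_weight j).norm.const_mul D
  refine tendsto_integral_of_dominated_convergence _ (fun n => ?_) hW (fun n => ?_) ?_
  · exact (aestronglyMeasurable_cutoffGap hS ha hm hp (ha' j) j n).mul
      (hm'.measurable j).aestronglyMeasurable
  · refine ae_timeVol_prod fun t ht x => ?_
    rw [norm_mul, norm_mul, ← mul_assoc]
    refine mul_le_mul_of_nonneg_right ?_ (norm_nonneg _)
    rw [Real.norm_of_nonneg (by positivity : 0 ≤ (1 + ‖x‖) ^ 2)]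
    exact hD _ (ha' j) j n t (Ioo_subset_Ico_self ht) x
  · refine ae_timeVol_prod fun t ht x => ?_
    -- At a fixed point the sequence is eventually constant: the cutoff is one nearby and the
    -- commutators vanish.
    obtain ⟨N, hN⟩ := exists_nat_gt ‖x‖
    refine tendsto_const_nhds.congr' ?_
    filter_upwards [eventually_ge_atTop N] with n hn
    have hx : ‖x‖ < (n : ℝ) + 1 := by
      have : (N : ℝ) ≤ n := by exact_mod_cast hn
      linarith
    simp only [cutoffGap, cutoff_eq_one hx,
      fun k => cutoffCommutator_eq_zero k (hp.contDiff j t (Ioo_subset_Ico_self ht)) hx]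
    simp

end CrowdModel

/-! ### One-sided derivatives of the total Hamiltonian along segments -/

namespace CrowdModel

open Function Filter Topology

variable {d M : ℕ} {S : CrowdModel d M} {a : Fin M → ℝ → Pt d → Pt d}
  {m p : Fin M → ℝ → Pt d → ℝ}

/-- The coefficient of `m_j` in the Hamiltonian without the interaction term. -/
def localCost (S : CrowdModel d M) (p : Fin M → ℝ → Pt d → ℝ) (j : Fin M) (t : ℝ) (x α : Pt d) :
    ℝ :=
  (1 / 2) * ‖α‖ ^ 2 + inner ℝ (S.b t x α) (gradient (p j t) x)

/-- The interaction term as a bilinear form. -/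
def interaction (S : CrowdModel d M) (m n : Fin M → Pt d → ℝ) (x : Pt d) : ℝ :=
  ∑ j, ∑ k, S.Λ j k * (S.G m x j * n k x)

theorem dotProduct_eq_interaction (m n : Fin M → Pt d → ℝ) (x : Pt d) :
    S.G m x ⬝ᵥ (S.Λ *ᵥ fun j => n j x) = S.interaction m n x := by
  simp only [interaction, dotProduct, Matrix.mulVec, Finset.mul_sum]
  exact Finset.sum_congr rfl fun j _ => Finset.sum_congr rfl fun k _ => by ring

theorem hamiltonian_eq (t : ℝ) (x : Pt d) (α : Fin M → Pt d) (m : Fin M → Pt d → ℝ) :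
    S.hamiltonian t x α m p =
      (∑ j, S.localCost p j t x (α j) * m j x) + S.interaction m m x := by
  rw [hamiltonian, runningCost, dotProduct_eq_interaction, add_right_comm, ← Finset.sum_add_distrib]
  congr 1
  refine Finset.sum_congr rfl fun j _ => ?_
  rw [localCost, real_inner_smul_left]
  ring

/-- Both estimates combine the linear growth of `∇p` with that of the drift or with its Lipschitz
dependence on the control. The Lipschitz estimate will dominate difference quotients along segments
of controls. -/
theorem exists_localCost_bound (hS : S.Standing) (hp : S.IsAdjoint a m p) : ∃ C, 0 ≤ C ∧
    ∀ j, ∀ t ∈ Ico 0 S.T, ∀ x, ∀ α ∈ convexHull ℝ S.A,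
      |S.localCost p j t x α| ≤ C * (1 + ‖x‖) ^ 2 ∧
      ∀ α' ∈ convexHull ℝ S.A,
        |S.localCost p j t x α' - S.localCost p j t x α| ≤ C * (1 + ‖x‖) ^ 2 * ‖α' - α‖ := by
  obtain ⟨K, hK0, hK⟩ := hS.exists_growth
  obtain ⟨C, hC0, hC⟩ := hp.exists_growth hS.T_pos
  refine ⟨K ^ 2 + K + K * C, by positivity, fun j t ht x α hα => ?_⟩
  have hK' := hK t (Ico_subset_Icc_self ht) x
  obtain ⟨h1, h2, -, h4⟩ := hK' α hα
  obtain ⟨hg, -, -⟩ := hC j t ht x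
  have hn := norm_nonneg x
  have hW : (1 : ℝ) ≤ (1 + ‖x‖) ^ 2 := one_le_pow₀ (by linarith)
  constructor
  · refine (abs_add_le _ _).trans ?_
    have e1 : |(1 / 2) * ‖α‖ ^ 2| ≤ (K ^ 2 + K) * (1 + ‖x‖) ^ 2 := by
      rw [abs_of_nonneg (by positivity)]
      have : ‖α‖ ^ 2 ≤ K ^ 2 := by gcongr
      have h0 : (K ^ 2 + K) * 1 ≤ (K ^ 2 + K) * (1 + ‖x‖) ^ 2 := by gcongr
      nlinarith [sq_nonneg ‖α‖]
    have e2 : |inner ℝ (S.b t x α) (gradient (p j t) x)| ≤ K * C * (1 + ‖x‖) ^ 2 := by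
      refine (abs_real_inner_le_norm _ _).trans ?_
      calc _ ≤ (K * (1 + ‖x‖)) * (C * (1 + ‖x‖)) :=
            mul_le_mul h2 hg (norm_nonneg _) (by positivity)
        _ = _ := by ring
    linarith
  · intro α' hα'
    obtain ⟨h1', -, -, -⟩ := hK' α' hα'
    have e0 : S.localCost p j t x α' - S.localCost p j t x α =
        (1 / 2) * (‖α'‖ ^ 2 - ‖α‖ ^ 2) +
          inner ℝ (S.b t x α' - S.b t x α) (gradient (p j t) x) := by
      rw [localCost, localCost, inner_sub_left]
      ring
    have hδ := norm_nonneg (α' - α)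
    have e1 : |(1 / 2) * (‖α'‖ ^ 2 - ‖α‖ ^ 2)| ≤ K * (1 + ‖x‖) ^ 2 * ‖α' - α‖ := by
      rw [abs_mul, abs_of_pos (by norm_num : (0 : ℝ) < 1 / 2), sq_sub_sq, abs_mul,
        abs_of_nonneg (by positivity : 0 ≤ ‖α'‖ + ‖α‖)]
      have h5 := abs_norm_sub_norm_le α' α
      calc 1 / 2 * ((‖α'‖ + ‖α‖) * |‖α'‖ - ‖α‖|) ≤ 1 / 2 * ((K + K) * ‖α' - α‖) := by gcongr
        _ = K * 1 * ‖α' - α‖ := by ring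
        _ ≤ _ := by gcongr
    have e2 : |inner ℝ (S.b t x α' - S.b t x α) (gradient (p j t) x)| ≤
        K * C * (1 + ‖x‖) ^ 2 * ‖α' - α‖ := by
      refine (abs_real_inner_le_norm _ _).trans ?_
      calc _ ≤ (K * ‖α' - α‖) * (C * (1 + ‖x‖)) :=
            mul_le_mul (h4 α' hα') hg (norm_nonneg _) (by positivity)
        _ = K * C * (1 + ‖x‖) * ‖α' - α‖ := by ring
        _ ≤ _ := by
          gcongr
          exact le_self_pow₀ (by linarith) two_ne_zero
    rw [e0]
    refine (abs_add_le _ _).trans ?_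
    have : 0 ≤ K ^ 2 * (1 + ‖x‖) ^ 2 * ‖α' - α‖ := by positivity
    linarith

theorem Standing.differentiableAt_localCost (hS : S.Standing) (j : Fin M) {t : ℝ}
    (ht : t ∈ Icc 0 S.T) (x : Pt d) {α : Pt d} (hα : α ∈ S.A) :
    DifferentiableAt ℝ (S.localCost p j t x) α :=
  ((differentiableAt_id.norm_sq ℝ).const_mul (1 / 2)).add
    ((hS.b_differentiable t ht x α hα).inner ℝ (differentiableAt_const _))

theorem measurable_localCost (hS : S.Standing) (hp : S.IsAdjoint a m p) (j : Fin M) {t : ℝ}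
    (ht : t ∈ Ico 0 S.T) {α : Pt d → Pt d} (hα : Measurable α)
    (hmem : ∀ x, α x ∈ convexHull ℝ S.A) : Measurable fun x => S.localCost p j t x (α x) := by
  have h1 := hS.measurable_drift (Ico_subset_Icc_self ht) hα hmem
  have h2 : Measurable fun x => gradient (p j t) x := by
    refine Continuous.measurable ?_
    unfold gradient
    exact (LinearIsometryEquiv.continuous _).comp
      ((hp.contDiff j t ht).continuous_fderiv two_ne_zero)
  exact ((hα.norm.pow_const 2).const_mul _).add (h1.inner h2)

theorem integrable_localCost_mul (hS : S.Standing) (hp : S.IsAdjoint a m p) (j : Fin M) {t : ℝ}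
    (ht : t ∈ Ico 0 S.T) {α : Pt d → Pt d} (hα : Measurable α)
    (hmem : ∀ x, α x ∈ convexHull ℝ S.A) {u : Pt d → ℝ} (hu : IsDensity2 u) :
    Integrable fun x => S.localCost p j t x (α x) * u x := by
  obtain ⟨C, -, hC⟩ := exists_localCost_bound hS hp
  exact hu.integrable_mul (measurable_localCost hS hp j ht hα hmem).aestronglyMeasurable
    fun x => (hC j t ht x _ (hmem x)).1

theorem Standing.integrable_G_mul (hS : S.Standing) {m : Fin M → Pt d → ℝ} {j : Fin M}
    (hm : IsDensity2 (m j)) {u : Pt d → ℝ} (hu : Integrable u) :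
    Integrable fun x => S.G m x j * u x := by
  obtain ⟨C, -, hC⟩ := hS.exists_G_bound
  exact hu.bdd_mul (c := C) (hS.measurable_G_profile j hm.measurable).aestronglyMeasurable
    (Eventually.of_forall fun x => hC m j hm x)

theorem Standing.integrable_interaction (hS : S.Standing) {m n : Fin M → Pt d → ℝ}
    (hm : m ∈ densityProfiles) (hn : n ∈ densityProfiles) : Integrable (S.interaction m n) :=
  integrable_finsetSum _ fun j _ => integrable_finsetSum _ fun k _ =>
    (hS.integrable_G_mul (hm j) (hn k).integrable).const_mul _

theorem totalHamiltonian_eq (hS : S.Standing) (hp : S.IsAdjoint a m p) {t : ℝ}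
    (ht : t ∈ Ico 0 S.T) {α : Fin M → Pt d → Pt d} (hα : α ∈ S.controlProfiles)
    {u : Fin M → Pt d → ℝ} (hu : u ∈ densityProfiles) :
    S.totalHamiltonian p t α u =
      (∑ j, ∫ x, S.localCost p j t x (α j x) * u j x) + ∫ x, S.interaction u u x := by
  have hI := fun j => integrable_localCost_mul hS hp j ht (hα j).1 (hα j).2 (hu j)
  simp_rw [totalHamiltonian, hamiltonian_eq]
  rw [integral_add (integrable_finsetSum _ fun j _ => hI j) (hS.integrable_interaction hu hu),
    integral_finsetSum _ fun j _ => hI j]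

/-- `G` is linear in the densities, so the interaction is bilinear and a quadratic polynomial along
a segment. -/
theorem Standing.interaction_segment (hS : S.Standing) {m₀ m₁ : Fin M → Pt d → ℝ}
    (h₀ : m₀ ∈ densityProfiles) (h₁ : m₁ ∈ densityProfiles) (ε : ℝ) (x : Pt d) :
    S.interaction ((1 - ε) • m₀ + ε • m₁) ((1 - ε) • m₀ + ε • m₁) x =
      (1 - ε) ^ 2 * S.interaction m₀ m₀ x +
        (1 - ε) * ε * (S.interaction m₀ m₁ x + S.interaction m₁ m₀ x) +
        ε ^ 2 * S.interaction m₁ m₁ x := by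
  have hG : ∀ j, S.G ((1 - ε) • m₀ + ε • m₁) x j = (1 - ε) * S.G m₀ x j + ε * S.G m₁ x j := by
    intro j
    simp only [G, Pi.add_apply, Pi.smul_apply, smul_eq_mul]
    rw [← integral_const_mul, ← integral_const_mul, ← integral_add
      ((hS.integrable_kernel_mul (h₀ j).integrable x).const_mul _)
      ((hS.integrable_kernel_mul (h₁ j).integrable x).const_mul _)]
    congr 1
    funext y
    ring
  simp only [interaction, hG, Pi.add_apply, Pi.smul_apply, smul_eq_mul, Finset.mul_sum,
    ← Finset.sum_add_distrib]
  exact Finset.sum_congr rfl fun j _ => Finset.sum_congr rfl fun k _ => by ring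

theorem integrable_abs_sub_le {u₀ u₁ : Pt d → ℝ} (h₀ : IsDensity2 u₀) (h₁ : IsDensity2 u₁) :
    Integrable fun x => (1 + ‖x‖) ^ 2 * (u₀ x + u₁ x) := by
  simp only [mul_add]
  exact h₀.integrable_weight.add h₁.integrable_weight

/-- The derivative of the local part of the Hamiltonian along a segment. -/
theorem tendsto_localCost_segment (hS : S.Standing) (hp : S.IsAdjoint a m p) (j : Fin M) {t : ℝ}
    (ht : t ∈ Ico 0 S.T) {α₀ α₁ : Pt d → Pt d} (hα₀ : Measurable α₀) (hA : ∀ x, α₀ x ∈ S.A)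
    (hα₁ : Measurable α₁) (hmem : ∀ x, α₁ x ∈ convexHull ℝ S.A) {u₀ u₁ : Pt d → ℝ}
    (h₀ : IsDensity2 u₀) (h₁ : IsDensity2 u₁) :
    Tendsto (fun ε : ℝ => ∫ x, ε⁻¹ * (S.localCost p j t x ((1 - ε) • α₀ x + ε • α₁ x) -
        S.localCost p j t x (α₀ x)) * ((1 - ε) * u₀ x + ε * u₁ x)) (𝓝[>] 0)
      (𝓝 (∫ x, fderiv ℝ (S.localCost p j t x) (α₀ x) (α₁ x - α₀ x) * u₀ x)) := by
  obtain ⟨C, hC0, hC⟩ := exists_localCost_bound hS hp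
  obtain ⟨K, hK0, hK⟩ := hS.exists_growth
  have hA' : ∀ x, α₀ x ∈ convexHull ℝ S.A := fun x => subset_convexHull ℝ _ (hA x)
  have hseg : ∀ ε ∈ Ioo (0 : ℝ) 1, ∀ x, (1 - ε) • α₀ x + ε • α₁ x ∈ convexHull ℝ S.A :=
    fun ε hε x => convex_convexHull ℝ S.A (hA' x) (hmem x) (by linarith [hε.2]) hε.1.le (by ring)
  have hev : ∀ᶠ ε : ℝ in 𝓝[>] 0, ε ∈ Ioo (0 : ℝ) 1 := Ioo_mem_nhdsGT one_pos
  have hid : ∀ (ε : ℝ) x, (1 - ε) • α₀ x + ε • α₁ x = α₀ x + ε • (α₁ x - α₀ x) := fun ε x => by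
    rw [smul_sub, sub_smul, one_smul]
    abel
  -- The dominating function is the Lipschitz bound of the local cost, with `‖α₁ x - α₀ x‖ ≤ K + K`
  -- and the moving density bounded by `u₀ + u₁`.
  refine tendsto_integral_filter_of_dominated_convergence
    (fun x => C * (K + K) * ((1 + ‖x‖) ^ 2 * (u₀ x + u₁ x))) ?_ ?_
    ((integrable_abs_sub_le h₀ h₁).const_mul _) ?_
  · filter_upwards [hev] with ε hε
    have m1 := measurable_localCost hS hp j ht
      ((hα₀.const_smul (1 - ε)).add (hα₁.const_smul ε)) (hseg ε hε)
    have m2 := measurable_localCost hS hp j ht hα₀ hA'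
    exact (((m1.sub m2).const_mul _).mul ((h₀.measurable.const_mul _).add
      (h₁.measurable.const_mul _))).aestronglyMeasurable
  · filter_upwards [hev] with ε hε
    refine Eventually.of_forall fun x => ?_
    have b1 := (hC j t ht x _ (hA' x)).2 _ (hseg ε hε x)
    have hK' := hK t (Ico_subset_Icc_self ht) x
    have b2 : ‖α₁ x - α₀ x‖ ≤ K + K :=
      (norm_sub_le _ _).trans (add_le_add (hK' _ (hmem x)).1 (hK' _ (hA' x)).1)
    have e3 : ‖(1 - ε) • α₀ x + ε • α₁ x - α₀ x‖ = ε * ‖α₁ x - α₀ x‖ := by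
      rw [hid, add_sub_cancel_left, norm_smul, Real.norm_of_nonneg hε.1.le]
    rw [e3] at b1
    have u0 := h₀.nonneg x
    have u1 := h₁.nonneg x
    have b4 : (1 - ε) * u₀ x + ε * u₁ x ≤ u₀ x + u₁ x := by
      nlinarith [mul_nonneg hε.1.le u0, mul_nonneg (sub_nonneg.2 hε.2.le) u1]
    have b5 : 0 ≤ (1 - ε) * u₀ x + ε * u₁ x :=
      add_nonneg (mul_nonneg (sub_nonneg.2 hε.2.le) u0) (mul_nonneg hε.1.le u1)
    rw [norm_mul, norm_mul, Real.norm_of_nonneg b5, norm_inv, Real.norm_of_nonneg hε.1.le]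
    have b6 : ε⁻¹ * ‖S.localCost p j t x ((1 - ε) • α₀ x + ε • α₁ x) -
        S.localCost p j t x (α₀ x)‖ ≤ C * (1 + ‖x‖) ^ 2 * (K + K) := by
      rw [inv_mul_le_iff₀ hε.1]
      refine b1.trans ?_
      calc C * (1 + ‖x‖) ^ 2 * (ε * ‖α₁ x - α₀ x‖) ≤ C * (1 + ‖x‖) ^ 2 * (ε * (K + K)) := by
            have := hε.1.le
            gcongr
        _ = _ := by ring
    calc _ ≤ (C * (1 + ‖x‖) ^ 2 * (K + K)) * (u₀ x + u₁ x) :=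
          mul_le_mul b6 b4 b5 (by positivity)
      _ = _ := by ring
  · refine Eventually.of_forall fun x => ?_
    -- Differentiability is available because the starting control takes values in `A` itself; the
    -- end point need only lie in the hull.
    have hd := (hS.differentiableAt_localCost (p := p) j (Ico_subset_Icc_self ht) x
      (hA x)).hasFDerivAt.hasLineDerivAt (α₁ x - α₀ x)
    have l1 := hd.tendsto_slope_zero_right
    have l2 : Tendsto (fun ε : ℝ => (1 - ε) * u₀ x + ε * u₁ x) (𝓝[>] 0) (𝓝 (u₀ x)) := by
      have : Continuous fun ε : ℝ => (1 - ε) * u₀ x + ε * u₁ x := by fun_prop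
      have h := (this.tendsto 0).mono_left (nhdsWithin_le_nhds (s := Ioi 0))
      simpa using h
    refine (l1.mul l2).congr fun ε => ?_
    rw [hid, smul_eq_mul]

/-- If the total Hamiltonian is convex along a segment, its increment dominates the one-sided
derivative at the left end point. -/
theorem segment_derivative_le (hS : S.Standing) (hp : S.IsAdjoint a m p) {t : ℝ}
    (ht : t ∈ Ico 0 S.T) {α₀ α₁ : Fin M → Pt d → Pt d} (hα₀ : α₀ ∈ S.controlProfiles)
    (hA : ∀ j x, α₀ j x ∈ S.A) (hα₁ : α₁ ∈ S.controlProfiles) {u₀ u₁ : Fin M → Pt d → ℝ}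
    (h₀ : u₀ ∈ densityProfiles) (h₁ : u₁ ∈ densityProfiles)
    (hseg : ∀ ε ∈ Ioo (0 : ℝ) 1,
      (1 - ε) • α₀ + ε • α₁ ∈ S.controlProfiles ∧ (1 - ε) • u₀ + ε • u₁ ∈ densityProfiles ∧
      S.totalHamiltonian p t ((1 - ε) • α₀ + ε • α₁) ((1 - ε) • u₀ + ε • u₁) ≤
        (1 - ε) * S.totalHamiltonian p t α₀ u₀ + ε * S.totalHamiltonian p t α₁ u₁) :
    (∑ j, ∫ x, fderiv ℝ (S.localCost p j t x) (α₀ j x) (α₁ j x - α₀ j x) * u₀ j x) +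
      (∑ j, ((∫ x, S.localCost p j t x (α₀ j x) * u₁ j x) -
        ∫ x, S.localCost p j t x (α₀ j x) * u₀ j x)) +
      ((∫ x, S.interaction u₀ u₁ x) + (∫ x, S.interaction u₁ u₀ x) -
        2 * ∫ x, S.interaction u₀ u₀ x) ≤
      S.totalHamiltonian p t α₁ u₁ - S.totalHamiltonian p t α₀ u₀ := by
  set Q00 := ∫ x, S.interaction u₀ u₀ x
  set Q01 := ∫ x, S.interaction u₀ u₁ x
  set Q10 := ∫ x, S.interaction u₁ u₀ x
  set Q11 := ∫ x, S.interaction u₁ u₁ x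
  have hlim1 := tendsto_finsetSum Finset.univ fun j (_ : j ∈ Finset.univ) =>
    tendsto_localCost_segment hS hp j ht (hα₀ j).1 (hA j) (hα₁ j).1 (hα₁ j).2 (h₀ j) (h₁ j)
  -- This is the difference quotient of the quadratic polynomial of the interaction, since `((1 - ε)
  -- ^ 2 - 1) / ε = ε - 2`.
  have hlim2 : Tendsto (fun ε : ℝ => (ε - 2) * Q00 + (1 - ε) * (Q01 + Q10) + ε * Q11) (𝓝[>] 0)
      (𝓝 (Q01 + Q10 - 2 * Q00)) := by
    have : Continuous fun ε : ℝ => (ε - 2) * Q00 + (1 - ε) * (Q01 + Q10) + ε * Q11 := by fun_prop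
    have h := (this.tendsto 0).mono_left (nhdsWithin_le_nhds (s := Ioi 0))
    convert h using 2
    ring
  -- Convexity bounds the difference quotient by the full increment for every `ε` in `(0, 1)`; the
  -- inequality passes to the limit.
  refine le_of_tendsto ((hlim1.add_const _).add hlim2) ?_
  filter_upwards [Ioo_mem_nhdsGT (one_pos : (0 : ℝ) < 1)] with ε hε
  obtain ⟨s1, s2, s3⟩ := hseg ε hε
  have hε0 : ε ≠ 0 := hε.1.ne'
  have i0 := fun j => integrable_localCost_mul hS hp j ht (hα₀ j).1 (hα₀ j).2 (h₀ j)
  have i1 := fun j => integrable_localCost_mul hS hp j ht (hα₀ j).1 (hα₀ j).2 (h₁ j)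
  have iε := fun j => integrable_localCost_mul hS hp j ht (s1 j).1 (s1 j).2 (s2 j)
  -- The local increment is split into the change of the control, weighted by the moving density,
  -- and the change of the density at the initial control, which is exactly linear in `ε`.
  have hloc : ∀ j, ∫ x, S.localCost p j t x (((1 - ε) • α₀ + ε • α₁) j x) *
        ((1 - ε) • u₀ + ε • u₁) j x =
      (∫ x, S.localCost p j t x (α₀ j x) * u₀ j x) +
        ε * ((∫ x, ε⁻¹ * (S.localCost p j t x ((1 - ε) • α₀ j x + ε • α₁ j x) -
          S.localCost p j t x (α₀ j x)) * ((1 - ε) * u₀ j x + ε * u₁ j x)) +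
        ((∫ x, S.localCost p j t x (α₀ j x) * u₁ j x) -
          ∫ x, S.localCost p j t x (α₀ j x) * u₀ j x)) := by
    intro j
    have e : ∀ x, ε⁻¹ * (S.localCost p j t x ((1 - ε) • α₀ j x + ε • α₁ j x) -
          S.localCost p j t x (α₀ j x)) * ((1 - ε) * u₀ j x + ε * u₁ j x) =
        ε⁻¹ * (S.localCost p j t x (((1 - ε) • α₀ + ε • α₁) j x) *
          ((1 - ε) • u₀ + ε • u₁) j x - ((1 - ε) * (S.localCost p j t x (α₀ j x) * u₀ j x) +
            ε * (S.localCost p j t x (α₀ j x) * u₁ j x))) := fun x => by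
      simp only [Pi.add_apply, Pi.smul_apply, smul_eq_mul]
      ring
    simp_rw [e]
    have i2 : Integrable fun x => (1 - ε) * (S.localCost p j t x (α₀ j x) * u₀ j x) +
            ε * (S.localCost p j t x (α₀ j x) * u₁ j x) :=
      ((i0 j).const_mul _).add ((i1 j).const_mul _)
    rw [integral_const_mul, integral_sub (iε j) i2,
      integral_add ((i0 j).const_mul _) ((i1 j).const_mul _), integral_const_mul,
      integral_const_mul]
    field_simp
    ring
  have hint : ∫ x, S.interaction ((1 - ε) • u₀ + ε • u₁) ((1 - ε) • u₀ + ε • u₁) x =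
      Q00 + ε * ((ε - 2) * Q00 + (1 - ε) * (Q01 + Q10) + ε * Q11) := by
    have j00 := hS.integrable_interaction h₀ h₀
    have j01 := hS.integrable_interaction h₀ h₁
    have j10 := hS.integrable_interaction h₁ h₀
    have j11 := hS.integrable_interaction h₁ h₁
    simp_rw [hS.interaction_segment h₀ h₁]
    have jj : Integrable fun x => S.interaction u₀ u₁ x + S.interaction u₁ u₀ x := j01.add j10
    have k1 : Integrable fun x => (1 - ε) ^ 2 * S.interaction u₀ u₀ x +
        (1 - ε) * ε * (S.interaction u₀ u₁ x + S.interaction u₁ u₀ x) :=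
      (j00.const_mul _).add (jj.const_mul _)
    rw [integral_add k1 (j11.const_mul _),
      integral_add (j00.const_mul _) (jj.const_mul _), integral_const_mul,
      integral_const_mul, integral_const_mul, integral_add j01 j10]
    ring
  have hF0 := totalHamiltonian_eq hS hp ht hα₀ h₀
  have hFε := totalHamiltonian_eq hS hp ht s1 s2
  simp_rw [hloc] at hFε
  rw [Finset.sum_add_distrib, ← Finset.mul_sum, Finset.sum_add_distrib, hint] at hFε
  have hF0' : S.totalHamiltonian p t α₀ u₀ =
      (∑ j, ∫ x, S.localCost p j t x (α₀ j x) * u₀ j x) + Q00 := hF0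
  refine le_of_mul_le_mul_left ?_ hε.1
  linarith

end CrowdModel

/-! ### The first variation and the cost -/

namespace CrowdModel

open Function Filter Topology

variable {d M : ℕ} {S : CrowdModel d M} {a a' : Fin M → ℝ → Pt d → Pt d}
  {m m' p : Fin M → ℝ → Pt d → ℝ}

/-- Only the `j`-th local cost depends on the `j`-th control; the interaction involves no control at
all. -/
theorem dHamiltonian_eq (hS : S.Standing) (j : Fin M) {t : ℝ} (ht : t ∈ Icc 0 S.T) (x : Pt d)
    {α : Fin M → Pt d} (hα : α j ∈ S.A) (u : Fin M → Pt d → ℝ) (w : Pt d) :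
    S.dHamiltonian j t x α u p w = fderiv ℝ (S.localCost p j t x) (α j) w * u j x := by
  have hfun : (fun v => S.hamiltonian t x (update α j v) u p) = fun v =>
      S.localCost p j t x v * u j x + ((∑ i ∈ Finset.univ.erase j,
        S.localCost p i t x (α i) * u i x) + S.interaction u u x) := by
    funext v
    rw [hamiltonian_eq, ← Finset.add_sum_erase _ _ (Finset.mem_univ j), update_self, add_assoc]
    congr 2
    exact Finset.sum_congr rfl fun i hi => by rw [update_of_ne (Finset.ne_of_mem_erase hi)]
  have hd := hS.differentiableAt_localCost (p := p) j ht x hα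
  rw [dHamiltonian, hfun, fderiv_add_const, fderiv_mul_const hd]
  simp [mul_comm]

/-- If the first variation vanishes, the derivative of the Hamiltonian in the direction of any
other control vanishes almost everywhere. -/
theorem FirstVariationVanishes.ae_eq_zero (hS : S.Standing) (ha : ∀ j, S.IsControl (a j))
    (hopt : S.FirstVariationVanishes a m p) (j : Fin M) {α : ℝ → Pt d → Pt d}
    (hα : S.IsControl α) :
    ∀ᵐ z ∂(S.timeVol.prod (volume : Measure (Pt d))),
      fderiv ℝ (S.localCost p j z.1 z.2) (a j z.1 z.2) (α z.1 z.2 - a j z.1 z.2) *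
        m j z.1 z.2 = 0 := by
  classical
  set Dw : (ℝ → Pt d → Pt d) → ℝ × Pt d → ℝ := fun w z => S.dHamiltonian j z.1 z.2
    (fun k => a k z.1 z.2) (fun k => m k z.1) p (w z.1 z.2) with hDw
  have hI : ∀ w, S.IsControl w → Integrable (Dw w) (S.timeVol.prod volume) := fun w hw => by
    rw [timeVol_prod]
    exact (hopt j w hw).1.mono_set (prod_mono_left Ioo_subset_Icc_self)
  have hz : ∀ w, S.IsControl w → ∫ z, Dw w z ∂(S.timeVol.prod volume) = 0 := fun w hw => by
    rw [integral_prod_symm _ (hI w hw), ← (hopt j w hw).2]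
    congr 1
    funext x
    exact (intervalIntegral_eq_timeVol hS.T_pos.le _).symm
  have hdiff : ∀ᵐ z ∂(S.timeVol.prod (volume : Measure (Pt d))), Dw α z - Dw (a j) z = 0 := by
    refine Integrable.ae_eq_zero_of_forall_setIntegral_eq_zero ((hI α hα).sub (hI _ (ha j)))
      fun E hE _ => ?_
    -- Switching from `a j` to `α` on `E` stays in `A` without any convexity. As the variation
    -- vanishes for `w` and for `a j`, the difference integrates to zero over every measurable `E`.
    set w : ℝ → Pt d → Pt d := fun t x => if (t, x) ∈ E then α t x else a j t x with hw
    have hwc : S.IsControl w := by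
      refine ⟨Measurable.ite hE hα.1 (ha j).1, fun t x => ?_⟩
      simp only [hw]
      split_ifs
      exacts [hα.2 t x, (ha j).2 t x]
    have hEq : E.indicator (fun z => Dw α z - Dw (a j) z) = fun z => Dw w z - Dw (a j) z := by
      funext z
      by_cases hzE : z ∈ E
      · simp [hDw, hw, hzE]
      · simp [hDw, hw, hzE]
    rw [← integral_indicator hE, hEq, integral_sub (hI w hwc) (hI _ (ha j)), hz w hwc, hz _ (ha j), sub_zero]
  have hmem : ∀ᵐ z ∂(S.timeVol.prod (volume : Measure (Pt d))), z.1 ∈ Icc 0 S.T :=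
    ae_timeVol_prod fun t ht _ => Ioo_subset_Icc_self ht
  filter_upwards [hdiff, hmem] with z h1 h2
  simp only [hDw] at h1
  rw [dHamiltonian_eq hS j h2 z.2 ((ha j).2 _ _), dHamiltonian_eq hS j h2 z.2 ((ha j).2 _ _),
    ← sub_mul, ← map_sub] at h1
  exact h1

theorem IsControl.mem_controlProfiles (ha : ∀ j, S.IsControl (a j)) (t : ℝ) :
    (fun j => a j t) ∈ S.controlProfiles := fun j =>
  ⟨(ha j).1.comp measurable_prodMk_left, fun x => (ha j).mem_hull t x⟩

theorem IsState.mem_densityProfiles (hm : S.IsState a m) {t : ℝ} (ht : t ∈ Icc 0 S.T) :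
    (fun j => m j t) ∈ densityProfiles := fun j => hm.density j t ht

theorem Standing.integral_interaction (hS : S.Standing) {u v : Fin M → Pt d → ℝ}
    (hu : u ∈ densityProfiles) (hv : v ∈ densityProfiles) :
    ∫ x, S.interaction u v x = ∑ j, ∑ k, S.Λ j k * ∫ x, S.G u x j * v k x := by
  have hI : ∀ j k, Integrable fun x => S.Λ j k * (S.G u x j * v k x) := fun j k =>
    (hS.integrable_G_mul (hu j) (hv k).integrable).const_mul _
  have hI' : ∀ j, Integrable fun x => ∑ k, S.Λ j k * (S.G u x j * v k x) := fun j =>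
    integrable_finsetSum _ fun k _ => hI j k
  simp only [interaction]
  rw [integral_finsetSum _ fun j _ => hI' j]
  refine Finset.sum_congr rfl fun j _ => ?_
  rw [integral_finsetSum _ fun k _ => hI j k]
  exact Finset.sum_congr rfl fun k _ => integral_const_mul _ _

/-- The `Λ` part is the interaction of `u` with `v`; evenness of the kernel turns the `Λᵀ` part into
the interaction with exchanged arguments. -/
theorem Standing.integral_adjointInteraction (hS : S.Standing) {u v : Fin M → Pt d → ℝ}
    (hu : u ∈ densityProfiles) (hv : v ∈ densityProfiles) :
    ∑ j, ∫ x, S.adjointInteraction u j x * v j x =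
      (∫ x, S.interaction u v x) + ∫ x, S.interaction v u x := by
  have hG := fun j k => hS.integrable_G_mul (hu j) (hv k).integrable
  have e2 : ∫ x, S.interaction v u x = ∑ j, ∑ k, S.Λ j k * ∫ x, S.G u x k * v j x := by
    rw [hS.integral_interaction hv hu]
    refine Finset.sum_congr rfl fun j _ => Finset.sum_congr rfl fun k _ => ?_
    rw [hS.integral_G_mul_comm (hv j).integrable (hu k).integrable]
    simp_rw [mul_comm (v j _)]
  have e3 : ∀ j, ∫ x, S.adjointInteraction u j x * v j x =
      ∑ k, (S.Λ k j + S.Λ j k) * ∫ x, S.G u x k * v j x := fun j => by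
    have : ∀ x, S.adjointInteraction u j x * v j x =
        ∑ k, (S.Λ k j + S.Λ j k) * (S.G u x k * v j x) := fun x => by
      rw [adjointInteraction_eq_sum, Finset.sum_mul]
      exact Finset.sum_congr rfl fun k _ => by ring
    simp_rw [this]
    have hI : ∀ k, Integrable fun x => (S.Λ k j + S.Λ j k) * (S.G u x k * v j x) := fun k =>
      (hG k j).const_mul _
    rw [integral_finsetSum _ fun k _ => hI k]
    exact Finset.sum_congr rfl fun k _ => integral_const_mul _ _
  simp_rw [e3, add_mul, Finset.sum_add_distrib]
  rw [hS.integral_interaction hu hv, e2, Finset.sum_comm]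

/-- The Hamiltonian minus its linearization in the densities along the reference control and
state, as a function of the time and the point. -/
def reducedCost (S : CrowdModel d M) (a : Fin M → ℝ → Pt d → Pt d) (m p : Fin M → ℝ → Pt d → ℝ)
    (a' : Fin M → ℝ → Pt d → Pt d) (m' : Fin M → ℝ → Pt d → ℝ) (t : ℝ) (x : Pt d) : ℝ :=
  S.runningCost x (fun j => a' j t x) (fun j => m' j t) +
    ∑ j, S.adjointGap a m p (a' j) j t x * m' j t x

/-- The drift term of the competitor in `adjointGap` completes the running cost to the Hamiltonian;
what is subtracted involves only the reference control and state as coefficients of `m'`. -/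
theorem reducedCost_eq (t : ℝ) (x : Pt d) :
    S.reducedCost a m p a' m' t x =
      S.hamiltonian t x (fun j => a' j t x) (fun j => m' j t) p -
        ∑ j, (S.localCost p j t x (a j t x) * m' j t x +
          S.adjointInteraction (fun k => m k t) j x * m' j t x) := by
  rw [reducedCost, hamiltonian, add_sub_assoc, ← Finset.sum_sub_distrib]
  congr 1
  refine Finset.sum_congr rfl fun j _ => ?_
  rw [adjointGap, localCost, real_inner_smul_left]
  ring

theorem integrable_runningCost (hS : S.Standing) (ha' : ∀ j, S.IsControl (a' j))
    (hm' : S.IsState a' m') :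
    Integrable (fun z : ℝ × Pt d => S.runningCost z.2 (fun j => a' j z.1 z.2)
      fun j => m' j z.1) (S.timeVol.prod volume) := by
  obtain ⟨K, hK0, hK⟩ := hS.exists_growth
  obtain ⟨C, hC0, hC⟩ := hS.exists_G_bound
  have hW : ∀ x : Pt d, (1 : ℝ) ≤ (1 + ‖x‖) ^ 2 := fun x =>
    one_le_pow₀ (by linarith [norm_nonneg x])
  simp only [runningCost, dotProduct_eq_interaction]
  refine Integrable.add (integrable_finsetSum _ fun j _ => ?_)
    (integrable_finsetSum _ fun j _ => integrable_finsetSum _ fun k _ => Integrable.const_mul ?_ _)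
  · have hmeas : Measurable fun z : ℝ × Pt d => (1 / 2) * ‖a' j z.1 z.2‖ ^ 2 := by
      have : Measurable fun z : ℝ × Pt d => a' j z.1 z.2 := (ha' j).1
      fun_prop
    refine hm'.integrable_mul j (φ := fun t x => (1 / 2) * ‖a' j t x‖ ^ 2) (C := (1 / 2) * K ^ 2)
      hmeas.aestronglyMeasurable fun t ht x => ?_
    have := (hK t (Ioo_subset_Icc_self ht) x _ ((ha' j).mem_hull t x)).1
    rw [abs_of_nonneg (by positivity)]
    calc (1 / 2) * ‖a' j t x‖ ^ 2 ≤ (1 / 2) * K ^ 2 * 1 := by rw [mul_one]; gcongr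
      _ ≤ _ := mul_le_mul_of_nonneg_left (hW x) (by positivity)
  · refine hm'.integrable_mul k (φ := fun t x => S.G (fun j => m' j t) x j) (C := C)
      (hS.measurable_G j (hm'.measurable j)).aestronglyMeasurable fun t ht x => ?_
    refine (hC _ j (hm'.density j t (Ioo_subset_Icc_self ht)) x).trans ?_
    exact le_mul_of_one_le_right hC0 (hW x)

theorem integrable_reducedCost (hS : S.Standing) (ha : ∀ j, S.IsControl (a j))
    (hm : S.IsState a m) (hp : S.IsAdjoint a m p) (ha' : ∀ j, S.IsControl (a' j))
    (hm' : S.IsState a' m') :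
    Integrable (uncurry (S.reducedCost a m p a' m')) (S.timeVol.prod volume) := by
  obtain ⟨C, -, hC⟩ := exists_adjointGap_bound hS ha hm hp
  exact (integrable_runningCost hS ha' hm').add (integrable_finsetSum _ fun j _ =>
    hm'.integrable_mul j (aestronglyMeasurable_adjointGap hS ha hm hp (ha' j) j)
      fun t ht x => hC _ (ha' j) j t (Ioo_subset_Ico_self ht) x)

/-- The pairing at time zero depends only on the prescribed initial law, hence is the same for all
competitors. -/
theorem IsState.integral_initial (hm' : S.IsState a' m') {j : Fin M} (h0 : (0 : ℝ) ∈ Icc 0 S.T)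
    (f : Pt d → ℝ) : ∫ x, m' j 0 x * f x = ∫ x, f x ∂(S.μ₀ j) := by
  have hd := hm'.density j 0 h0
  rw [hm'.initial j, integral_withDensity_eq_integral_toReal_smul
    hd.measurable.ennreal_ofReal (Eventually.of_forall fun x => ENNReal.ofReal_lt_top)]
  congr 1
  funext x
  rw [ENNReal.toReal_ofReal (hd.nonneg x), smul_eq_mul]

/-- The cost, rewritten by means of the adjoint state. -/
theorem cost_eq (hS : S.Standing) (ha : ∀ j, S.IsControl (a j))
    (hm : S.IsState a m) (hp : S.IsAdjoint a m p) (ha' : ∀ j, S.IsControl (a' j))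
    (hm' : S.IsState a' m') :
    S.cost a' m' = (∑ j, ∫ x, p j 0 x ∂(S.μ₀ j)) +
      ∫ t, (∫ x, S.reducedCost a m p a' m' t x) ∂S.timeVol := by
  have hTm : S.T ∈ Icc 0 S.T := ⟨hS.T_pos.le, le_rfl⟩
  have h0 : (0 : ℝ) ∈ Icc 0 S.T := ⟨le_rfl, hS.T_pos.le⟩
  obtain ⟨C, -, hC⟩ := exists_adjointGap_bound hS ha hm hp
  have hR := integrable_runningCost hS ha' hm'
  have hgap := fun j => hm'.integrable_mul j (aestronglyMeasurable_adjointGap hS ha hm hp (ha' j) j)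
      fun t ht x => hC _ (ha' j) j t (Ioo_subset_Ico_self ht) x
  have hΨ : ∀ j, Integrable fun x => S.Ψ j x * m' j S.T x := fun j => by
    obtain ⟨E, -, hE⟩ := hS.exists_terminalCost_bound j
    exact (hm'.density j S.T hTm).integrable_mul
      (hS.continuous_terminalCost j).aestronglyMeasurable hE
  -- Duality trades the terminal cost for the common initial term and the integral of the adjoint
  -- gap.
  have hterm : ∀ j, ∫ x, S.Ψ j x * m' j S.T x = (∫ x, p j 0 x ∂(S.μ₀ j)) +
      ∫ z, S.adjointGap a m p (a' j) j z.1 z.2 * m' j z.1 z.2 ∂(S.timeVol.prod volume) := by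
    intro j
    rw [← state_adjoint_duality hS ha hm hp ha' hm' j, hm'.integral_initial h0]
    simp_rw [mul_comm (S.Ψ j _)]
    ring
  have hsum : Integrable (fun z : ℝ × Pt d => ∑ j, S.adjointGap a m p (a' j) j z.1 z.2 *
      m' j z.1 z.2) (S.timeVol.prod volume) := integrable_finsetSum _ fun j _ => hgap j
  rw [← integral_prod (f := fun z : ℝ × Pt d => S.reducedCost a m p a' m' z.1 z.2)
    (integrable_reducedCost hS ha hm hp ha' hm')]
  simp only [reducedCost]
  rw [integral_add hR hsum, integral_finsetSum _ fun j _ => hgap j, integral_prod_symm _ hR, cost]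
  simp_rw [intervalIntegral_eq_timeVol hS.T_pos.le]
  rw [integral_add hR.integral_prod_right (integrable_finsetSum _ fun j _ => hΨ j),
    integral_finsetSum _ fun j _ => hΨ j]
  simp_rw [hterm, Finset.sum_add_distrib]
  ring

/-- The subtracted term is the derivative of the total Hamiltonian in the densities at `(a, m)`,
applied to `m'`; the two interactions come from differentiating a quadratic form. -/
theorem integral_reducedCost (hS : S.Standing) (ha : ∀ j, S.IsControl (a j))
    (hm : S.IsState a m) (hp : S.IsAdjoint a m p) (ha' : ∀ j, S.IsControl (a' j))
    (hm' : S.IsState a' m') {t : ℝ} (ht : t ∈ Ioo 0 S.T) :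
    ∫ x, S.reducedCost a m p a' m' t x =
      S.totalHamiltonian p t (fun j => a' j t) (fun j => m' j t) -
        ((∑ j, ∫ x, S.localCost p j t x (a j t x) * m' j t x) +
          ((∫ x, S.interaction (fun j => m j t) (fun j => m' j t) x) +
            ∫ x, S.interaction (fun j => m' j t) (fun j => m j t) x)) := by
  have ht' := Ioo_subset_Ico_self ht
  have ht'' := Ioo_subset_Icc_self ht
  have hmd := hm.mem_densityProfiles ht''
  have hmd' := hm'.mem_densityProfiles ht''
  have hac := IsControl.mem_controlProfiles ha t
  have hac' := IsControl.mem_controlProfiles ha' t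
  have i1 : ∀ j, Integrable fun x => S.localCost p j t x (a j t x) * m' j t x := fun j =>
    integrable_localCost_mul hS hp j ht' (hac j).1 (hac j).2 (hmd' j)
  have i1' := fun j => integrable_localCost_mul hS hp j ht' (hac' j).1 (hac' j).2 (hmd' j)
  have i2 : ∀ j, Integrable fun x => S.adjointInteraction (fun k => m k t) j x * m' j t x := by
    intro j
    have : ∀ x, S.adjointInteraction (fun k => m k t) j x * m' j t x =
        ∑ k, (S.Λ k j + S.Λ j k) * (S.G (fun k => m k t) x k * m' j t x) := fun x => by
      rw [adjointInteraction_eq_sum, Finset.sum_mul]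
      exact Finset.sum_congr rfl fun k _ => by ring
    simp_rw [this]
    exact integrable_finsetSum _ fun k _ =>
      (hS.integrable_G_mul (hmd k) (hmd' j).integrable).const_mul _
  have iH : Integrable fun x => S.hamiltonian t x (fun j => a' j t x) (fun j => m' j t) p := by
    simp_rw [hamiltonian_eq]
    exact (integrable_finsetSum _ fun j _ => i1' j).add (hS.integrable_interaction hmd' hmd')
  simp_rw [reducedCost_eq]
  have i3 : ∀ j, Integrable fun x => S.localCost p j t x (a j t x) * m' j t x +
      S.adjointInteraction (fun k => m k t) j x * m' j t x := fun j => (i1 j).add (i2 j)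
  rw [integral_sub iH (integrable_finsetSum _ fun j _ => i3 j),
    integral_finsetSum _ fun j _ => i3 j]
  simp_rw [fun j => integral_add (i1 j) (i2 j), Finset.sum_add_distrib]
  rw [hS.integral_adjointInteraction hmd hmd']
  rfl

/-- Convexity of the Hamiltonian, in either sense, and stationarity give the pointwise in time
comparison of the reduced costs. -/
theorem ae_totalHamiltonian_sub_le (hS : S.Standing) (ha : ∀ j, S.IsControl (a j))
    (hm : S.IsState a m) (hp : S.IsAdjoint a m p)
    (hconv : S.HamiltonianConvex p ∨
      (S.HamiltonianSepConvex p ∧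
        ∀ j, ∀ᵐ z : ℝ × Pt d ∂(volume.restrict (Icc 0 S.T ×ˢ univ)), 0 < m j z.1 z.2))
    (hopt : S.FirstVariationVanishes a m p) (ha' : ∀ j, S.IsControl (a' j))
    (hm' : S.IsState a' m') :
    ∀ᵐ t ∂S.timeVol, (∑ j, ((∫ x, S.localCost p j t x (a j t x) * m' j t x) -
        ∫ x, S.localCost p j t x (a j t x) * m j t x)) +
      ((∫ x, S.interaction (fun j => m j t) (fun j => m' j t) x) +
        (∫ x, S.interaction (fun j => m' j t) (fun j => m j t) x) -
        2 * ∫ x, S.interaction (fun j => m j t) (fun j => m j t) x) ≤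
      S.totalHamiltonian p t (fun j => a' j t) (fun j => m' j t) -
        S.totalHamiltonian p t (fun j => a j t) (fun j => m j t) := by
  have hD := fun j => hopt.ae_eq_zero hS ha j (ha' j)
  have hmem : ∀ᵐ t ∂S.timeVol, t ∈ Ioo 0 S.T := ae_restrict_mem measurableSet_Ioo
  rcases hconv with hconv | ⟨hconv, hpos⟩
  · have hD' := ae_all_iff.2 fun j => Measure.ae_ae_of_ae_prod (hD j)
    filter_upwards [hmem, hD'] with t ht hDt
    have ht' := Ioo_subset_Ico_self ht
    have ht'' := Ioo_subset_Icc_self ht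
    obtain ⟨hcs, hc⟩ := hconv t ht'
    have key := segment_derivative_le hS hp ht' (IsControl.mem_controlProfiles ha t)
      (fun j x => (ha j).2 t x) (IsControl.mem_controlProfiles ha' t)
      (hm.mem_densityProfiles ht'') (hm'.mem_densityProfiles ht'') fun ε hε => by
        have h0 : ((fun j => a j t, fun j => m j t) :
            (Fin M → Pt d → Pt d) × (Fin M → Pt d → ℝ)) ∈
            S.controlProfiles ×ˢ densityProfiles :=
          ⟨IsControl.mem_controlProfiles ha t, hm.mem_densityProfiles ht''⟩
        have h1 : ((fun j => a' j t, fun j => m' j t) :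
            (Fin M → Pt d → Pt d) × (Fin M → Pt d → ℝ)) ∈
            S.controlProfiles ×ˢ densityProfiles :=
          ⟨IsControl.mem_controlProfiles ha' t, hm'.mem_densityProfiles ht''⟩
        have e1 : 0 ≤ 1 - ε := by linarith [hε.2]
        have hmem := hcs h0 h1 e1 hε.1.le (by ring)
        exact ⟨hmem.1, hmem.2, hc h0 h1 e1 hε.1.le (by ring)⟩
    -- The control part of the derivative at `(a, m)` is zero by stationarity.
    rw [Finset.sum_eq_zero fun j _ => ?_, zero_add] at key
    · exact key
    · rw [integral_congr_ae (hDt j), integral_zero]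
  · have hD' : ∀ j, ∀ᵐ z ∂(S.timeVol.prod (volume : Measure (Pt d))),
        fderiv ℝ (S.localCost p j z.1 z.2) (a j z.1 z.2) (a' j z.1 z.2 - a j z.1 z.2) = 0 := by
      intro j
      have hpos' : ∀ᵐ z ∂(S.timeVol.prod (volume : Measure (Pt d))), 0 < m j z.1 z.2 := by
        rw [timeVol_prod]
        exact ae_mono (Measure.restrict_mono (prod_mono_left Ioo_subset_Icc_self) le_rfl) (hpos j)
      filter_upwards [hD j, hpos'] with z h1 h2
      exact (mul_eq_zero.1 h1).resolve_right h2.ne'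
    have hD'' := ae_all_iff.2 fun j => Measure.ae_ae_of_ae_prod (hD' j)
    filter_upwards [hmem, hD''] with t ht hDt
    have ht' := Ioo_subset_Ico_self ht
    have ht'' := Ioo_subset_Icc_self ht
    obtain ⟨hca, hcm⟩ := hconv t ht'
    have ha0 := IsControl.mem_controlProfiles ha t
    have ha1 := IsControl.mem_controlProfiles ha' t
    have hm0 := hm.mem_densityProfiles ht''
    have hm1 := hm'.mem_densityProfiles ht''
    have hself : ∀ {V : Type} [AddCommGroup V] [Module ℝ V] (ε : ℝ) (v : V),
        (1 - ε) • v + ε • v = v := fun ε v => by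
      rw [← add_smul, sub_add_cancel, one_smul]
    -- Controls move while the density stays at `m'`; the density terms cancel and the control
    -- derivative is weighted by `m'`.
    have key1 := segment_derivative_le hS hp ht' ha0 (fun j x => (ha j).2 t x) ha1 hm1 hm1
      fun ε hε => by
        have e1 : 0 ≤ 1 - ε := by linarith [hε.2]
        rw [hself]
        exact ⟨(hca _ hm1).1 ha0 ha1 e1 hε.1.le (by ring), hm1,
          (hca _ hm1).2 ha0 ha1 e1 hε.1.le (by ring)⟩
    -- Densities move while the control stays at `a`. The sum of both inequalities telescopes
    -- through the intermediate pair `(a, m')`.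
    have key2 := segment_derivative_le hS hp ht' ha0 (fun j x => (ha j).2 t x) ha0 hm0 hm1
      fun ε hε => by
        have e1 : 0 ≤ 1 - ε := by linarith [hε.2]
        rw [hself]
        exact ⟨ha0, (hcm _ ha0).1 hm0 hm1 e1 hε.1.le (by ring),
          (hcm _ ha0).2 hm0 hm1 e1 hε.1.le (by ring)⟩
    rw [Finset.sum_eq_zero fun j _ => ?_, zero_add] at key1 key2
    · simp only [sub_self, Finset.sum_const_zero, zero_add] at key1
      linarith
    · simp
    · rw [integral_congr_ae ((hDt j).mono fun x hx => by
        rw [hx, zero_mul]), integral_zero]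

end CrowdModel

end

/-! ### Comparison of the costs. -/

theorem theorem4p2 {d M : ℕ} (S : CrowdModel d M) (hS : S.Standing)
    (a : Fin M → ℝ → Pt d → Pt d) (m p : Fin M → ℝ → Pt d → ℝ)
    (ha : ∀ j, S.IsControl (a j)) (hm : S.IsState a m) (hp : S.IsAdjoint a m p)
    (hconv : S.HamiltonianConvex p ∨
      (S.HamiltonianSepConvex p ∧
        ∀ j, ∀ᵐ z : ℝ × Pt d ∂(volume.restrict (Icc 0 S.T ×ˢ univ)), 0 < m j z.1 z.2))
    (hopt : S.FirstVariationVanishes a m p) :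
    S.SolvesOC a m := by
  refine ⟨ha, hm, fun a' m' ha' hm' => ?_⟩
  rw [CrowdModel.cost_eq hS ha hm hp ha hm, CrowdModel.cost_eq hS ha hm hp ha' hm']
  -- The initial terms coincide, so only the reduced costs have to be compared, at almost every
  -- time.
  refine add_le_add_right (integral_mono_ae
    (CrowdModel.integrable_reducedCost hS ha hm hp ha hm).integral_prod_left
    (CrowdModel.integrable_reducedCost hS ha hm hp ha' hm').integral_prod_left ?_) _
  have hmem : ∀ᵐ t ∂S.timeVol, t ∈ Ioo 0 S.T := ae_restrict_mem measurableSet_Ioo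
  filter_upwards [hmem, CrowdModel.ae_totalHamiltonian_sub_le hS ha hm hp hconv hopt ha' hm']
    with t ht h
  have e := CrowdModel.integral_reducedCost hS ha hm hp ha hm ht
  have e' := CrowdModel.integral_reducedCost hS ha hm hp ha' hm' ht
  simp only [Function.uncurry_apply_pair]
  -- In `e` both interactions in the subtracted term are that of `m` with itself, which accounts for
  -- the factor two in `h`.
  rw [Finset.sum_sub_distrib] at h
  linarith
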